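/- Throughout, Banach spaces are complex, $B(X,Y)$ is the space of bounded operators with the operator norm, and locally compact groups are Hausdorff. **Definitions.** Let $G$ be a locally compact group. A *length function* on $G$ is a map $\ell\colon G\to[0,\infty)$ that is bounded on compact subsets and satisfies $\ell(g^{-1})=\ell(g)$ and $\ell(gh)\le \ell(g)+\ell(h)$ for all $g,h\in G$. A *lattice* in $G$ is a discrete subgroup $\Gamma$ such that $G/\Gamma$ carries a $G$-invariant regular Borel probability measure. A *two-step representation* of $G$ is a tuple $(X_0,X_1,X_2,\pi_0,\pi_1)$ where $X_0,X_1,X_2$ are Banach spaces and $\pi_i\colon G\to B(X_i,X_{i+1})$ ($i=0,1$) are strongly continuous maps (i.e. $g\mapsto \pi_i(g)x$ is continuous for every $x\in X_i$) such that $$\pi_1(gg')\pi_0(g'')=\pi_1(g)\pi_0(g'g'')\qquad\text{for all } g,g',g''\in G.$$ Then $\pi\colon G\to B(X_0,X_2)$ denotes the strongly continuous map with $\pi(gg')=\pi_1(g)\pi_0(g')$, and for a compactly supported Borel probability measure $m$ on $G$, $\pi(m)\in B(X_0,X_2)$ is the operator $x\mapsto\int \pi(g)x\,dm(g)$ (Bochner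 integral). Let $\mathcal E$ be a class of Banach spaces and $\ell$ a length function on $G$. The pair $(G,\ell)$ has *property $(*_{\mathcal E})$* if there exist $s,t,C>0$ and a sequence $(m_n)_{n\ge 0}$ of compactly supported Borel probability measures on $G$, with the support of $m_n$ contained in $\{g\in G:\ell(g)\le n\}$, such that the following holds. For every two-step representation $(X_0,X_1,X_2,\pi_0,\pi_1)$ of $G$ with $X_1\in\mathcal E$ and every real number $L$ such that $\|\pi_i(g)\|\le Le^{s\ell(g)}$ for all $g\in G$ and $i\in\{0,1\}$, there is $P\in B(X_0,X_2)$ such that $$\|\pi(m_n)-P\|\le CL^2e^{-tn}\quad\text{for every } n\ge 0,$$ $$\lim_{n\to\infty}\|\pi(\delta_g*m_n*\delta_{g'})-\pi(m_n)\|=0\quad\text{for all } g,g'\in G.$$ The pair $(G,\ell)$ has *property $(*)$* if it has $(*_{\mathcal E})$ for $\mathcal E$ the class of Hilbert spaces. **Theorem.** Let $\Gamma$ be a lattice in a locally compact group $G$ and let $\ell$ be a length function on $G$. Then $(G,\ell)$ has $(*)$ if and only if $(\Gamma,\ell|_\Gamma)$ has $(*)$. More generally, if $\mathcal E$ is a class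 of Banach spaces such that $L_2(\Omega,\mu;X)\in\mathcal E$ for every $X\in\mathcal E$ and every measure space $(\Omega,\mu)$, then $(G,\ell)$ has $(*_{\mathcal E})$ if and only if $(\Gamma,\ell|_\Gamma)$ has $(*_{\mathcal E})$. -/

import Mathlib

open MeasureTheory Filter Topology

universe u

/-- A length function on a topological group `G`: a non-negative function, bounded on compact
subsets, symmetric and subadditive. Neither continuity nor measurability nor `ℓ 1 = 0` is
required. -/
structure LengthFunction (G : Type u) [Group G] [TopologicalSpace G] where
  toFun : G → ℝ
  nonneg : ∀ g, 0 ≤ toFun g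
  bddAbove_image : ∀ K : Set G, IsCompact K → BddAbove (toFun '' K)
  map_inv : ∀ g, toFun g⁻¹ = toFun g
  map_mul_le : ∀ g h, toFun (g * h) ≤ toFun g + toFun h

instance {G : Type u} [Group G] [TopologicalSpace G] :
    CoeFun (LengthFunction G) (fun _ => G → ℝ) :=
  ⟨LengthFunction.toFun⟩

/-- The restriction of a length function to a subgroup. -/
def LengthFunction.restrict {G : Type u} [Group G] [TopologicalSpace G]
    (ℓ : LengthFunction G) (Γ : Subgroup G) : LengthFunction Γ where
  toFun γ := ℓ (γ : G)
  nonneg γ := ℓ.nonneg γ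
  bddAbove_image K hK := by
    have h := ℓ.bddAbove_image _ (hK.image continuous_subtype_val)
    rwa [Set.image_image] at h
  map_inv γ := ℓ.map_inv γ
  map_mul_le γ δ := ℓ.map_mul_le γ δ

/-- A lattice in a topological group: a discrete subgroup `Γ` such that `G ⧸ Γ` (with its Borel
`σ`-algebra) carries a regular probability measure invariant under left translation by `G`. -/
structure IsLatticeSubgroup {G : Type u} [Group G] [TopologicalSpace G] (Γ : Subgroup G) :
    Prop where
  discrete : DiscreteTopology Γ
  exists_invariant : ∃ (_ : MeasurableSpace (G ⧸ Γ)) (_ : BorelSpace (G ⧸ Γ))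
    (μ : Measure (G ⧸ Γ)), IsProbabilityMeasure μ ∧ μ.Regular ∧ SMulInvariantMeasure G (G ⧸ Γ) μ

/-- `𝒫_c(G)`: the compactly supported Borel probability measures on `G`. -/
structure CompactProb (G : Type u) [TopologicalSpace G] [MeasurableSpace G] where
  measure : Measure G
  isProb : IsProbabilityMeasure measure
  exists_compact : ∃ K : Set G, IsCompact K ∧ measure Kᶜ = 0

/-- The support of the measure `m` is contained in `S`: `m` is concentrated on a compact subset
of `S`. -/
def CompactProb.SupportedIn {G : Type u} [TopologicalSpace G] [MeasurableSpace G]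
    (m : CompactProb G) (S : Set G) : Prop :=
  ∃ K : Set G, IsCompact K ∧ K ⊆ S ∧ m.measure Kᶜ = 0

/-- The convolution `δ_g * m * δ_g'`, that is, the image of `m` under `h ↦ g * h * g'`. -/
noncomputable def CompactProb.translate {G : Type u} [Group G] [TopologicalSpace G]
    [IsTopologicalGroup G] [MeasurableSpace G] [BorelSpace G]
    (g : G) (m : CompactProb G) (g' : G) : CompactProb G where
  measure := m.measure.map (fun h => g * h * g')
  isProb := by
    have := m.isProb
    exact Measure.isProbabilityMeasure_map
      (by fun_prop : Continuous fun h : G => g * h * g').measurable.aemeasurable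
  exists_compact := by
    obtain ⟨K, hK, hm⟩ := m.exists_compact
    let e : G ≃ₜ G := (Homeomorph.mulLeft g).trans (Homeomorph.mulRight g')
    refine ⟨e '' K, hK.image e.continuous, ?_⟩
    change m.measure.map e (e '' K)ᶜ = 0
    have h := e.toMeasurableEquiv.map_apply (μ := m.measure) (e '' K)ᶜ
    rw [Homeomorph.toMeasurableEquiv_coe] at h
    rw [h, Set.preimage_compl, e.injective.preimage_image]
    exact hm

/-- The orbit maps of a strongly continuous map are Bochner integrable against compactly
supported probability measures. -/
theorem CompactProb.integrable {G : Type u} [TopologicalSpace G] [T2Space G] [MeasurableSpace G]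
    [BorelSpace G] {Y : Type u} [NormedAddCommGroup Y] (m : CompactProb G) {f : G → Y} (hf : Continuous f) :
    Integrable f m.measure := by
  obtain ⟨K, hK, hm⟩ := m.exists_compact
  have := m.isProb
  have h : IntegrableOn f K m.measure := hf.continuousOn.integrableOn_compact hK
  rwa [IntegrableOn, Measure.restrict_eq_self_of_ae_mem] at h
  exact hm

theorem CompactProb.exists_bound {G : Type u} [TopologicalSpace G] [MeasurableSpace G]
    {X Y : Type u} [NormedAddCommGroup X] [NormedSpace ℂ X] [CompleteSpace X]
    [NormedAddCommGroup Y] [NormedSpace ℂ Y] (m : CompactProb G) (T : G → X →L[ℂ] Y)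
    (hT : ∀ x, Continuous fun g => T g x) :
    ∃ C, ∀ x, ‖∫ g, T g x ∂m.measure‖ ≤ C * ‖x‖ := by
  obtain ⟨K, hK, hm⟩ := m.exists_compact
  have := m.isProb
  obtain ⟨C, hC⟩ := banach_steinhaus (g := fun k : K => T k) (fun x => by
    obtain ⟨B, hB⟩ := hK.exists_bound_of_continuousOn (hT x).continuousOn
    exact ⟨B, fun k => hB k k.2⟩)
  refine ⟨C, fun x => ?_⟩
  have hae : ∀ᵐ g ∂m.measure, ‖T g x‖ ≤ C * ‖x‖ := by
    have hK' : ∀ᵐ g ∂m.measure, g ∈ K := hm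
    filter_upwards [hK'] with g hg
    exact (T g).le_of_opNorm_le (hC ⟨g, hg⟩) x
  simpa using norm_integral_le_of_norm_le_const hae

/-- For a strongly continuous map `T : G → B(X, Y)` and `m ∈ 𝒫_c(G)`, the bounded operator
`T(m) : x ↦ ∫ T(g) x dm(g)` (Bochner integral). -/
noncomputable def strongIntegral {G : Type u} [TopologicalSpace G] [T2Space G]
    [MeasurableSpace G] [BorelSpace G] {X Y : Type u} [NormedAddCommGroup X] [NormedSpace ℂ X]
    [CompleteSpace X] [NormedAddCommGroup Y] [NormedSpace ℂ Y] (T : G → X →L[ℂ] Y)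
    (hT : ∀ x, Continuous fun g => T g x) (m : CompactProb G) : X →L[ℂ] Y :=
  LinearMap.mkContinuousOfExistsBound
    { toFun := fun x => ∫ g, T g x ∂m.measure
      map_add' := fun x y => by
        simp only [map_add]
        exact integral_add (m.integrable (hT x)) (m.integrable (hT y))
      map_smul' := fun c x => by
        simp only [map_smul, RingHom.id_apply]
        exact integral_smul c _ }
    (m.exists_bound T hT)

/-- A two-step representation `(X₀, X₁, X₂, π₀, π₁)` of a topological group `G`. -/
structure TwoStepRep (G : Type u) [Group G] [TopologicalSpace G] (X₀ X₁ X₂ : Type u)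
    [NormedAddCommGroup X₀] [NormedSpace ℂ X₀] [NormedAddCommGroup X₁] [NormedSpace ℂ X₁]
    [NormedAddCommGroup X₂] [NormedSpace ℂ X₂] where
  pi₀ : G → X₀ →L[ℂ] X₁
  pi₁ : G → X₁ →L[ℂ] X₂
  continuous₀ : ∀ x, Continuous fun g => pi₀ g x
  continuous₁ : ∀ x, Continuous fun g => pi₁ g x
  compat : ∀ g g' g'', (pi₁ (g * g')).comp (pi₀ g'') = (pi₁ g).comp (pi₀ (g' * g''))

namespace TwoStepRep

variable {G : Type u} [Group G] [TopologicalSpace G] {X₀ X₁ X₂ : Type u}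
  [NormedAddCommGroup X₀] [NormedSpace ℂ X₀] [NormedAddCommGroup X₁] [NormedSpace ℂ X₁]
  [NormedAddCommGroup X₂] [NormedSpace ℂ X₂]

/-- The map `π : G → B(X₀, X₂)` with `π(g g') = π₁(g) π₀(g')`; see `pi_mul`. -/
def pi (ρ : TwoStepRep G X₀ X₁ X₂) (g : G) : X₀ →L[ℂ] X₂ := (ρ.pi₁ g).comp (ρ.pi₀ 1)

theorem pi_mul (ρ : TwoStepRep G X₀ X₁ X₂) (g g' : G) :
    ρ.pi (g * g') = (ρ.pi₁ g).comp (ρ.pi₀ g') := by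
  rw [pi, ρ.compat, mul_one]

theorem continuous_pi (ρ : TwoStepRep G X₀ X₁ X₂) (x : X₀) : Continuous fun g => ρ.pi g x :=
  ρ.continuous₁ (ρ.pi₀ 1 x)

/-- The operator `π(m) = ∫ π(g) dm(g)` for `m ∈ 𝒫_c(G)`. -/
noncomputable def average [T2Space G] [MeasurableSpace G] [BorelSpace G] [CompleteSpace X₀]
    (ρ : TwoStepRep G X₀ X₁ X₂) (m : CompactProb G) : X₀ →L[ℂ] X₂ :=
  strongIntegral ρ.pi ρ.continuous_pi m

end TwoStepRep

/-- A class of (complex) Banach spaces. It is only ever evaluated at complete spaces. -/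
abbrev BanachClass : Type (u + 1) :=
  ∀ (X : Type u) [NormedAddCommGroup X] [NormedSpace ℂ X], Prop

/-- The class of Hilbert spaces: the norm comes from an inner product, for the given complex
vector space structure. -/
def HilbertClass : BanachClass.{u} := fun X _ hX =>
  ∃ h : InnerProductSpace ℂ X, h.toNormedSpace = hX

/-- `E` is stable under `X ↦ L₂(Ω, μ; X)` for every measure space `(Ω, μ)`. -/
def BanachClass.StableL2 (E : BanachClass.{u}) : Prop :=
  ∀ (X : Type u) [NormedAddCommGroup X] [NormedSpace ℂ X] [CompleteSpace X]
    (Ω : Type u) [MeasurableSpace Ω] (μ : Measure Ω), E X → E (Lp X 2 μ)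

/-- Property `(*_E)` for the pair `(G, ℓ)`. -/
def HasStarFor (G : Type u) [Group G] [TopologicalSpace G] [IsTopologicalGroup G] [T2Space G]
    [MeasurableSpace G] [BorelSpace G] (ℓ : LengthFunction G) (E : BanachClass.{u}) : Prop :=
  ∃ s t C : ℝ, 0 < s ∧ 0 < t ∧ 0 < C ∧ ∃ m : ℕ → CompactProb G,
    (∀ n : ℕ, (m n).SupportedIn {g | ℓ g ≤ n}) ∧
    ∀ (X₀ X₁ X₂ : Type u)
      [NormedAddCommGroup X₀] [NormedSpace ℂ X₀] [CompleteSpace X₀]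
      [NormedAddCommGroup X₁] [NormedSpace ℂ X₁] [CompleteSpace X₁]
      [NormedAddCommGroup X₂] [NormedSpace ℂ X₂] [CompleteSpace X₂]
      (ρ : TwoStepRep G X₀ X₁ X₂) (L : ℝ), E X₁ →
      (∀ g, ‖ρ.pi₀ g‖ ≤ L * Real.exp (s * ℓ g)) →
      (∀ g, ‖ρ.pi₁ g‖ ≤ L * Real.exp (s * ℓ g)) →
      ∃ P : X₀ →L[ℂ] X₂,
        (∀ n : ℕ, ‖ρ.average (m n) - P‖ ≤ C * L ^ 2 * Real.exp (-(t * n))) ∧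
        ∀ g g' : G, Tendsto
          (fun n => ‖ρ.average ((m n).translate g g') - ρ.average (m n)‖) atTop (𝓝 0)

/-- Property `(*)` for the pair `(G, ℓ)`: the case where `X₁` is a Hilbert space. -/
def HasStar (G : Type u) [Group G] [TopologicalSpace G] [IsTopologicalGroup G] [T2Space G]
    [MeasurableSpace G] [BorelSpace G] (ℓ : LengthFunction G) : Prop :=
  HasStarFor G ℓ HilbertClass

/-!
Let `μ` be the invariant probability measure on `G ⧸ Γ`. If all the spaces of the class vanish, so do
all the operators `π(m)`, and either property just says that `ℓ 1 = 0`
(`hasStarFor_of_subsingleton`). Otherwise both implications use a section `σ` of `G → G ⧸ Γ` whose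
values are, up to a constant, of minimal length in their coset (`AlmostMinimalSection`).

**From `G` to `Γ`** (`HasStarFor.restrict`). A two-step representation `ρ` of `Γ` is induced to `G`;
the outer spaces are kept, and `X₁` is replaced by `L²(G ⧸ Γ; X₁)`, which belongs to the class. The
operators are lattice sums `∑_γ f (g σ(q) γ) a γ` for two auxiliary functions `ψ, φ ∈ C_c(G)` in the
place of `f`. The choice of `σ` makes them bounded by a multiple of `e^{2 s ℓ(g)}`, uniformly in `q`,
without any integrability of `ℓ` on `G ⧸ Γ`. Since the composite of the induced operators is
`∑_γ (∫ ψ (g y) φ (y γ) dy) ρ.pi γ`, the average of the induced representation against a measure on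
`G` is an average of `ρ` against a finite positive measure on `Γ`. The limit `P ψ φ` of these averages
is linear, locally bounded and left-invariant in each of `ψ` and `φ`, so it only depends on
their Haar integrals (`weil_smul_comm`: invariant functionals are unique, even if vector-valued and
not positive). In particular it does not change under right translations of `ψ` and `φ` by `Γ`, which
correspond to the translations of the measure on `Γ`. It remains to normalize the measures on `Γ`.
For the trivial representation on a non-zero space of the class, the same argument shows that their
masses converge exponentially fast; the limit is positive, because uniqueness allows one to replace
`φ` by a function whose sum over the lattice is at least `1` on most of `G ⧸ Γ`
(`exists_le_averageMass`).

**From `Γ` to `G`** (`HasStarFor.of_restrict`). Given measures `m n` for `Γ`, the measures for `G` are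
`ν n * m n * ν̌ n`, where `ν n` is a measure on `G` that approximates `μ`. The averages of
`γ ↦ π (g γ g')` against `m n` converge exponentially fast to an operator depending only on the cosets
`g Γ` and `Γ g'` (`StarEstimate.exists_limit`), and its growth in `g` and `g'` is slow if `s` is small
for `G`. So it suffices that `ν n` lives at length `O(n)` and averages right `Γ`-invariant
functions of slow exponential growth with exponentially small errors (`IsQuotientAveraging`). Such
`ν n` exist because the property of `Γ` controls the size of the cusps of `G ⧸ Γ`. Applied to
the translations of `L²(G ⧸ Γ; X)` by `Γ`, it shows that a small subset of `G ⧸ Γ` that is almost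
invariant under a suitable compact set `K` is almost invariant under `Γ`, hence under all of `G`, and
is null by ergodicity (`exists_isCompact_expansion`). Therefore the complement of the image of `K ^ n`
has exponentially small measure (`exists_isCompact_decay`), and `ν n` is the lift by `σ` of the
normalized restriction of `μ` to the image of `K ^ (n + 1)`, up to a small set.
-/

set_option linter.unusedSectionVars false

open scoped CompactlySupported BoundedContinuousFunction Pointwise

/-! ### Sums over a discrete subgroup and the Weil functional -/

section Periodization

variable {G : Type*} [Group G] [TopologicalSpace G] [IsTopologicalGroup G] {Γ : Subgroup G}
  {V : Type*} [NormedAddCommGroup V]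

/-- A point of `G` has a neighbourhood that meets each coset of the discrete subgroup `Γ` at most
once. -/
theorem exists_nhds_injOn_mk [DiscreteTopology Γ] (x : G) :
    ∃ U ∈ 𝓝 x, Set.InjOn (QuotientGroup.mk : G → G ⧸ Γ) U := by
  obtain ⟨V, hV, hVΓ⟩ : ∃ V ∈ 𝓝 (1 : G), ∀ γ : Γ, (γ : G) ∈ V → γ = 1 := by
    have h1 : ({1} : Set Γ) ∈ 𝓝 (1 : Γ) := (isOpen_discrete _).mem_nhds rfl
    rw [nhds_subtype_eq_comap] at h1
    obtain ⟨V, hV, h⟩ := h1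
    exact ⟨V, hV, fun γ hγ => h hγ⟩
  have hc : Tendsto (fun p : G × G => p.1⁻¹ * p.2) (𝓝 (x, x)) (𝓝 1) := by
    have : Continuous fun p : G × G => p.1⁻¹ * p.2 := by fun_prop
    simpa using this.tendsto (x, x)
  have := hc hV
  rw [nhds_prod_eq] at this
  obtain ⟨U, hU, h⟩ := mem_prod_self_iff.1 this
  refine ⟨U, hU, fun a ha b hb hab => ?_⟩
  have h1 := hVΓ ⟨_, QuotientGroup.eq.1 hab⟩ (h (Set.mk_mem_prod ha hb))
  exact inv_mul_eq_one.1 (congrArg Subtype.val h1)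

/-- A compact subset of `G` contains a uniformly bounded number of points of each coset `h Γ`. -/
theorem exists_card_translates_le [DiscreteTopology Γ] {K : Set G} (hK : IsCompact K) :
    ∃ N : ℕ, ∀ (h : G) (s : Finset Γ), (∀ γ ∈ s, h * (γ : G) ∈ K) → s.card ≤ N := by
  classical
  obtain ⟨U, hU, hUΓ⟩ := exists_nhds_injOn_mk (Γ := Γ) (1 : G)
  obtain ⟨t, -, ht⟩ := hK.elim_nhds_subcover (fun k => (fun x => k⁻¹ * x) ⁻¹' U) (fun k _ => by
    have : ContinuousAt (fun x => k⁻¹ * x) k := by fun_prop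
    exact this.preimage_mem_nhds (by simpa using hU))
  refine ⟨t.card, fun h s hs => ?_⟩
  have hex : ∀ γ ∈ s, ∃ k ∈ t, k⁻¹ * (h * (γ : G)) ∈ U := fun γ hγ => by
    simpa using ht (hs γ hγ)
  choose! i hi hiU using hex
  refine Finset.card_le_card_of_injOn i hi fun γ hγ δ hδ hγδ => ?_
  have h1 := hUΓ (hiU γ hγ) (hγδ ▸ hiU δ hδ)
    (by rw [← mul_assoc, ← mul_assoc, QuotientGroup.mk_mul_of_mem _ γ.2, QuotientGroup.mk_mul_of_mem _ δ.2])
  exact Subtype.ext (mul_left_cancel (mul_left_cancel h1))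

theorem finite_translates [DiscreteTopology Γ] {K : Set G} (hK : IsCompact K) (h : G) :
    {γ : Γ | h * (γ : G) ∈ K}.Finite := by
  obtain ⟨N, hN⟩ := exists_card_translates_le (Γ := Γ) hK
  by_contra hinf
  obtain ⟨s, hs, hcard⟩ := Set.Infinite.exists_subset_card_eq hinf (N + 1)
  have := hN h s (fun γ hγ => hs hγ)
  omega

theorem locallyFinite_translates [T2Space G] [LocallyCompactSpace G] [DiscreteTopology Γ]
    {K : Set G} (hK : IsCompact K) :
    LocallyFinite fun γ : Γ => {h : G | h * (γ : G) ∈ K} := by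
  intro h
  obtain ⟨W, hW, hWh⟩ := exists_compact_mem_nhds h
  refine ⟨W, hWh, ((finite_translates (Γ := Γ) (hW.inv.mul hK) 1)).subset ?_⟩
  rintro γ ⟨x, hx, hxW⟩
  exact ⟨x⁻¹, Set.inv_mem_inv.2 hxW, x * γ, hx, by simp⟩

theorem tsum_eq_sum_translates [DiscreteTopology Γ] {K : Set G} (hK : IsCompact K) (h : G)
    (a : Γ → V) (ha : ∀ γ : Γ, h * (γ : G) ∉ K → a γ = 0) :
    ∑' γ, a γ = ∑ γ ∈ (finite_translates (Γ := Γ) hK h).toFinset, a γ :=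
  tsum_eq_sum fun γ hγ => ha γ (by simpa using hγ)

theorem continuous_tsum_translates [T2Space G] [LocallyCompactSpace G] [DiscreteTopology Γ]
    {K : Set G} (hK : IsCompact K) {F : Γ → G → V}
    (hF : ∀ γ, Continuous (F γ)) (h0 : ∀ (γ : Γ) h, h * (γ : G) ∉ K → F γ h = 0) :
    Continuous fun h => ∑' γ, F γ h := by
  have hsupp : LocallyFinite fun γ : Γ => Function.support (F γ) :=
    (locallyFinite_translates (Γ := Γ) hK).subset fun γ h hh => by
      by_contra hc
      exact hh (h0 γ h hc)
  refine (continuous_finsum hF hsupp).congr fun h => ?_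
  refine (tsum_eq_finsum ?_).symm
  refine (finite_translates (Γ := Γ) hK h).subset fun γ hγ => ?_
  by_contra hc
  exact hγ (h0 γ h hc)

theorem norm_tsum_translates_le [DiscreteTopology Γ] {K : Set G} {N : ℕ}
    (hK : IsCompact K) (hN : ∀ (h : G) (s : Finset Γ), (∀ γ ∈ s, h * (γ : G) ∈ K) → s.card ≤ N)
    {h : G} {a : Γ → V} {B : ℝ} (hB : 0 ≤ B)
    (ha : ∀ γ : Γ, h * (γ : G) ∉ K → a γ = 0) (hle : ∀ γ : Γ, h * (γ : G) ∈ K → ‖a γ‖ ≤ B) :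
    ‖∑' γ, a γ‖ ≤ N * B := by
  rw [tsum_eq_sum_translates hK h a ha]
  refine (norm_sum_le_of_le _ (f := a) (n := fun _ => B) fun γ hγ => hle γ (by simpa using hγ)).trans ?_
  rw [Finset.sum_const, nsmul_eq_mul]
  gcongr
  exact hN h _ fun γ hγ => by simpa using hγ

/-- The function `g Γ ↦ ∑_γ f (g γ)` on `G ⧸ Γ`, defined by means of a representative of each coset;
`periodize_mk` says that the choice of representative does not matter. -/
noncomputable def periodize (Γ : Subgroup G) (f : G → V) (q : G ⧸ Γ) : V :=
  ∑' γ : Γ, f (q.out * γ)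

theorem periodize_mk (f : G → V) (g : G) : periodize Γ f (g : G ⧸ Γ) = ∑' γ : Γ, f (g * γ) := by
  obtain ⟨δ, hδ⟩ := QuotientGroup.mk_out_eq_mul Γ g
  rw [periodize, hδ]
  exact (Equiv.mulLeft δ).tsum_eq (fun γ : Γ => f (g * γ)) ▸ by simp [mul_assoc]

theorem periodize_mul_left (f : G → V) (k : G) (q : G ⧸ Γ) :
    periodize Γ (fun h => f (k * h)) q = periodize Γ f (k • q) := by
  induction q using QuotientGroup.induction_on with | _ g => ?_
  rw [MulAction.Quotient.smul_coe, periodize_mk, periodize_mk]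
  simp [mul_assoc]

theorem periodize_mul_right (f : G → V) (δ : Γ) :
    periodize Γ (fun h => f (h * δ)) = periodize Γ f := by
  ext q
  induction q using QuotientGroup.induction_on with | _ g => ?_
  rw [periodize_mk, periodize_mk]
  exact (Equiv.mulRight δ).tsum_eq (fun γ : Γ => f (g * γ)) ▸ by simp [mul_assoc]

variable [T2Space G] [LocallyCompactSpace G] [DiscreteTopology Γ]

theorem continuous_periodize {f : G → V} (hf : Continuous f) (hc : HasCompactSupport f) :
    Continuous (periodize Γ f) := by
  refine (QuotientGroup.isQuotientMap_mk (N := Γ)).continuous_iff.2 ?_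
  have : (periodize Γ f) ∘ (QuotientGroup.mk : G → G ⧸ Γ) = fun h => ∑' γ : Γ, f (h * γ) := by
    ext h; exact periodize_mk f h
  rw [this]
  exact continuous_tsum_translates hc (F := fun γ h => f (h * γ)) (fun γ => by fun_prop)
    fun γ h hh => image_eq_zero_of_notMem_tsupport hh

theorem hasCompactSupport_periodize {f : G → V} (hc : HasCompactSupport f) :
    HasCompactSupport (periodize Γ f) := by
  refine HasCompactSupport.intro (K := (QuotientGroup.mk : G → G ⧸ Γ) '' tsupport f)
    (hc.isCompact.image QuotientGroup.continuous_mk) fun q hq => ?_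
  induction q using QuotientGroup.induction_on with | _ g => ?_
  rw [periodize_mk]
  refine (tsum_congr fun γ => image_eq_zero_of_notMem_tsupport fun hγ => hq ⟨_, hγ, ?_⟩).trans tsum_zero
  simp

theorem summable_translates {f : G → V} (hc : HasCompactSupport f) (h : G) :
    Summable fun γ : Γ => f (h * γ) :=
  summable_of_hasFiniteSupport ((finite_translates (Γ := Γ) hc h).subset fun γ hγ => by
    by_contra hcon
    exact hγ (image_eq_zero_of_notMem_tsupport hcon))

/-- The Weil functional `f ↦ ∫_{G ⧸ Γ} ∑_γ f (g γ) dμ(g Γ)`: for an invariant `μ` it is the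
integral of `f` against a Haar measure of `G`. -/
noncomputable def weil [NormedSpace ℝ V] [MeasurableSpace (G ⧸ Γ)] (μ : Measure (G ⧸ Γ)) (f : G → V) : V :=
  ∫ q, periodize Γ f q ∂μ

variable [NormedSpace ℝ V] [MeasurableSpace (G ⧸ Γ)] [BorelSpace (G ⧸ Γ)] (μ : Measure (G ⧸ Γ))

theorem integrable_periodize [IsFiniteMeasure μ] {f : G → V} (hf : Continuous f)
    (hc : HasCompactSupport f) : Integrable (periodize Γ f) μ :=
  (continuous_periodize hf hc).integrable_of_hasCompactSupport (hasCompactSupport_periodize hc)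

theorem weil_mul_left [SMulInvariantMeasure G (G ⧸ Γ) μ] (f : G → V) (k : G) :
    weil μ (fun h => f (k * h)) = weil μ f := by
  simp only [weil, periodize_mul_left]
  exact integral_smul_eq_self (periodize Γ f)

theorem weil_mul_right (f : G → V) (δ : Γ) : weil μ (fun h => f (h * δ)) = weil μ f := by
  simp only [weil, periodize_mul_right]

theorem weil_sub [IsFiniteMeasure μ] {f f' : G → V} (hf : Continuous f) (hc : HasCompactSupport f)
    (hf' : Continuous f') (hc' : HasCompactSupport f') :
    weil μ (fun h => f h - f' h) = weil μ f - weil μ f' := by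
  rw [weil, weil, weil, ← integral_sub (integrable_periodize μ hf hc) (integrable_periodize μ hf' hc')]
  congr 1; ext q
  exact (summable_translates hc _).tsum_sub (summable_translates hc' _)

theorem weil_add [IsFiniteMeasure μ] {f f' : G → V} (hf : Continuous f) (hc : HasCompactSupport f)
    (hf' : Continuous f') (hc' : HasCompactSupport f') :
    weil μ (fun h => f h + f' h) = weil μ f + weil μ f' := by
  rw [weil, weil, weil, ← integral_add (integrable_periodize μ hf hc) (integrable_periodize μ hf' hc')]
  congr 1; ext q
  exact (summable_translates hc _).tsum_add (summable_translates hc' _)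

theorem weil_const_smul (c : ℝ) (f : G → V) :
    weil μ (fun h => c • f h) = c • weil μ f := by
  rw [weil, weil, ← integral_smul]
  congr 1; ext q
  exact tsum_const_smul'' c

theorem weil_clm {V' : Type*} [NormedAddCommGroup V'] [NormedSpace ℝ V'] [CompleteSpace V]
    [CompleteSpace V'] [IsFiniteMeasure μ] (L : V →L[ℝ] V') {f : G → V} (hf : Continuous f)
    (hc : HasCompactSupport f) : weil μ (fun h => L (f h)) = L (weil μ f) := by
  rw [weil, weil, ← L.integral_comp_comm (integrable_periodize μ hf hc)]
  congr 1; ext q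
  exact (L.map_tsum (summable_translates hc _)).symm

theorem weil_mono [IsFiniteMeasure μ] {f f' : G → ℝ} (hf : Continuous f)
    (hc : HasCompactSupport f) (hf' : Continuous f') (hc' : HasCompactSupport f')
    (h : ∀ x, f x ≤ f' x) : weil μ f ≤ weil μ f' :=
  integral_mono (integrable_periodize μ hf hc) (integrable_periodize μ hf' hc') fun _ =>
    (summable_translates hc _).tsum_le_tsum (fun _ => h _) (summable_translates hc' _)

theorem weil_nonneg {f : G → ℝ} (h : ∀ x, 0 ≤ f x) : 0 ≤ weil μ f :=
  integral_nonneg fun _ => tsum_nonneg fun _ => h _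

theorem abs_weil_le [IsFiniteMeasure μ] {f f' : G → ℝ} (hf : Continuous f)
    (hc : HasCompactSupport f) (hf' : Continuous f') (hc' : HasCompactSupport f')
    (h : ∀ x, |f x| ≤ f' x) : |weil μ f| ≤ weil μ f' := by
  refine abs_le.2 ⟨?_, weil_mono μ hf hc hf' hc' fun x => (le_abs_self _).trans (h x)⟩
  have h1 := weil_const_smul μ (-1) f'
  have h2 := weil_mono μ (f := fun x => (-1 : ℝ) • f' x) (by fun_prop) (hc'.smul_left (f := fun _ => (-1 : ℝ))) hf hc
    fun x => by have := (abs_le.1 (h x)).1; simpa using this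
  rw [h1] at h2
  simpa using h2

/-- An invariant measure on the homogeneous space `G ⧸ Γ` charges every non-empty open set. -/
theorem weil_pos [IsFiniteMeasure μ] [NeZero μ] [μ.Regular] [SMulInvariantMeasure G (G ⧸ Γ) μ]
    {f : G → ℝ} (hf : Continuous f)
    (hc : HasCompactSupport f) (h : ∀ x, 0 ≤ f x) {x : G} (hx : 0 < f x) : 0 < weil μ f := by
  have : μ.IsOpenPosMeasure :=
    ⟨fun U hU hne =>
      (measure_isOpen_pos_of_smulInvariant_of_ne_zero G (NeZero.ne μ) hU hne).ne'⟩
  refine (continuous_periodize hf hc).integral_pos_of_hasCompactSupport_nonneg_nonzero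
    (hasCompactSupport_periodize hc) (fun q => tsum_nonneg fun _ => h _) (x := (x : G ⧸ Γ)) ?_
  rw [periodize_mk]
  refine ((hx.trans_le ?_)).ne'
  simpa using (summable_translates (Γ := Γ) hc x).le_tsum 1 fun γ _ => h _

end Periodization

/-! ### Uniqueness of invariant functionals -/

section Uniqueness

variable {G : Type*} [Group G] [TopologicalSpace G] [IsTopologicalGroup G]

/-- The left translate `h ↦ f (k h)` of a compactly supported continuous function. -/
def CompactlySupportedContinuousMap.mulLeft {E : Type*} [TopologicalSpace E] [Zero E]
    (f : C_c(G, E)) (k : G) : C_c(G, E) where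
  toFun h := f (k * h)
  continuous_toFun := by fun_prop
  hasCompactSupport' := f.hasCompactSupport.comp_homeomorph (Homeomorph.mulLeft k)

/-- The right translate `h ↦ f (h k)` of a compactly supported continuous function. -/
def CompactlySupportedContinuousMap.mulRight {E : Type*} [TopologicalSpace E] [Zero E]
    (f : C_c(G, E)) (k : G) : C_c(G, E) where
  toFun h := f (h * k)
  continuous_toFun := by fun_prop
  hasCompactSupport' := f.hasCompactSupport.comp_homeomorph (Homeomorph.mulRight k)

@[simp] theorem CompactlySupportedContinuousMap.mulLeft_apply {E : Type*} [TopologicalSpace E]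
    [Zero E] (f : C_c(G, E)) (k h : G) : f.mulLeft k h = f (k * h) := rfl

@[simp] theorem CompactlySupportedContinuousMap.mulRight_apply {E : Type*} [TopologicalSpace E]
    [Zero E] (f : C_c(G, E)) (k h : G) : f.mulRight k h = f (h * k) := rfl

variable [T2Space G] [LocallyCompactSpace G]

/-- Left translation is continuous for the supremum norm on compactly supported functions. -/
theorem eventually_norm_mulLeft_sub_lt {E : Type*} [NormedAddCommGroup E] {f : G → E}
    (hf : Continuous f)
    (hc : HasCompactSupport f) (g₀ : G) {ε : ℝ} (hε : 0 < ε) :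
    ∀ᶠ g in 𝓝 g₀, ∀ h, ‖f (g * h) - f (g₀ * h)‖ < ε := by
  obtain ⟨W, hW, hWg⟩ := exists_compact_mem_nhds g₀
  have hK : IsCompact (W⁻¹ * tsupport f) := hW.inv.mul hc.isCompact
  obtain ⟨v, hv, h⟩ := hK.mem_uniformity_of_prod (f := fun g h => f (g * h)) (s := Set.univ)
    (q := g₀) (u := {p | dist p.1 p.2 < ε}) (by fun_prop) (Set.mem_univ _)
    (Metric.dist_mem_uniformity hε)
  rw [nhdsWithin_univ] at hv
  filter_upwards [hv, hWg] with g hg hgW x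
  by_cases hx : x ∈ W⁻¹ * tsupport f
  · simpa [dist_eq_norm] using h g hg x hx
  · have h1 : ∀ y ∈ W, f (y * x) = 0 := fun y hy => image_eq_zero_of_notMem_tsupport fun hcon =>
      hx ⟨y⁻¹, Set.inv_mem_inv.2 hy, y * x, hcon, by simp⟩
    rw [h1 g hgW, h1 g₀ (mem_of_mem_nhds hWg)]
    simpa using hε

/-- Right translation is continuous for the supremum norm on compactly supported functions. -/
theorem eventually_norm_mulRight_sub_lt {E : Type*} [NormedAddCommGroup E] {f : G → E}
    (hf : Continuous f) (hc : HasCompactSupport f) {ε : ℝ} (hε : 0 < ε) :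
    ∀ᶠ g in 𝓝 (1 : G), ∀ h, ‖f (h * g) - f h‖ < ε := by
  have h := eventually_norm_mulLeft_sub_lt (f := fun x => f x⁻¹) (by fun_prop)
    (hc.comp_homeomorph (Homeomorph.inv G)) 1 hε
  have h2 : Tendsto (fun g : G => g⁻¹) (𝓝 1) (𝓝 1) := by
    simpa using (continuous_inv (G := G)).tendsto 1
  filter_upwards [h2.eventually h] with g hg x
  simpa using hg x⁻¹

/-- For every neighbourhood of `1` there is a non-negative bump function supported in it. -/
theorem exists_bump {U : Set G} (hU : U ∈ 𝓝 (1 : G)) :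
    ∃ χ : C_c(G, ℝ), (∀ x, 0 ≤ χ x) ∧ χ 1 = 1 ∧ ∀ x, χ x ≠ 0 → x ∈ U := by
  obtain ⟨f, h1, h0, hc, hI⟩ := exists_continuous_one_zero_of_isCompact (isCompact_singleton (x := (1 : G)))
    (isOpen_interior (s := U)).isClosed_compl (by
      simpa [Set.disjoint_left] using mem_interior_iff_mem_nhds.2 hU)
  refine ⟨⟨f, hc⟩, fun x => (hI x).1, h1 rfl, fun x hx => ?_⟩
  by_contra hxU
  exact hx (h0 fun h => hxU (interior_subset h))

/-- A compact set has a compactly supported cutoff function. -/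
theorem exists_cutoff {K : Set G} (hK : IsCompact K) :
    ∃ κ : C_c(G, ℝ), (∀ x ∈ K, κ x = 1) ∧ (∀ x, 0 ≤ κ x) ∧ ∀ x, κ x ≤ 1 := by
  obtain ⟨f, h1, -, hc, hI⟩ := exists_continuous_one_zero_of_isCompact hK isClosed_empty
    (Set.disjoint_empty K)
  exact ⟨⟨f, hc⟩, fun x hx => h1 hx, fun x => (hI x).1, fun x => (hI x).2⟩

variable {Γ : Subgroup G} [DiscreteTopology Γ] {V : Type*} [NormedAddCommGroup V] [NormedSpace ℝ V] [CompleteSpace V]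
  [MeasurableSpace (G ⧸ Γ)] [BorelSpace (G ⧸ Γ)] (μ : Measure (G ⧸ Γ)) [IsFiniteMeasure μ]
  [μ.Regular] [NeZero μ] [SMulInvariantMeasure G (G ⧸ Γ) μ]

/-- A linear map on `C_c(G)` that is bounded for the supremum norm on functions supported in a given
compact set, cut off so as to be defined on bounded functions. -/
theorem exists_clm_cutoff (I : C_c(G, ℝ) →ₗ[ℝ] V)
    (hb : ∀ K, IsCompact K → ∃ C, ∀ f : C_c(G, ℝ), (∀ x ∉ K, f x = 0) → (∀ x, |f x| ≤ 1) →
      ‖I f‖ ≤ C) (κ : C_c(G, ℝ)) (hκ0 : ∀ x, 0 ≤ κ x) (hκ1 : ∀ x, κ x ≤ 1) :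
    ∃ J : (G →ᵇ ℝ) →L[ℝ] V, ∀ (b : G →ᵇ ℝ), J b = I (b • κ) := by
  obtain ⟨C, hC⟩ := hb _ κ.hasCompactSupport
  refine ⟨LinearMap.mkContinuous
    { toFun := fun b => I (b • κ)
      map_add' := fun b b' => by
        rw [← map_add]; congr 1; ext x
        simp [add_mul]
      map_smul' := fun c b => by
        rw [RingHom.id_apply, ← map_smul]; congr 1; ext x
        simp [mul_assoc] } C fun b => ?_, fun b => rfl⟩
  change ‖I (b • κ)‖ ≤ C * ‖b‖
  rcases eq_or_ne b 0 with rfl | hb0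
  · have : ((0 : G →ᵇ ℝ) • κ : C_c(G, ℝ)) = 0 := by ext x; simp
    simp [this]
  have hpos : 0 < ‖b‖ := norm_pos_iff.2 hb0
  have h1 := hC (‖b‖⁻¹ • (b • κ)) (fun x hx => by
      simp [image_eq_zero_of_notMem_tsupport hx]) (fun x => by
      have h2 : |b x| ≤ ‖b‖ := b.norm_coe_le_norm x
      have h3 : |κ x| ≤ 1 := abs_le.2 ⟨by linarith [hκ0 x], hκ1 x⟩
      simp only [CompactlySupportedContinuousMap.coe_smul, Pi.smul_apply, smul_eq_mul,
        CompactlySupportedContinuousMap.coe_smulc, abs_mul, abs_inv, abs_norm]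
      rw [inv_mul_le_iff₀ hpos, mul_one]
      nlinarith [abs_nonneg (b x), abs_nonneg (κ x)])
  rw [map_smul, norm_smul, norm_inv, norm_norm, inv_mul_le_iff₀ hpos] at h1
  linarith

/-- The function `k ↦ f k • χ (k⁻¹ ·)` with values in the bounded continuous functions. -/
noncomputable def smulTranslate (f χ : C_c(G, ℝ)) (k : G) : G →ᵇ ℝ :=
  f k • (χ.mulLeft k⁻¹).toBoundedContinuousFunction

theorem smulTranslate_apply (f χ : C_c(G, ℝ)) (k h : G) :
    smulTranslate f χ k h = f k * χ (k⁻¹ * h) := rfl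

theorem continuous_smulTranslate (f χ : C_c(G, ℝ)) : Continuous (smulTranslate f χ) := by
  refine f.continuous.smul ?_
  refine continuous_iff_continuousAt.2 fun g => ?_
  refine Metric.tendsto_nhds.2 fun ε hε => ?_
  have h2 : Tendsto (fun g : G => g⁻¹) (𝓝 g) (𝓝 g⁻¹) := continuous_inv.tendsto g
  filter_upwards [h2.eventually (eventually_norm_mulLeft_sub_lt χ.continuous χ.hasCompactSupport g⁻¹ (half_pos hε))]
    with k hk
  refine ((BoundedContinuousFunction.dist_le (half_pos hε).le).2 fun x => ?_).trans_lt (half_lt_self hε)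
  rw [dist_eq_norm]
  exact (hk x).le

theorem hasCompactSupport_smulTranslate (f χ : C_c(G, ℝ)) :
    HasCompactSupport (smulTranslate f χ) :=
  f.hasCompactSupport.smul_right

/-- Approximation of `f` by averages of left translates of a bump function `χ`: the integral of
`k ↦ f k • χ (k⁻¹ ·)` is close to a multiple of `f` when `χ` is supported near `1`. -/
theorem norm_weil_smulTranslate_sub_le (f χ : C_c(G, ℝ)) (hχ : ∀ x, 0 ≤ χ x) {ε : ℝ} (hε : 0 ≤ ε)
    (hf : ∀ u, χ u ≠ 0 → ∀ k, |f (k * u) - f k| ≤ ε) :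
    ‖weil μ (smulTranslate f χ) - weil μ (fun k => χ k⁻¹) • f.toBoundedContinuousFunction‖
      ≤ ε * weil μ (fun k => χ k⁻¹) := by
  have hχc : HasCompactSupport fun k => χ k⁻¹ :=
    χ.hasCompactSupport.comp_homeomorph (Homeomorph.inv G)
  refine (BoundedContinuousFunction.norm_le (mul_nonneg hε (weil_nonneg μ fun _ => hχ _))).2
    fun h => ?_
  have e1 : weil μ (smulTranslate f χ) h = weil μ fun k => f k * χ (k⁻¹ * h) :=
    (weil_clm μ (BoundedContinuousFunction.evalCLM ℝ h) (continuous_smulTranslate f χ)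
      (hasCompactSupport_smulTranslate f χ)).symm
  have hc2 : HasCompactSupport fun k => χ (k⁻¹ * h) := by
    have := hχc.comp_homeomorph (Homeomorph.mulLeft h⁻¹)
    convert this using 2 with k
    simp
  have e2 : weil μ (fun k => χ k⁻¹) = weil μ fun k => χ (k⁻¹ * h) := by
    rw [← weil_mul_left μ (fun k => χ k⁻¹) h⁻¹]
    simp
  have e3 : weil μ (fun k => χ k⁻¹) * f h = weil μ fun k => f h * χ (k⁻¹ * h) := by
    rw [e2, mul_comm]
    exact (weil_const_smul μ (f h) fun k => χ (k⁻¹ * h)).symm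
  change ‖weil μ (smulTranslate f χ) h - weil μ (fun k => χ k⁻¹) * f h‖ ≤ _
  rw [e1, e3, e2, ← weil_sub μ (f := fun k => f k * χ (k⁻¹ * h))
    (f' := fun k => f h * χ (k⁻¹ * h)) (by fun_prop) (f.hasCompactSupport.mul_right) (by fun_prop)
    (hc2.mul_left), Real.norm_eq_abs]
  have e4 : ε * weil μ (fun k => χ (k⁻¹ * h)) = weil μ (fun k => ε * χ (k⁻¹ * h)) :=
    (weil_const_smul μ ε fun k => χ (k⁻¹ * h)).symm
  rw [e4]
  refine abs_weil_le μ (by fun_prop) ((f.hasCompactSupport.mul_right).sub hc2.mul_left)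
    (by fun_prop) hc2.mul_left fun k => ?_
  rw [← sub_mul, abs_mul, abs_of_nonneg (hχ _)]
  by_cases h0 : χ (k⁻¹ * h) = 0
  · simp [h0]
  · have := hf _ h0 k
    rw [mul_inv_cancel_left, abs_sub_comm] at this
    gcongr
    exact hχ _

/-- **Uniqueness of the invariant functional**, for vector-valued functionals that need not be
positive: a left-invariant locally bounded linear map on `C_c(G)` is a multiple of the Weil
functional. -/
theorem weil_smul_comm (I : C_c(G, ℝ) →ₗ[ℝ] V)
    (hb : ∀ K, IsCompact K → ∃ C, ∀ f : C_c(G, ℝ), (∀ x ∉ K, f x = 0) → (∀ x, |f x| ≤ 1) →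
      ‖I f‖ ≤ C)
    (hinv : ∀ f k, I (f.mulLeft k) = I f) (f f' : C_c(G, ℝ)) :
    weil μ f' • I f = weil μ f • I f' := by
  obtain ⟨U₀, hU₀, hU₀1⟩ := exists_compact_mem_nhds (1 : G)
  have hK : IsCompact ((tsupport f ∪ tsupport f') * U₀) :=
    (f.hasCompactSupport.isCompact.union f'.hasCompactSupport.isCompact).mul hU₀
  obtain ⟨κ, hκK, hκ0, hκ1⟩ := exists_cutoff hK
  obtain ⟨J, hJ⟩ := exists_clm_cutoff I hb κ hκ0 hκ1
  -- applying `I` to the approximation of `F` by translates of `χ`, all of which have the same image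
  -- under `I`, compares `I F` with `I χ`
  have key : ∀ F : C_c(G, ℝ), tsupport F ⊆ tsupport f ∪ tsupport f' → ∀ ε > 0, ∀ χ : C_c(G, ℝ),
      (∀ x, 0 ≤ χ x) → (∀ x, χ x ≠ 0 → x ∈ U₀) → (∀ u, χ u ≠ 0 → ∀ k, |F (k * u) - F k| ≤ ε) →
      ‖weil μ F • I χ - weil μ (fun k => χ k⁻¹) • I F‖
        ≤ ‖J‖ * (ε * weil μ (fun k => χ k⁻¹)) := by
    intro F hF ε hε χ hχ hχU hχε
    have h1 : J (weil μ (smulTranslate F χ)) = weil μ F • I χ := by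
      rw [← weil_clm μ J (continuous_smulTranslate F χ) (hasCompactSupport_smulTranslate F χ)]
      have h2 : ∀ k, J (smulTranslate F χ k) =
          (ContinuousLinearMap.id ℝ ℝ).smulRight (I χ) (F k) := by
        intro k
        rw [hJ, ContinuousLinearMap.smulRight_apply, ContinuousLinearMap.id_apply, ← hinv χ k⁻¹, ← map_smul]
        congr 1
        ext x
        simp only [CompactlySupportedContinuousMap.coe_smulc, smulTranslate_apply, smul_eq_mul,
          CompactlySupportedContinuousMap.coe_smul, Pi.smul_apply,
          CompactlySupportedContinuousMap.mulLeft_apply]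
        by_cases h0 : F k * χ (k⁻¹ * x) = 0
        · simp [h0]
        · have hk : k ∈ tsupport F := subset_tsupport _ (left_ne_zero_of_mul h0)
          rw [hκK x ⟨k, hF hk, k⁻¹ * x, hχU _ (right_ne_zero_of_mul h0), by simp⟩, mul_one]
      simp only [h2]
      rw [weil_clm μ (f := F) _ F.continuous F.hasCompactSupport]
      simp
    have h3 : J F.toBoundedContinuousFunction = I F := by
      rw [hJ]
      congr 1
      ext x
      by_cases h0 : F x = 0
      · simp [h0]
      · have hx : x ∈ tsupport F := subset_tsupport _ h0
        have := hκK x ⟨x, hF hx, 1, mem_of_mem_nhds hU₀1, by simp⟩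
        simp [this]
    rw [← h1, ← h3, ← map_smul, ← map_sub]
    exact J.le_of_opNorm_le_of_le le_rfl (norm_weil_smulTranslate_sub_le μ F χ hχ hε.le hχε)
  have hfin : ∀ ε > 0, ‖weil μ f' • I f - weil μ f • I f'‖
      ≤ (‖J‖ * (|weil μ f'| + |weil μ f|)) * ε := by
    intro ε hε
    obtain ⟨χ, hχ, hχ1, hχU⟩ := exists_bump (Filter.inter_mem hU₀1 (Filter.inter_mem
      (eventually_norm_mulRight_sub_lt f.continuous f.hasCompactSupport hε)
      (eventually_norm_mulRight_sub_lt f'.continuous f'.hasCompactSupport hε)))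
    have k1 := key f Set.subset_union_left ε hε χ hχ (fun x hx => (hχU x hx).1)
      fun u hu k => ((hχU u hu).2.1 k).le
    have k2 := key f' Set.subset_union_right ε hε χ hχ (fun x hx => (hχU x hx).1)
      fun u hu k => ((hχU u hu).2.2 k).le
    set c := weil μ (fun k => χ k⁻¹) with hc
    have hcpos : 0 < c := weil_pos μ (by fun_prop)
      (χ.hasCompactSupport.comp_homeomorph (Homeomorph.inv G)) (fun x => hχ _) (x := 1)
      (by simp [hχ1])
    -- eliminate `I χ` between the two comparisons and divide by `c`, which is positive
    have h4 : c • (weil μ f' • I f - weil μ f • I f') =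
        weil μ f • (weil μ f' • I χ - c • I f') - weil μ f' • (weil μ f • I χ - c • I f) := by
      module
    have h5 : c * ‖weil μ f' • I f - weil μ f • I f'‖ ≤
        |weil μ f| * (‖J‖ * (ε * c)) + |weil μ f'| * (‖J‖ * (ε * c)) := by
      rw [← abs_of_pos hcpos, ← Real.norm_eq_abs c, ← norm_smul, h4, Real.norm_eq_abs, abs_of_pos hcpos]
      refine (norm_sub_le _ _).trans ?_
      rw [norm_smul, norm_smul, Real.norm_eq_abs, Real.norm_eq_abs]
      gcongr
    have h6 : c * ‖weil μ f' • I f - weil μ f • I f'‖ ≤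
        c * ((‖J‖ * (|weil μ f'| + |weil μ f|)) * ε) := by linarith
    exact le_of_mul_le_mul_left h6 hcpos
  rw [← sub_eq_zero, ← norm_le_zero_iff]
  refine ge_of_tendsto (x := 𝓝[>] (0 : ℝ)) (f := fun ε => (‖J‖ * (|weil μ f'| + |weil μ f|)) * ε)
    ?_ (eventually_nhdsWithin_of_forall fun ε hε => hfin ε hε)
  have : Continuous fun ε : ℝ => (‖J‖ * (|weil μ f'| + |weil μ f|)) * ε := by fun_prop
  simpa using (this.tendsto 0).mono_left nhdsWithin_le_nhds

end Uniqueness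

/-! ### Sections of almost minimal length -/

section Section

variable {G : Type u} [Group G] [TopologicalSpace G] [IsTopologicalGroup G] [T2Space G]
  [LocallyCompactSpace G] {Γ : Subgroup G} [DiscreteTopology Γ]

/-- A point of `G` has a compact neighbourhood, as small as desired, that meets each coset of the
discrete subgroup `Γ` at most once. -/
theorem exists_compact_nhds_injOn (x : G) {O : Set G} (hO : O ∈ 𝓝 x) :
    ∃ K : Set G, IsCompact K ∧ K ∈ 𝓝 x ∧ K ⊆ O ∧
      Set.InjOn (QuotientGroup.mk : G → G ⧸ Γ) K := by
  obtain ⟨U, hU, hUΓ⟩ := exists_nhds_injOn_mk (Γ := Γ) x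
  obtain ⟨K, hKx, hKU, hK⟩ := local_compact_nhds (inter_mem hO hU)
  exact ⟨K, hK, hKx, hKU.trans Set.inter_subset_left, hUΓ.mono (hKU.trans Set.inter_subset_right)⟩

/-- The infimum of the lengths in a coset of `Γ` need not be attained, but it is up to the
constant `1`. -/
theorem exists_almost_minimal (ℓ : LengthFunction G) (q : G ⧸ Γ) :
    ∃ x : G, (x : G ⧸ Γ) = q ∧ ∀ γ : Γ, ℓ x ≤ ℓ (x * γ) + 1 := by
  induction q using QuotientGroup.induction_on with | _ g => ?_
  have hbdd : BddBelow (Set.range fun γ : Γ => ℓ (g * γ)) :=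
    ⟨0, by rintro _ ⟨γ, rfl⟩; exact ℓ.nonneg _⟩
  obtain ⟨_, ⟨δ, rfl⟩, hδ⟩ := exists_lt_of_csInf_lt (Set.range_nonempty _)
    (lt_add_one (sInf (Set.range fun γ : Γ => ℓ (g * γ))))
  refine ⟨g * δ, by simp, fun γ => hδ.le.trans ?_⟩
  gcongr
  exact csInf_le hbdd ⟨δ * γ, by simp [mul_assoc]⟩

theorem LengthFunction.exists_bound (ℓ : LengthFunction G) {K : Set G} (hK : IsCompact K) :
    ∃ b, 0 ≤ b ∧ ∀ x ∈ K, ℓ x ≤ b := by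
  obtain ⟨b, hb⟩ := ℓ.bddAbove_image K hK
  exact ⟨max b 0, le_max_right _ _, fun x hx => (hb ⟨x, hx, rfl⟩).trans (le_max_left _ _)⟩

variable [MeasurableSpace G] [BorelSpace G] [MeasurableSpace (G ⧸ Γ)] [BorelSpace (G ⧸ Γ)]

/-- A section of `G → G ⧸ Γ` whose values have almost minimal length in their coset. It is almost
everywhere measurable, and compactly valued on each member of a sequence of sets `D n` whose
complements have small measure. -/
structure AlmostMinimalSection (ℓ : LengthFunction G) (μ : Measure (G ⧸ Γ)) where
  toFun : G ⧸ Γ → G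
  /-- The defect of minimality of the length. -/
  c : ℝ
  /-- The sets on which the section is compactly valued. -/
  D : ℕ → Set (G ⧸ Γ)
  mk_apply : ∀ q, (toFun q : G ⧸ Γ) = q
  c_nonneg : 0 ≤ c
  length_le : ∀ q (γ : Γ), ℓ (toFun q) ≤ ℓ (toFun q * γ) + c
  aemeasurable : AEMeasurable toFun μ
  measurableSet_D : ∀ n, MeasurableSet (D n)
  tendsto_D : Tendsto (fun n => μ (D n)ᶜ) atTop (𝓝 0)
  exists_compact : ∀ n, ∃ Q, IsCompact Q ∧ ∀ q ∈ D n, toFun q ∈ Q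

/-- As `ℓ` need not be measurable, the section is assembled from countably many local sections on
compact sets, each of which takes values in a small neighbourhood of a point of almost minimal
length. -/
theorem nonempty_almostMinimalSection (ℓ : LengthFunction G) (μ : Measure (G ⧸ Γ))
    [IsProbabilityMeasure μ] [μ.Regular] : Nonempty (AlmostMinimalSection ℓ μ) := by
  classical
  choose x hx hxmin using exists_almost_minimal (Γ := Γ) ℓ
  obtain ⟨U, hU, hU1⟩ := exists_compact_mem_nhds (1 : G)
  obtain ⟨b, hb0, hb⟩ := ℓ.exists_bound hU
  have hnear : ∀ q, {y | y * (x q)⁻¹ ∈ U} ∈ 𝓝 (x q) := fun q => by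
    have : ContinuousAt (fun y => y * (x q)⁻¹) (x q) := by fun_prop
    exact this.preimage_mem_nhds (by simpa using hU1)
  choose K hK hKx hKU hKinj using fun q => exists_compact_nhds_injOn (Γ := Γ) (x q) (hnear q)
  let T : G ⧸ Γ → Set (G ⧸ Γ) := fun q => QuotientGroup.mk '' K q
  have hTc : ∀ q, IsCompact (T q) := fun q => (hK q).image QuotientGroup.continuous_mk
  have hTn : ∀ q, T q ∈ 𝓝 q := fun q => by
    have := QuotientGroup.isOpenMap_coe.image_mem_nhds (hKx q) (f := (QuotientGroup.mk : G → G ⧸ Γ))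
    rwa [hx] at this
  -- countably many of the compact sets `T q` cover a conull set
  have hex : ∀ n : ℕ, ∃ t : Finset (G ⧸ Γ), μ (⋃ q ∈ t, T q)ᶜ ≤ (n + 1 : ENNReal)⁻¹ := by
    intro n
    obtain ⟨A, -, hA, hAμ⟩ := MeasurableSet.univ.exists_isCompact_sdiff_lt (μ := μ)
      (measure_ne_top _ _) (ε := (n + 1 : ENNReal)⁻¹) (by simp)
    obtain ⟨t, -, ht⟩ := hA.elim_nhds_subcover T fun q _ => hTn q
    refine ⟨t, (measure_mono ?_).trans hAμ.le⟩
    rw [← Set.compl_eq_univ_sdiff]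
    exact Set.compl_subset_compl.2 ht
  choose t ht using hex
  obtain ⟨e, he⟩ := (Set.countable_iUnion fun n => (t n ∪ {((1 : G) : G ⧸ Γ)} : Finset (G ⧸ Γ)).countable_toSet).exists_eq_range
    ⟨((1 : G) : G ⧸ Γ), Set.mem_iUnion.2 ⟨0, by simp⟩⟩
  have hcov : μ (⋃ i, T (e i))ᶜ = 0 := by
    refine le_antisymm (ge_of_tendsto' (x := atTop) (f := fun n : ℕ => (n + 1 : ENNReal)⁻¹) ?_ fun n => ?_) bot_le
    · have := (ENNReal.tendsto_inv_nat_nhds_zero).comp (tendsto_add_atTop_nat 1)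
      simpa [Function.comp_def] using this
    · refine (measure_mono (Set.compl_subset_compl.2 ?_)).trans (ht n)
      refine Set.iUnion₂_subset fun q hq => ?_
      obtain ⟨i, rfl⟩ : q ∈ Set.range e := he ▸ Set.mem_iUnion.2 ⟨n, by simp [hq]⟩
      exact Set.subset_iUnion (fun i => T (e i)) i
  -- the local section on `T (e i)` with values in `K (e i)`
  let s : ℕ → G ⧸ Γ → G := fun i => Function.invFunOn QuotientGroup.mk (K (e i))
  have hs1 : ∀ i, ∀ q ∈ T (e i), s i q ∈ K (e i) := fun i q hq => Function.invFunOn_mem hq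
  have hs2 : ∀ i, ∀ q ∈ T (e i), (s i q : G ⧸ Γ) = q := fun i q hq => Function.invFunOn_eq hq
  -- at each `q` the first local section defined at `q` is used; off the null set where there is none,
  -- `σ` must still be an almost minimal section while `σ'` is constant, hence measurable
  let P : G ⧸ Γ → Prop := fun q => ∃ i, q ∈ T (e i)
  let σ : G ⧸ Γ → G := fun q => if h : P q then s (Nat.find h) q else x q
  let σ' : G ⧸ Γ → G := fun q => if h : P q then s (Nat.find h) q else 1
  have hPn : ∀ᵐ q ∂μ, P q := by
    rw [ae_iff]
    convert hcov using 2
    ext q; simp [P]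
  have hTm : ∀ i, MeasurableSet (T (e i)) := fun i => (hTc _).measurableSet
  have hmeas : Measurable σ' := by
    refine measurable_of_isClosed fun C hC => ?_
    have heq : σ' ⁻¹' C = (⋃ i, (T (e i) \ ⋃ j < i, T (e j)) ∩ (QuotientGroup.mk '' (K (e i) ∩ C)))
        ∪ ((⋃ i, T (e i))ᶜ ∩ {_q | (1 : G) ∈ C}) := by
      ext q
      by_cases h : P q
      · have hσ : σ' q = s (Nat.find h) q := dif_pos h
        have hnot : q ∈ ⋃ i, T (e i) := Set.mem_iUnion.2 h
        simp only [Set.mem_preimage, hσ, Set.mem_union, Set.mem_inter_iff, Set.mem_compl_iff, hnot,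
          not_true_eq_false, false_and, or_false, Set.mem_iUnion]
        constructor
        · intro hC'
          refine ⟨Nat.find h, ⟨Nat.find_spec h, ?_⟩, s _ q, ⟨hs1 _ q (Nat.find_spec h), hC'⟩, hs2 _ q (Nat.find_spec h)⟩
          simp only [Set.mem_iUnion, not_exists]
          exact fun j hj => Nat.find_min h hj
        · rintro ⟨i, ⟨hi, hij⟩, y, ⟨hyK, hyC⟩, rfl⟩
          have hfi : Nat.find h = i := by
            rw [Nat.find_eq_iff]
            exact ⟨hi, fun j hj hcon => hij (by simp only [Set.mem_iUnion]; exact ⟨j, hj, hcon⟩)⟩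
          rw [hfi]
          rwa [hKinj (e i) (hs1 i _ hi) hyK (hs2 i _ hi)]
      · have hσ : σ' q = 1 := dif_neg h
        have hq : ∀ i, q ∉ T (e i) := fun i hi => h ⟨i, hi⟩
        simp [hσ, hq]
    rw [heq]
    refine (MeasurableSet.iUnion fun i => ?_).union ((MeasurableSet.iUnion hTm).compl.inter
      (MeasurableSet.const _))
    refine ((hTm i).diff (MeasurableSet.biUnion (Set.to_countable _) fun j _ => hTm j)).inter ?_
    exact (((hK _).inter_right hC).image QuotientGroup.continuous_mk).measurableSet
  have hσmk : ∀ q, (σ q : G ⧸ Γ) = q := fun q => by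
    by_cases h : P q
    · simp only [σ, dif_pos h]; exact hs2 _ q (Nat.find_spec h)
    · simp only [σ, dif_neg h, hx]
  refine ⟨⟨σ, 2 * b + 1, fun n => ⋃ i ≤ n, T (e i), hσmk, by linarith, fun q γ => ?_,
    ⟨σ', hmeas, hPn.mono fun q hq => by simp only [σ, σ', dif_pos hq]⟩,
    fun n => MeasurableSet.biUnion (Set.to_countable _) fun j _ => hTm j, ?_, fun n =>
    ⟨⋃ i ≤ n, K (e i), (Set.finite_Iic n).isCompact_biUnion fun i _ => hK _, fun q hq => ?_⟩⟩⟩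
  · by_cases h : P q
    · simp only [σ, dif_pos h]
      set y := s (Nat.find h) q with hy
      set z := x (e (Nat.find h)) with hz
      have hyU : y * z⁻¹ ∈ U := hKU _ (hs1 _ q (Nat.find_spec h))
      -- `y` differs on the left from the almost minimal `z` by an element of `U`, so right
      -- multiplication by `γ` changes the lengths of `y` and `z` alike up to `2 b`
      have h1 : ℓ y ≤ ℓ (y * z⁻¹) + ℓ z := by
        simpa using ℓ.map_mul_le (y * z⁻¹) z
      have h2 : ℓ (z * γ) ≤ ℓ (y * z⁻¹)⁻¹ + ℓ (y * γ) := by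
        have := ℓ.map_mul_le (y * z⁻¹)⁻¹ (y * γ)
        convert this using 2
        group
      rw [ℓ.map_inv] at h2
      have h3 := hb _ hyU
      have h4 := hxmin (e (Nat.find h)) γ
      change ℓ z ≤ ℓ (z * γ) + 1 at h4
      linarith
    · simp only [σ, dif_neg h]
      linarith [hxmin q γ]
  · have hmono : Antitone fun n => (⋃ i ≤ n, T (e i))ᶜ := fun m n hmn =>
      Set.compl_subset_compl.2 (Set.biUnion_subset_biUnion_left fun i hi => le_trans hi hmn)
    have := tendsto_measure_iInter_atTop (μ := μ) (s := fun n => (⋃ i ≤ n, T (e i))ᶜ)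
      (fun n => (MeasurableSet.biUnion (Set.to_countable _) fun j _ => hTm j).compl.nullMeasurableSet)
      hmono ⟨0, measure_ne_top _ _⟩
    have heq : ⋂ n, (⋃ i ≤ n, T (e i))ᶜ = (⋃ i, T (e i))ᶜ := by
      rw [← Set.compl_iUnion]
      congr 1
      ext q
      simp only [Set.mem_iUnion]
      exact ⟨fun ⟨_, i, _, h⟩ => ⟨i, h⟩, fun ⟨i, h⟩ => ⟨i, i, le_rfl, h⟩⟩
    rwa [heq, hcov] at this
  · simp only [Set.mem_iUnion] at hq ⊢
    obtain ⟨i, hi, hiq⟩ := hq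
    have h : P q := ⟨i, hiq⟩
    refine ⟨Nat.find h, (Nat.find_min' h hiq).trans hi, ?_⟩
    simp only [σ, dif_pos h]
    exact hs1 _ q (Nat.find_spec h)

/-- The values of the section lie, almost surely, in a `σ`-compact set, which provides the separability
needed for strong measurability even when `G` is not second countable. -/
theorem AlmostMinimalSection.aestronglyMeasurable_comp {ℓ : LengthFunction G}
    {μ : Measure (G ⧸ Γ)} (σ : AlmostMinimalSection ℓ μ)
    {Y : Type*} [NormedAddCommGroup Y] {f : G → Y} (hf : Continuous f) :
    AEStronglyMeasurable (fun q => f (σ.toFun q)) μ := by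
  borelize Y
  choose Q hQ hσQ using σ.exists_compact
  refine aestronglyMeasurable_iff_aemeasurable_separable.2
    ⟨hf.measurable.comp_aemeasurable σ.aemeasurable, ⋃ n, f '' Q n,
      TopologicalSpace.IsSeparable.iUnion fun n => ((hQ n).image hf).isSeparable, ?_⟩
  have hnull : μ (⋂ n, (σ.D n)ᶜ) = 0 :=
    le_antisymm (ge_of_tendsto' σ.tendsto_D fun n => measure_mono (Set.iInter_subset _ n)) bot_le
  have h2 : ∀ᵐ q ∂μ, q ∉ ⋂ n, (σ.D n)ᶜ := measure_eq_zero_iff_ae_notMem.1 hnull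
  filter_upwards [h2] with q hq
  simp only [Set.mem_iInter, Set.mem_compl_iff, not_forall, not_not] at hq
  obtain ⟨n, hn⟩ := hq
  exact Set.mem_iUnion.2 ⟨n, σ.toFun q, hσQ n q hn, rfl⟩

end Section

/-! ### Compactly supported probability measures -/

section CompactProbTools

variable {Z : Type*} [TopologicalSpace Z] [MeasurableSpace Z]

instance CompactProb.instIsProbabilityMeasure (m : CompactProb Z) :
    IsProbabilityMeasure m.measure := m.isProb

/-- The Dirac mass at a point. -/
noncomputable def CompactProb.dirac [T1Space Z] [OpensMeasurableSpace Z] (z : Z) : CompactProb Z where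
  measure := Measure.dirac z
  isProb := inferInstance
  exists_compact := ⟨{z}, isCompact_singleton, by
    rw [Measure.dirac_apply' _ (measurableSet_singleton z).compl]; simp⟩

theorem CompactProb.dirac_supportedIn [T1Space Z] [OpensMeasurableSpace Z] {z : Z} {S : Set Z}
    (hz : z ∈ S) : (CompactProb.dirac z).SupportedIn S :=
  ⟨{z}, isCompact_singleton, by simpa using hz, by
    change Measure.dirac z _ = 0
    rw [Measure.dirac_apply' _ (measurableSet_singleton z).compl]; simp⟩

/-- The image of a compactly supported measure under a continuous map. -/
noncomputable def CompactProb.map [OpensMeasurableSpace Z] {Z' : Type*} [TopologicalSpace Z']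
    [MeasurableSpace Z'] [BorelSpace Z'] [T2Space Z'] (m : CompactProb Z) (f : Z → Z')
    (hf : Continuous f) : CompactProb Z' where
  measure := m.measure.map f
  isProb := Measure.isProbabilityMeasure_map hf.measurable.aemeasurable
  exists_compact := by
    obtain ⟨K, hK, h⟩ := m.exists_compact
    refine ⟨f '' K, hK.image hf, ?_⟩
    rw [Measure.map_apply hf.measurable (hK.image hf).measurableSet.compl]
    exact measure_mono_null (fun z hz hzK => hz ⟨z, hzK, rfl⟩) h

theorem CompactProb.map_supportedIn [OpensMeasurableSpace Z] {Z' : Type*} [TopologicalSpace Z']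
    [MeasurableSpace Z'] [BorelSpace Z'] [T2Space Z'] {m : CompactProb Z} {f : Z → Z'}
    (hf : Continuous f) {S : Set Z} {S' : Set Z'} (h : m.SupportedIn S) (hS : Set.MapsTo f S S') :
    (m.map f hf).SupportedIn S' := by
  obtain ⟨K, hK, hKS, h⟩ := h
  refine ⟨f '' K, hK.image hf, (hS.mono_left hKS).image_subset, ?_⟩
  change m.measure.map f _ = 0
  rw [Measure.map_apply hf.measurable (hK.image hf).measurableSet.compl]
  exact measure_mono_null (fun z hz hzK => hz ⟨z, hzK, rfl⟩) h

theorem CompactProb.SupportedIn.mono {m : CompactProb Z} {S S' : Set Z} (h : m.SupportedIn S)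
    (hS : S ⊆ S') : m.SupportedIn S' := by
  obtain ⟨K, hK, hKS, h⟩ := h
  exact ⟨K, hK, hKS.trans hS, h⟩

theorem CompactProb.SupportedIn.ae {m : CompactProb Z} {S : Set Z} (h : m.SupportedIn S) :
    ∀ᵐ z ∂m.measure, z ∈ S := by
  obtain ⟨K, hK, hKS, h⟩ := h
  have h1 : ∀ᵐ z ∂m.measure, z ∈ K := h
  exact h1.mono fun z hz => hKS hz

theorem CompactProb.supportedIn_nonempty {m : CompactProb Z} {S : Set Z} (h : m.SupportedIn S) :
    S.Nonempty := h.ae.exists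

variable {Y : Type*} [NormedAddCommGroup Y] [NormedSpace ℝ Y]

theorem CompactProb.norm_integral_le {m : CompactProb Z} {S : Set Z} (h : m.SupportedIn S)
    {f : Z → Y} {B : ℝ} (hB : ∀ z ∈ S, ‖f z‖ ≤ B) : ‖∫ z, f z ∂m.measure‖ ≤ B := by
  simpa using norm_integral_le_of_norm_le_const (μ := m.measure) (h.ae.mono fun z hz => hB z hz)

variable [T2Space Z] [BorelSpace Z]

theorem CompactProb.integrable_of_continuous (m : CompactProb Z) {f : Z → Y} (hf : Continuous f) :
    Integrable f m.measure := by
  obtain ⟨K, hK, hm⟩ := m.exists_compact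
  have h : IntegrableOn f K m.measure := hf.continuousOn.integrableOn_compact hK
  rwa [IntegrableOn, Measure.restrict_eq_self_of_ae_mem] at h
  exact hm

/-- An integral against a compactly supported measure depends continuously on parameters. -/
theorem CompactProb.continuous_integral {W : Type*} [TopologicalSpace W] (m : CompactProb Z)
    {f : W → Z → Y} (hf : Continuous f.uncurry) : Continuous fun w => ∫ z, f w z ∂m.measure := by
  obtain ⟨K, hK, hm⟩ := m.exists_compact
  have hfw : ∀ w, Continuous (f w) := fun w => hf.comp (by fun_prop : Continuous fun z => (w, z))
  refine continuous_iff_continuousAt.2 fun w₀ => Metric.tendsto_nhds.2 fun ε hε => ?_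
  obtain ⟨v, hv, h⟩ := hK.mem_uniformity_of_prod (f := f) (s := Set.univ) (q := w₀)
    hf.continuousOn (Set.mem_univ _) (Metric.dist_mem_uniformity (half_pos hε))
  rw [nhdsWithin_univ] at hv
  filter_upwards [hv] with w hw
  rw [dist_eq_norm, ← integral_sub (m.integrable_of_continuous (hfw _)) (m.integrable_of_continuous (hfw _))]
  refine (CompactProb.norm_integral_le ⟨K, hK, subset_rfl, hm⟩ fun z hz => ?_).trans_lt
    (half_lt_self hε)
  rw [← dist_eq_norm]
  exact (h w hw z hz).le

end CompactProbTools

/-! ### Convolution -/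

section Convolution

variable {G : Type*} [Group G] [TopologicalSpace G] [IsTopologicalGroup G] [T2Space G]
  [LocallyCompactSpace G] [MeasurableSpace G] [BorelSpace G]

theorem CompactProb.continuous_integral_mul (m : CompactProb G) {Y : Type*}
    [NormedAddCommGroup Y] [NormedSpace ℝ Y] {f : G → Y} (hf : Continuous f) :
    Continuous fun g => ∫ h, f (g * h) ∂m.measure :=
  m.continuous_integral (f := fun g h => f (g * h)) (hf.comp continuous_mul)

/-- Convolution of compactly supported measures. Multiplication on `G` need not be measurable for
the product `σ`-algebra and the measures need not be regular, so the convolution is obtained from the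
Riesz–Markov–Kakutani theorem; it is characterised by the integrals of continuous functions. -/
theorem CompactProb.exists_conv (m₁ m₂ : CompactProb G) :
    ∃ m : CompactProb G,
      (∀ S₁ S₂ : Set G, m₁.SupportedIn S₁ → m₂.SupportedIn S₂ → m.SupportedIn (S₁ * S₂)) ∧
      ∀ (Y : Type u) [NormedAddCommGroup Y] [NormedSpace ℝ Y] [CompleteSpace Y] (f : G → Y),
        Continuous f → ∫ g, f g ∂m.measure = ∫ g, ∫ h, f (g * h) ∂m₂.measure ∂m₁.measure := by
  have hr : ∀ (f : G → ℝ) (_ : Continuous f) (g : G), Integrable (fun h => f (g * h)) m₂.measure :=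
    fun f hf g => m₂.integrable_of_continuous (hf.comp (continuous_const_mul g))
  let Λ : C_c(G, ℝ) →ₚ[ℝ] ℝ :=
    { toFun f := ∫ g, ∫ h, f (g * h) ∂m₂.measure ∂m₁.measure
      map_add' f f' := by
        rw [← integral_add (m₁.integrable_of_continuous (m₂.continuous_integral_mul (map_continuous f)))
          (m₁.integrable_of_continuous (m₂.continuous_integral_mul (map_continuous f')))]
        congr 1; ext g
        exact integral_add (hr _ (map_continuous f) g) (hr _ (map_continuous f') g)
      map_smul' c f := by
        simp only [CompactlySupportedContinuousMap.coe_smul, Pi.smul_apply, RingHom.id_apply, integral_smul]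
      monotone' f f' h := by
        refine integral_mono (m₁.integrable_of_continuous (m₂.continuous_integral_mul (map_continuous f)))
          (m₁.integrable_of_continuous (m₂.continuous_integral_mul (map_continuous f'))) fun g => ?_
        exact integral_mono (hr _ (map_continuous f) g) (hr _ (map_continuous f') g) fun x => h _ }
  have hΛ : ∀ f : C_c(G, ℝ), Λ f = ∫ g, ∫ h, f (g * h) ∂m₂.measure ∂m₁.measure := fun f => rfl
  have hcongr : ∀ K₁ K₂ : Set G, m₁.measure K₁ᶜ = 0 → m₂.measure K₂ᶜ = 0 →
      ∀ {f f' : G → ℝ}, (∀ x ∈ K₁ * K₂, f x = f' x) →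
      ∫ g, ∫ h, f (g * h) ∂m₂.measure ∂m₁.measure = ∫ g, ∫ h, f' (g * h) ∂m₂.measure ∂m₁.measure := by
    intro K₁ K₂ h₁ h₂ f f' hff
    have h₁' : ∀ᵐ g ∂m₁.measure, g ∈ K₁ := h₁
    have h₂' : ∀ᵐ g ∂m₂.measure, g ∈ K₂ := h₂
    refine integral_congr_ae (h₁'.mono fun g hg => integral_congr_ae (h₂'.mono fun h hh => ?_))
    exact hff _ (Set.mul_mem_mul hg hh)
  set ν := RealRMK.rieszMeasure Λ with hν
  have hreg : ν.Regular := RealRMK.regular_rieszMeasure Λ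
  -- the Riesz measure is carried by `K₁ * K₂`, by inner regularity on the open complement
  have hsupp : ∀ K₁ K₂ : Set G, IsCompact K₁ → IsCompact K₂ → m₁.measure K₁ᶜ = 0 →
      m₂.measure K₂ᶜ = 0 → ν (K₁ * K₂)ᶜ = 0 := by
    intro K₁ K₂ hK₁ hK₂ h₁ h₂
    have hK := hK₁.mul hK₂
    rw [hK.isClosed.isOpen_compl.measure_eq_iSup_isCompact]
    simp only [ENNReal.iSup_eq_zero]
    intro L hLK hL
    obtain ⟨f, hf1, hf0, hfc, hfI⟩ := exists_continuous_one_zero_of_isCompact hL hK.isClosed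
      (Set.disjoint_left.2 fun x hx hxK => hLK hx hxK)
    have h3 := RealRMK.rieszMeasure_le_of_eq_one Λ (f := ⟨f, hfc⟩) (fun x => (hfI x).1) hL
      fun x hx => hf1 hx
    have h4 : Λ ⟨f, hfc⟩ = 0 := by
      refine (hcongr K₁ K₂ h₁ h₂ (f := f) (f' := 0) fun x hx => hf0 hx).trans ?_
      simp
    rw [h4] at h3
    simpa using h3
  obtain ⟨K₁, hK₁, h₁⟩ := m₁.exists_compact
  obtain ⟨K₂, hK₂, h₂⟩ := m₂.exists_compact
  obtain ⟨κ, hκ1, -, -⟩ := exists_cutoff (hK₁.mul hK₂)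
  have hae : ∀ᵐ x ∂ν, x ∈ K₁ * K₂ := hsupp K₁ K₂ hK₁ hK₂ h₁ h₂
  have hreal : ∀ f : G → ℝ, Continuous f →
      ∫ x, f x ∂ν = ∫ g, ∫ h, f (g * h) ∂m₂.measure ∂m₁.measure := by
    intro f hf
    let F : C_c(G, ℝ) := ⟨⟨fun x => κ x * f x, by fun_prop⟩, κ.hasCompactSupport.mul_right⟩
    have hF : ∀ x ∈ K₁ * K₂, F x = f x := fun x hx => by
      change κ x * f x = f x
      rw [hκ1 x hx, one_mul]
    rw [← hcongr K₁ K₂ h₁ h₂ hF, ← hΛ, ← RealRMK.integral_rieszMeasure]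
    exact integral_congr_ae (hae.mono fun x hx => (hF x hx).symm)
  have hfin : IsFiniteMeasure ν := by
    refine ⟨?_⟩
    have := measure_union_le (μ := ν) (K₁ * K₂) (K₁ * K₂)ᶜ
    rw [Set.union_compl_self, hsupp K₁ K₂ hK₁ hK₂ h₁ h₂, add_zero] at this
    exact this.trans_lt (hK₁.mul hK₂).measure_lt_top
  have hprob : IsProbabilityMeasure ν := by
    refine ⟨?_⟩
    have := hreal (fun _ => 1) continuous_const
    simp only [integral_const, smul_eq_mul, mul_one, probReal_univ] at this
    rwa [measureReal_def, ENNReal.toReal_eq_one_iff] at this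
  let m : CompactProb G := ⟨ν, hprob, K₁ * K₂, hK₁.mul hK₂, hsupp K₁ K₂ hK₁ hK₂ h₁ h₂⟩
  refine ⟨m, ?_, fun Y _ _ _ f hf => ?_⟩
  · rintro S₁ S₂ ⟨C₁, hC₁, hS₁, hm₁⟩ ⟨C₂, hC₂, hS₂, hm₂⟩
    exact ⟨C₁ * C₂, hC₁.mul hC₂, Set.mul_subset_mul hS₁ hS₂, hsupp C₁ C₂ hC₁ hC₂ hm₁ hm₂⟩
  -- vector-valued functions are tested against continuous functionals
  · refine (SeparatingDual.eq_iff_forall_dual_eq (R := ℝ)).2 fun L => ?_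
    have hi : ∀ g, Integrable (fun h => f (g * h)) m₂.measure := fun g =>
      m₂.integrable_of_continuous (hf.comp (continuous_const_mul g))
    rw [← L.integral_comp_comm (m.integrable_of_continuous hf),
      ← L.integral_comp_comm (m₁.integrable_of_continuous (m₂.continuous_integral_mul hf))]
    simp only [← L.integral_comp_comm (hi _)]
    exact hreal _ (L.continuous.comp hf)

end Convolution

/-! ### Averages of two-step representations -/

section Average

variable {G : Type u} [Group G] [TopologicalSpace G] [IsTopologicalGroup G] [T2Space G]
  [MeasurableSpace G] [BorelSpace G]
  {X₀ X₁ X₂ : Type u}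
  [NormedAddCommGroup X₀] [NormedSpace ℂ X₀] [CompleteSpace X₀]
  [NormedAddCommGroup X₁] [NormedSpace ℂ X₁]
  [NormedAddCommGroup X₂] [NormedSpace ℂ X₂]

theorem TwoStepRep.average_apply (ρ : TwoStepRep G X₀ X₁ X₂) (m : CompactProb G) (x : X₀) :
    ρ.average m x = ∫ g, ρ.pi g x ∂m.measure := rfl

theorem TwoStepRep.average_translate_apply (ρ : TwoStepRep G X₀ X₁ X₂) (m : CompactProb G)
    (g g' : G) (x : X₀) :
    ρ.average (m.translate g g') x = ∫ h, ρ.pi (g * h * g') x ∂m.measure := by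
  rw [TwoStepRep.average_apply]
  have hc : Continuous fun h : G => g * h * g' := by fun_prop
  refine integral_map hc.measurable.aemeasurable ?_
  have h := ((m.translate g g').integrable (ρ.continuous_pi x)).aestronglyMeasurable
  exact h

theorem TwoStepRep.norm_average_le (ρ : TwoStepRep G X₀ X₁ X₂) {m : CompactProb G} {S : Set G}
    (hm : m.SupportedIn S) {B : ℝ} (hB : ∀ g ∈ S, ‖ρ.pi g‖ ≤ B) : ‖ρ.average m‖ ≤ B := by
  have hB0 : 0 ≤ B := by
    obtain ⟨g, hg⟩ := CompactProb.supportedIn_nonempty hm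
    exact (norm_nonneg _).trans (hB g hg)
  refine ContinuousLinearMap.opNorm_le_bound _ hB0 fun x => ?_
  rw [TwoStepRep.average_apply]
  exact CompactProb.norm_integral_le hm fun g hg => (ρ.pi g).le_of_opNorm_le (hB g hg) x

/-- The two-step representation `g ↦ π (a g b)`. -/
def TwoStepRep.shift (ρ : TwoStepRep G X₀ X₁ X₂) (a b : G) : TwoStepRep G X₀ X₁ X₂ where
  pi₀ g := ρ.pi₀ (g * b)
  pi₁ g := ρ.pi₁ (a * g)
  continuous₀ x := (ρ.continuous₀ x).comp (continuous_mul_const b)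
  continuous₁ x := (ρ.continuous₁ x).comp (continuous_const_mul a)
  compat g g' g'' := by
    rw [← mul_assoc, ρ.compat, mul_assoc]

theorem TwoStepRep.shift_pi (ρ : TwoStepRep G X₀ X₁ X₂) (a b g : G) :
    (ρ.shift a b).pi g = ρ.pi (a * g * b) := by
  rw [ρ.pi_mul]
  change (ρ.pi₁ (a * g)).comp (ρ.pi₀ (1 * b)) = _
  rw [one_mul]

end Average

/-! ### First reductions of property `(*_E)` -/

section StarEstimate

variable {G : Type u} [Group G] [TopologicalSpace G] [IsTopologicalGroup G] [T2Space G]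
  [MeasurableSpace G] [BorelSpace G]

/-- The estimates required of a sequence `m` of measures in property `(*_E)`, with the constants
`s`, `t`, `C`. Nothing is required of the supports. -/
def StarEstimate (ℓ : LengthFunction G) (E : BanachClass.{u}) (s t C : ℝ)
    (m : ℕ → CompactProb G) : Prop :=
  ∀ (X₀ X₁ X₂ : Type u)
      [NormedAddCommGroup X₀] [NormedSpace ℂ X₀] [CompleteSpace X₀]
      [NormedAddCommGroup X₁] [NormedSpace ℂ X₁] [CompleteSpace X₁]
      [NormedAddCommGroup X₂] [NormedSpace ℂ X₂] [CompleteSpace X₂]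
      (ρ : TwoStepRep G X₀ X₁ X₂) (L : ℝ), E X₁ →
      (∀ g, ‖ρ.pi₀ g‖ ≤ L * Real.exp (s * ℓ g)) →
      (∀ g, ‖ρ.pi₁ g‖ ≤ L * Real.exp (s * ℓ g)) →
      ∃ P : X₀ →L[ℂ] X₂,
        (∀ n : ℕ, ‖ρ.average (m n) - P‖ ≤ C * L ^ 2 * Real.exp (-(t * n))) ∧
        ∀ g g' : G, Tendsto
          (fun n => ‖ρ.average ((m n).translate g g') - ρ.average (m n)‖) atTop (𝓝 0)

theorem hasStarFor_iff {ℓ : LengthFunction G} {E : BanachClass.{u}} :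
    HasStarFor G ℓ E ↔ ∃ s t C : ℝ, 0 < s ∧ 0 < t ∧ 0 < C ∧ ∃ m : ℕ → CompactProb G,
      (∀ n : ℕ, (m n).SupportedIn {g | ℓ g ≤ n}) ∧ StarEstimate ℓ E s t C m := Iff.rfl

theorem LengthFunction.map_one_le (ℓ : LengthFunction G) (g : G) : ℓ 1 ≤ 2 * ℓ g := by
  have := ℓ.map_mul_le g g⁻¹
  rw [mul_inv_cancel, ℓ.map_inv] at this
  linarith

/-- The support of `m 0` is a non-empty set of elements of length zero. -/
theorem HasStarFor.length_one {ℓ : LengthFunction G} {E : BanachClass.{u}}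
    (h : HasStarFor G ℓ E) : ℓ 1 = 0 := by
  obtain ⟨s, t, C, -, -, -, m, hm, -⟩ := h
  obtain ⟨g, hg⟩ := CompactProb.supportedIn_nonempty (hm 0)
  have h1 : ℓ g ≤ 0 := by simpa using hg
  exact le_antisymm (by linarith [ℓ.map_one_le g]) (ℓ.nonneg 1)

theorem tendsto_exp_neg_mul_natCast {t : ℝ} (ht : 0 < t) :
    Tendsto (fun n : ℕ => Real.exp (-(t * n))) atTop (𝓝 0) :=
  Real.tendsto_exp_neg_atTop_nhds_zero.comp (tendsto_natCast_atTop_atTop.const_mul_atTop ht)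

variable {X₀ X₁ X₂ : Type u}
  [NormedAddCommGroup X₀] [NormedSpace ℂ X₀]
  [NormedAddCommGroup X₁] [NormedSpace ℂ X₁]
  [NormedAddCommGroup X₂] [NormedSpace ℂ X₂]

theorem TwoStepRep.norm_pi_mul_le (ρ : TwoStepRep G X₀ X₁ X₂) {ℓ : LengthFunction G} {L s : ℝ}
    (h₀ : ∀ g, ‖ρ.pi₀ g‖ ≤ L * Real.exp (s * ℓ g))
    (h₁ : ∀ g, ‖ρ.pi₁ g‖ ≤ L * Real.exp (s * ℓ g)) (g g' : G) :
    ‖ρ.pi (g * g')‖ ≤ L ^ 2 * Real.exp (s * (ℓ g + ℓ g')) := by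
  rw [ρ.pi_mul, mul_add, Real.exp_add]
  calc _ ≤ ‖ρ.pi₁ g‖ * ‖ρ.pi₀ g'‖ := ContinuousLinearMap.opNorm_comp_le _ _
    _ ≤ (L * Real.exp (s * ℓ g)) * (L * Real.exp (s * ℓ g')) :=
      mul_le_mul (h₁ g) (h₀ g') (norm_nonneg _) ((norm_nonneg _).trans (h₁ g))
    _ = _ := by ring

theorem TwoStepRep.norm_pi_le (ρ : TwoStepRep G X₀ X₁ X₂) {ℓ : LengthFunction G} {L s : ℝ}
    (h1 : ℓ 1 = 0) (h₀ : ∀ g, ‖ρ.pi₀ g‖ ≤ L * Real.exp (s * ℓ g))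
    (h₁ : ∀ g, ‖ρ.pi₁ g‖ ≤ L * Real.exp (s * ℓ g)) (g : G) :
    ‖ρ.pi g‖ ≤ L ^ 2 * Real.exp (s * ℓ g) := by
  simpa [h1] using ρ.norm_pi_mul_le h₀ h₁ g 1

theorem TwoStepRep.nonneg_of_norm_le {ℓ : LengthFunction G} {L s : ℝ} {Y Y' : Type*}
    [SeminormedAddCommGroup Y] [NormedSpace ℂ Y] [SeminormedAddCommGroup Y'] [NormedSpace ℂ Y']
    {T : G → Y →L[ℂ] Y'}
    (h₀ : ∀ g, ‖T g‖ ≤ L * Real.exp (s * ℓ g)) : 0 ≤ L :=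
  nonneg_of_mul_nonneg_left ((norm_nonneg _).trans (h₀ 1)) (Real.exp_pos _)

/-- In property `(*_E)` it is enough that the supports grow linearly: the sequence of measures can
then be slowed down. -/
theorem hasStarFor_of_linear_support {ℓ : LengthFunction G} {E : BanachClass.{u}} (h1 : ℓ 1 = 0)
    {s t C : ℝ} (hs : 0 < s) (ht : 0 < t) (hC : 0 < C) {N : ℕ} (hN : 0 < N)
    {M : ℕ → CompactProb G} (hM : ∀ i : ℕ, (M i).SupportedIn {g | ℓ g ≤ N * (i + 1)})
    (H : StarEstimate ℓ E s t C M) : HasStarFor G ℓ E := by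
  have hN' : (0 : ℝ) < N := by exact_mod_cast hN
  have hNt : 0 < t / N := div_pos ht hN'
  -- the support of `M i` has length at most `N * (i + 1)`, so `M (n / N - 1)` is admissible at time
  -- `n ≥ N`; this index is at least `n / N - 2` as a real number, whence the factor `exp (2 * t)`
  refine hasStarFor_iff.2 ⟨s, t / N, (1 + Real.exp (s * N) + C) * Real.exp (2 * t), hs, hNt, by positivity,
    fun n => if n < N then CompactProb.dirac 1 else M (n / N - 1), fun n => ?_, ?_⟩
  · dsimp only
    split_ifs with hn
    · exact CompactProb.dirac_supportedIn (by simp [h1])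
    · refine (hM _).mono fun g (hg : ℓ g ≤ _) => hg.trans ?_
      have h2 : 1 ≤ n / N := (Nat.one_le_div_iff hN).2 (not_lt.1 hn)
      have h3 : ((n / N - 1 : ℕ) : ℝ) + 1 = ((n / N : ℕ) : ℝ) := by
        exact_mod_cast Nat.sub_add_cancel h2
      rw [h3]
      exact_mod_cast Nat.mul_div_le n N
  · intro X₀ X₁ X₂ _ _ _ _ _ _ _ _ _ ρ L hE h₀ h₁
    obtain ⟨P, hP, hinv⟩ := H X₀ X₁ X₂ ρ L hE h₀ h₁
    have hb : ‖ρ.average (M 0)‖ ≤ L ^ 2 * Real.exp (s * N) := by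
      refine ρ.norm_average_le (hM 0) fun g (hg : ℓ g ≤ _) => (ρ.norm_pi_le h1 h₀ h₁ g).trans ?_
      have : ℓ g ≤ N := by simpa using hg
      gcongr
    have hb1 : ‖ρ.average (CompactProb.dirac (1 : G))‖ ≤ L ^ 2 := by
      refine ρ.norm_average_le (CompactProb.dirac_supportedIn rfl) (S := {1}) fun g hg => ?_
      rw [Set.mem_singleton_iff.1 hg]
      simpa [h1] using ρ.norm_pi_le h1 h₀ h₁ 1
    refine ⟨P, fun n => ?_, fun g g' => ?_⟩
    · by_cases hn : n < N
      · simp only [if_pos hn]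
        have h3 : ‖ρ.average (M 0) - P‖ ≤ C * L ^ 2 := by simpa using hP 0
        have h4 : ‖ρ.average (CompactProb.dirac (1 : G)) - P‖ ≤ L ^ 2 * (1 + Real.exp (s * N) + C) := by
          calc _ = ‖ρ.average (CompactProb.dirac (1 : G)) - ρ.average (M 0) + (ρ.average (M 0) - P)‖ := by
                congr 1; abel
            _ ≤ (L ^ 2 + L ^ 2 * Real.exp (s * N)) + C * L ^ 2 :=
                norm_add_le_of_le (norm_sub_le_of_le hb1 hb) h3
            _ = _ := by ring
        -- for the finitely many `n < N` the bound only has to hold up to a constant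
        have h5 : 1 ≤ Real.exp (2 * t) * Real.exp (-(t / N * n)) := by
          rw [← Real.exp_add]
          refine Real.one_le_exp ?_
          have : t / N * n ≤ t / N * N := by
            gcongr
          rw [div_mul_cancel₀ _ hN'.ne'] at this
          linarith
        calc _ ≤ L ^ 2 * (1 + Real.exp (s * N) + C) * 1 := by rwa [mul_one]
          _ ≤ L ^ 2 * (1 + Real.exp (s * N) + C) * (Real.exp (2 * t) * Real.exp (-(t / N * n))) := by gcongr
          _ = _ := by ring
      · simp only [if_neg hn]
        refine (hP _).trans ?_
        have h2 : 1 ≤ n / N := (Nat.one_le_div_iff hN).2 (not_lt.1 hn)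
        have h3 : ((n / N - 1 : ℕ) : ℝ) + 1 = ((n / N : ℕ) : ℝ) := by
          exact_mod_cast Nat.sub_add_cancel h2
        have h4 : (n : ℝ) ≤ N * (((n / N - 1 : ℕ) : ℝ) + 2) := by
          have : n ≤ N * (n / N + 1) := (Nat.lt_mul_div_succ n hN).le
          have : (n : ℝ) ≤ N * (((n / N : ℕ) : ℝ) + 1) := by exact_mod_cast this
          rw [← h3] at this
          linarith
        have h5 : t / N * n ≤ t * (((n / N - 1 : ℕ) : ℝ) + 2) := by
          calc t / N * n ≤ t / N * (N * (((n / N - 1 : ℕ) : ℝ) + 2)) := by gcongr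
            _ = _ := by field_simp
        have h6 : Real.exp (-(t * ((n / N - 1 : ℕ) : ℝ))) ≤ Real.exp (2 * t) * Real.exp (-(t / N * n)) := by
          rw [← Real.exp_add]
          exact Real.exp_le_exp.2 (by linarith)
        calc _ ≤ C * L ^ 2 * (Real.exp (2 * t) * Real.exp (-(t / N * n))) := by gcongr
          _ ≤ (1 + Real.exp (s * N) + C) * L ^ 2 * (Real.exp (2 * t) * Real.exp (-(t / N * n))) := by
            gcongr
            linarith [Real.exp_pos (s * N)]
          _ = _ := by ring
    · have h2 : Tendsto (fun n : ℕ => n / N - 1) atTop atTop :=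
        (tendsto_sub_atTop_nat 1).comp (Nat.tendsto_div_const_atTop hN.ne')
      refine ((hinv g g').comp h2).congr' ?_
      filter_upwards [eventually_ge_atTop N] with n hn
      simp [not_lt.2 hn]

/-- If all spaces of the class vanish, property `(*_E)` only depends on the length of `1`. -/
theorem hasStarFor_of_subsingleton {ℓ : LengthFunction G} {E : BanachClass.{u}} (h1 : ℓ 1 = 0)
    (hE : ∀ (X : Type u) [NormedAddCommGroup X] [NormedSpace ℂ X] [CompleteSpace X], E X →
      Subsingleton X) : HasStarFor G ℓ E := by
  refine hasStarFor_iff.2 ⟨1, 1, 1, one_pos, one_pos, one_pos, fun _ => CompactProb.dirac 1,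
    fun n => CompactProb.dirac_supportedIn (by simp [h1]), ?_⟩
  intro X₀ X₁ X₂ _ _ _ _ _ _ _ _ _ ρ L hX _ _
  have := hE X₁ hX
  have h0 : ∀ m : CompactProb G, ρ.average m = 0 := fun m => by
    ext x
    rw [TwoStepRep.average_apply]
    have : ∀ g, ρ.pi g x = 0 := fun g => by
      rw [TwoStepRep.pi, ContinuousLinearMap.comp_apply, Subsingleton.elim (ρ.pi₀ 1 x) 0, map_zero]
    simp [this]
  refine ⟨0, fun n => ?_, fun g g' => ?_⟩
  · rw [h0]
    simp only [sub_zero, norm_zero]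
    positivity
  · simp [h0]

end StarEstimate

/-! ### Square-integrable fields of operators -/

section LpOperators

variable {Ω : Type*} [MeasurableSpace Ω] (μ : Measure Ω) {X Y : Type*}
  [NormedAddCommGroup X] [NormedSpace ℂ X] [NormedAddCommGroup Y] [NormedSpace ℂ Y]

/-- A square-integrable field of operators `A ω : X → Y` maps `x` to the field `ω ↦ A ω x`. -/
noncomputable def lpEval : Lp (X →L[ℂ] Y) 2 μ →L[ℂ] X →L[ℂ] Lp Y 2 μ :=
  LinearMap.mkContinuous₂
    (LinearMap.mk₂ ℂ (fun A x => (ContinuousLinearMap.apply ℂ Y x).compLp A)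
      (fun A A' x => by
        exact map_add ((ContinuousLinearMap.apply ℂ Y x).compLpₗ 2 μ) A A')
      (fun c A x => by
        exact map_smul ((ContinuousLinearMap.apply ℂ Y x).compLpₗ 2 μ) c A)
      (fun A x x' => by rw [map_add, ContinuousLinearMap.add_compLp])
      (fun c A x => by rw [map_smul, ContinuousLinearMap.smul_compLp])) 1
    (fun A x => by
      rw [one_mul, mul_comm]
      refine (ContinuousLinearMap.norm_compLp_le _ _).trans ?_
      gcongr
      refine ContinuousLinearMap.opNorm_le_bound _ (norm_nonneg _) fun T => ?_
      rw [mul_comm]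
      exact T.le_opNorm x)

theorem lpEval_apply_ae (A : Lp (X →L[ℂ] Y) 2 μ) (x : X) :
    ∀ᵐ ω ∂μ, lpEval μ A x ω = A ω x :=
  (ContinuousLinearMap.apply ℂ Y x).coeFn_compLp A

theorem norm_lpEval_le (A : Lp (X →L[ℂ] Y) 2 μ) : ‖lpEval μ A‖ ≤ ‖A‖ := by
  refine (ContinuousLinearMap.le_of_opNorm_le _ (LinearMap.mkContinuous₂_norm_le _ zero_le_one _) A).trans ?_
  rw [one_mul]

variable [CompleteSpace Y]

/-- A square-integrable field of operators `T ω : X → Y` maps a field `F` to `∫ T ω (F ω) dμ`. -/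
noncomputable def lpIntegrate : Lp (X →L[ℂ] Y) 2 μ →L[ℂ] Lp X 2 μ →L[ℂ] Y :=
  ContinuousLinearMap.lpPairing μ 2 2 (ContinuousLinearMap.id ℂ (X →L[ℂ] Y))

theorem lpIntegrate_apply (T : Lp (X →L[ℂ] Y) 2 μ) (F : Lp X 2 μ) :
    lpIntegrate μ T F = ∫ ω, T ω (F ω) ∂μ :=
  ContinuousLinearMap.lpPairing_eq_integral _ _ _

theorem norm_lpIntegrate_le (T : Lp (X →L[ℂ] Y) 2 μ) : ‖lpIntegrate μ T‖ ≤ ‖T‖ := by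
  refine ContinuousLinearMap.opNorm_le_bound _ (norm_nonneg _) fun F => ?_
  have h1 : lpIntegrate μ T F =
      L1.integral ((ContinuousLinearMap.id ℂ (X →L[ℂ] Y)).holder 1 T F) := by
    rw [L1.integral_eq_integral, lpIntegrate_apply]
    have h2 := ContinuousLinearMap.coeFn_holder (r := 1) (ContinuousLinearMap.id ℂ (X →L[ℂ] Y)) T F
    exact integral_congr_ae h2.symm
  rw [h1]
  refine (L1.norm_integral_le _).trans ((ContinuousLinearMap.norm_holder_apply_apply_le _ T F).trans ?_)
  gcongr
  calc _ ≤ 1 * ‖T‖ := by gcongr; exact ContinuousLinearMap.norm_id_le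
    _ = _ := one_mul _

end LpOperators

/-! ### Lattice sums along a section -/

section LatticeSum

variable {G : Type u} [Group G] [TopologicalSpace G] [IsTopologicalGroup G] [T2Space G]
  [LocallyCompactSpace G] {Γ : Subgroup G} [DiscreteTopology Γ]
  {V : Type*} [NormedAddCommGroup V] [NormedSpace ℝ V]

/-- The sum `∑_γ f (h γ) a γ`. It is finite, by discreteness of `Γ`, as soon as `f` has compact
support. -/
noncomputable def latticeSum (f : G → ℝ) (a : Γ → V) (h : G) : V :=
  ∑' γ : Γ, f (h * γ) • a γ

theorem continuous_latticeSum {f : G → ℝ} (hf : Continuous f) (hc : HasCompactSupport f) (a : Γ → V) :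
    Continuous (latticeSum f a) :=
  continuous_tsum_translates hc (F := fun γ h => f (h * γ) • a γ) (fun γ => by fun_prop)
    fun γ h hh => by rw [image_eq_zero_of_notMem_tsupport hh, zero_smul]

theorem summable_latticeSum {f : G → ℝ} {K : Set G} (hK : IsCompact K) (hf : ∀ x ∉ K, f x = 0)
    (a : Γ → V) (h : G) :
    Summable fun γ : Γ => f (h * γ) • a γ :=
  summable_of_hasFiniteSupport ((finite_translates (Γ := Γ) hK h).subset fun γ hγ => by
    by_contra hcon
    exact hγ (by simp only [hf _ hcon, zero_smul]))

variable [MeasurableSpace G] [BorelSpace G] [MeasurableSpace (G ⧸ Γ)] [BorelSpace (G ⧸ Γ)]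
  {ℓ : LengthFunction G} {μ : Measure (G ⧸ Γ)} (σ : AlmostMinimalSection ℓ μ)

/-- The almost minimality of the section `σ` is what keeps lattice sums bounded along `σ`: if
`g (σ q) γ` lies in a compact set, then the length of `σ q`, hence also that of `γ`, is bounded in
terms of the length of `g`. No integrability of `ℓ` on `G ⧸ Γ` is needed. -/
theorem AlmostMinimalSection.length_le_of_mem {K : Set G} {b : ℝ} (hb : ∀ x ∈ K, ℓ x ≤ b)
    {g : G} {q : G ⧸ Γ} {γ : Γ} (h : g * σ.toFun q * γ ∈ K) :
    ℓ (γ : G) ≤ 2 * ℓ g + (2 * b + σ.c) := by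
  have h1 := hb _ h
  have h2 : ℓ (σ.toFun q * γ) ≤ ℓ g + b := by
    have := ℓ.map_mul_le g⁻¹ (g * σ.toFun q * γ)
    rw [ℓ.map_inv] at this
    have h3 : g⁻¹ * (g * σ.toFun q * γ) = σ.toFun q * γ := by group
    rw [h3] at this
    linarith
  have h3 := σ.length_le q γ
  have h4 := ℓ.map_mul_le (σ.toFun q)⁻¹ (σ.toFun q * γ)
  rw [ℓ.map_inv, inv_mul_cancel_left] at h4
  linarith

/-- For each compact set there is a bound on lattice sums along the section, for all functions
bounded by one and supported in the compact set. -/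
theorem AlmostMinimalSection.exists_latticeSum_bound {K : Set G} (hK : IsCompact K) {s : ℝ}
    (hs : 0 ≤ s) : ∃ κ : ℝ, 0 ≤ κ ∧ ∀ {V : Type u} [NormedAddCommGroup V] [NormedSpace ℝ V]
      (f : G → ℝ) (B : ℝ) (a : Γ → V) (L : ℝ), (∀ x ∉ K, f x = 0) →
      (∀ x, |f x| ≤ B) → (∀ γ : Γ, ‖a γ‖ ≤ L * Real.exp (s * ℓ (γ : G))) → ∀ (g : G) (q : G ⧸ Γ),
      ‖latticeSum f a (g * σ.toFun q)‖ ≤ B * (κ * L * Real.exp (2 * s * ℓ g)) := by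
  obtain ⟨N, hN⟩ := exists_card_translates_le (Γ := Γ) hK
  obtain ⟨b, hb0, hb⟩ := ℓ.exists_bound hK
  refine ⟨N * Real.exp (s * (2 * b + σ.c)), by positivity, fun f B a L hf0 hf1 ha g q => ?_⟩
  have hL : 0 ≤ L := nonneg_of_mul_nonneg_left ((norm_nonneg _).trans (ha 1)) (Real.exp_pos _)
  have hB : 0 ≤ B := (abs_nonneg _).trans (hf1 1)
  have := norm_tsum_translates_le (Γ := Γ) (h := g * σ.toFun q) (a := fun γ => f (g * σ.toFun q * γ) • a γ)
    (B := B * (L * Real.exp (s * (2 * ℓ g + (2 * b + σ.c))))) hK hN (by positivity)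
    (fun γ hγ => by simp only [hf0 _ hγ, zero_smul]) (fun γ hγ => by
      rw [norm_smul, Real.norm_eq_abs]
      refine mul_le_mul (hf1 _) ((ha γ).trans ?_) (norm_nonneg _) hB
      gcongr
      exact σ.length_le_of_mem hb hγ)
  refine this.trans (le_of_eq ?_)
  rw [show s * (2 * ℓ g + (2 * b + σ.c)) = s * (2 * b + σ.c) + 2 * s * ℓ g by ring, Real.exp_add]
  ring

variable [IsProbabilityMeasure μ]

theorem AlmostMinimalSection.memLp_latticeSum {V : Type u} [NormedAddCommGroup V] [NormedSpace ℝ V]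
    (f : C_c(G, ℝ)) {a : Γ → V} {L s : ℝ}
    (hs : 0 ≤ s) (ha : ∀ γ : Γ, ‖a γ‖ ≤ L * Real.exp (s * ℓ (γ : G))) (g : G) :
    MemLp (fun q => latticeSum f a (g * σ.toFun q)) 2 μ := by
  obtain ⟨κ, -, hκ⟩ := σ.exists_latticeSum_bound f.hasCompactSupport hs
  obtain ⟨B, hB⟩ := f.continuous.bounded_above_of_compact_support f.hasCompactSupport
  have hc : Continuous fun h => latticeSum f a (g * h) :=
    (continuous_latticeSum f.continuous f.hasCompactSupport a).comp (continuous_const_mul g)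
  exact MemLp.of_bound (σ.aestronglyMeasurable_comp hc) _
    (ae_of_all _ fun q => hκ f B a L (fun x hx => image_eq_zero_of_notMem_tsupport hx) (fun x => hB x) ha g q)

open Classical in
/-- The class in `L²` of the function `q ↦ ∑_γ f (g σ(q) γ) a γ`. (It is zero if this function is
not square integrable, which does not happen when `a` grows at most exponentially.) -/
noncomputable def AlmostMinimalSection.lpSum {V : Type u} [NormedAddCommGroup V] [NormedSpace ℝ V]
    (f : G → ℝ) (a : Γ → V) (g : G) : Lp V 2 μ :=
  if h : MemLp (fun q => latticeSum f a (g * σ.toFun q)) 2 μ then h.toLp _ else 0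

variable {V : Type u} [NormedAddCommGroup V] [NormedSpace ℝ V]

theorem AlmostMinimalSection.lpSum_ae (f : C_c(G, ℝ)) {a : Γ → V} {L s : ℝ}
    (hs : 0 ≤ s) (ha : ∀ γ : Γ, ‖a γ‖ ≤ L * Real.exp (s * ℓ (γ : G))) (g : G) :
    ∀ᵐ q ∂μ, σ.lpSum f a g q = latticeSum f a (g * σ.toFun q) := by
  have h := σ.memLp_latticeSum f hs ha g
  rw [lpSum, dif_pos h]
  exact h.coeFn_toLp

theorem norm_Lp_le_of_ae_bound {Ω : Type*} [MeasurableSpace Ω] {μ : Measure Ω}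
    [IsProbabilityMeasure μ] {V : Type*} [NormedAddCommGroup V] {F : Lp V 2 μ} {C : ℝ}
    (h : ∀ᵐ q ∂μ, ‖F q‖ ≤ C) : ‖F‖ ≤ C := by
  obtain ⟨q, hq⟩ := h.exists
  have := Lp.norm_le_of_ae_bound ((norm_nonneg _).trans hq) h
  simpa [measureUnivNNReal] using this

/-- Continuity is uniform in `q`, since left translation of `f` is continuous for the supremum norm. -/
theorem AlmostMinimalSection.continuous_lpSum (f : C_c(G, ℝ)) {a : Γ → V} {L s : ℝ}
    (hs : 0 ≤ s) (ha : ∀ γ : Γ, ‖a γ‖ ≤ L * Real.exp (s * ℓ (γ : G))) :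
    Continuous (σ.lpSum f a) := by
  refine continuous_iff_continuousAt.2 fun g₀ => ?_
  obtain ⟨W, hW, hW1⟩ := exists_compact_mem_nhds (1 : G)
  have hK : IsCompact (W⁻¹ * tsupport f ∪ tsupport f) :=
    (hW.inv.mul f.hasCompactSupport.isCompact).union f.hasCompactSupport.isCompact
  obtain ⟨κ, hκ0, hκ⟩ := σ.exists_latticeSum_bound hK hs
  have hL : 0 ≤ L := nonneg_of_mul_nonneg_left ((norm_nonneg _).trans (ha 1)) (Real.exp_pos _)
  have htend : Tendsto (fun g => g * g₀⁻¹) (𝓝 g₀) (𝓝 1) := by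
    have : Continuous fun g : G => g * g₀⁻¹ := by fun_prop
    simpa using this.tendsto g₀
  have hclose : ∀ ε > 0, ∀ᶠ g in 𝓝 g₀, ‖σ.lpSum f a g - σ.lpSum f a g₀‖ ≤
      ε * (κ * L * Real.exp (2 * s * ℓ g₀)) := by
    intro ε hε
    filter_upwards [htend.eventually (eventually_norm_mulLeft_sub_lt f.continuous f.hasCompactSupport 1 hε),
      htend hW1] with g hg hgW
    refine norm_Lp_le_of_ae_bound ?_
    filter_upwards [Lp.coeFn_sub (σ.lpSum f a g) (σ.lpSum f a g₀), σ.lpSum_ae f hs ha g,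
      σ.lpSum_ae f hs ha g₀] with q h1 h2 h3
    rw [h1, Pi.sub_apply, h2, h3]
    -- the difference is a lattice sum along `g₀ σ(q)` for the uniformly
    -- small function `f (g g₀⁻¹ ·) - f`
    have h4 : latticeSum f a (g * σ.toFun q) - latticeSum f a (g₀ * σ.toFun q) =
        latticeSum (fun y => f (g * g₀⁻¹ * y) - f y) a (g₀ * σ.toFun q) := by
      rw [latticeSum, latticeSum, latticeSum,
        ← (summable_latticeSum f.hasCompactSupport (fun x hx => image_eq_zero_of_notMem_tsupport hx) a _).tsum_sub
        (summable_latticeSum f.hasCompactSupport (fun x hx => image_eq_zero_of_notMem_tsupport hx) a _)]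
      congr 1; ext γ
      rw [sub_smul]
      congr 3
      group
    rw [h4]
    refine hκ _ ε a L (fun x hx => ?_) (fun x => by simpa using (hg x).le) ha g₀ q
    rw [Set.mem_union, not_or] at hx
    rw [image_eq_zero_of_notMem_tsupport hx.2, image_eq_zero_of_notMem_tsupport fun hcon => hx.1 ⟨(g * g₀⁻¹)⁻¹, Set.inv_mem_inv.2 hgW, _, hcon,
      inv_mul_cancel_left _ _⟩, sub_zero]
  have hc0 : 0 ≤ κ * L * Real.exp (2 * s * ℓ g₀) := by positivity
  refine Metric.tendsto_nhds.2 fun ε hε => ?_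
  filter_upwards [hclose (ε / (κ * L * Real.exp (2 * s * ℓ g₀) + 1)) (by positivity)] with g hg
  rw [dist_eq_norm]
  refine hg.trans_lt ?_
  rw [div_mul_eq_mul_div, div_lt_iff₀ (by positivity)]
  nlinarith

end LatticeSum

/-! ### Induction of two-step representations -/

section Induction

variable {G : Type u} [Group G] [TopologicalSpace G] [IsTopologicalGroup G] [T2Space G]
  [LocallyCompactSpace G] {Γ : Subgroup G} [DiscreteTopology Γ]
  {X₀ X₁ X₂ : Type u}
  [NormedAddCommGroup X₀] [NormedSpace ℂ X₀]
  [NormedAddCommGroup X₁] [NormedSpace ℂ X₁]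
  [NormedAddCommGroup X₂] [NormedSpace ℂ X₂]

theorem hasCompactSupport_mul_translate (ψ φ : C_c(G, ℝ)) (g k : G) (γ : G) :
    HasCompactSupport fun y => ψ (g * y) * φ (k * y * γ) :=
  (ψ.mulLeft g).hasCompactSupport.mul_right

theorem mul_translate_eq_zero (ψ φ : C_c(G, ℝ)) (g k : G) {γ : G}
    (hγ : γ ∉ (tsupport ψ)⁻¹ * {g * k⁻¹} * tsupport φ) (y : G) :
    ψ (g * y) * φ (k * y * γ) = 0 := by
  by_contra h
  refine hγ ⟨(g * y)⁻¹ * (g * k⁻¹), ⟨(g * y)⁻¹,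
    Set.inv_mem_inv.2 (subset_tsupport _ (left_ne_zero_of_mul h)), g * k⁻¹, rfl, rfl⟩, k * y * γ,
    subset_tsupport _ (right_ne_zero_of_mul h), ?_⟩
  simp only
  group

/-- The product of two lattice sums at the same point is again a sum over the lattice: collecting
the terms with a given `γ⁻¹ * δ` leaves coefficients that are functions on `G ⧸ Γ`. -/
theorem latticeSum_comp_latticeSum (ψ φ : C_c(G, ℝ)) {a₁ : Γ → X₁ →L[ℂ] X₂} {a₀ : Γ → X₀ →L[ℂ] X₁}
    {p : Γ → X₀ →L[ℂ] X₂} (hp : ∀ γ δ, (a₁ γ).comp (a₀ δ) = p (γ⁻¹ * δ)) (g k h : G) (x : X₀) :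
    latticeSum ψ a₁ (g * h) (latticeSum φ a₀ (k * h) x) =
      ∑' γ : Γ, periodize Γ (fun y => ψ (g * y) * φ (k * y * γ)) (h : G ⧸ Γ) • p γ x := by
  classical
  have hz : ∀ (f : C_c(G, ℝ)) y, y ∉ tsupport f → f y = 0 := fun f y hy => image_eq_zero_of_notMem_tsupport hy
  set S₁ := (finite_translates (Γ := Γ) ψ.hasCompactSupport (g * h)).toFinset with hS₁
  set S₀ := (finite_translates (Γ := Γ) φ.hasCompactSupport (k * h)).toFinset with hS₀
  have m₁ : ∀ γ : Γ, γ ∉ S₁ → ψ (g * h * γ) = 0 := fun γ hγ => hz ψ _ (by simpa [hS₁] using hγ)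
  have m₀ : ∀ γ : Γ, γ ∉ S₀ → φ (k * h * γ) = 0 := fun γ hγ => hz φ _ (by simpa [hS₀] using hγ)
  have e₁ : latticeSum ψ a₁ (g * h) = ∑ γ ∈ S₁, ψ (g * h * γ) • a₁ γ :=
    tsum_eq_sum fun γ hγ => by rw [m₁ γ hγ, zero_smul]
  have e₀ : latticeSum φ a₀ (k * h) = ∑ γ ∈ S₀, φ (k * h * γ) • a₀ γ :=
    tsum_eq_sum fun γ hγ => by rw [m₀ γ hγ, zero_smul]
  set S := S₁⁻¹ * S₀ with hS
  have e₂ : ∀ γ : Γ, periodize Γ (fun y => ψ (g * y) * φ (k * y * γ)) (h : G ⧸ Γ) =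
      ∑ δ ∈ S₁, ψ (g * h * δ) * φ (k * h * (δ * γ : Γ)) := by
    intro γ
    rw [periodize_mk, tsum_eq_sum (s := S₁) fun δ hδ => by rw [← mul_assoc, m₁ δ hδ, zero_mul]]
    simp [mul_assoc]
  have e₃ : ∑' γ : Γ, periodize Γ (fun y => ψ (g * y) * φ (k * y * γ)) (h : G ⧸ Γ) • p γ x =
      ∑ γ ∈ S, periodize Γ (fun y => ψ (g * y) * φ (k * y * γ)) (h : G ⧸ Γ) • p γ x := by
    refine tsum_eq_sum fun γ hγ => ?_
    rw [e₂, Finset.sum_eq_zero, zero_smul]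
    intro δ hδ
    rw [m₀ (δ * γ) fun hcon => hγ ?_, mul_zero]
    exact Finset.mem_mul.2 ⟨δ⁻¹, Finset.inv_mem_inv hδ, δ * γ, hcon, by simp⟩
  rw [e₁, e₀, e₃]
  simp only [sum_apply, smul_apply, e₂, Finset.sum_smul]
  rw [Finset.sum_comm]
  refine Finset.sum_congr rfl fun δ hδ => ?_
  rw [map_sum, Finset.smul_sum]
  -- for fixed `δ`, substitute `γ ↦ δ γ`
  have h1 : ∀ γ : Γ, ψ (g * h * δ) • a₁ δ (φ (k * h * γ) • a₀ γ x) =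
      (ψ (g * h * δ) * φ (k * h * γ)) • p (δ⁻¹ * γ) x := fun γ => by
    rw [← hp, ContinuousLinearMap.comp_apply, mul_smul]
    congr 1
    exact (a₁ δ).map_smul_of_tower _ _
  simp only [h1]
  have h2 : ∑ γ ∈ S₀, (ψ (g * h * δ) * φ (k * h * γ)) • p (δ⁻¹ * γ) x =
      ∑' γ : Γ, (ψ (g * h * δ) * φ (k * h * γ)) • p (δ⁻¹ * γ) x :=
    (tsum_eq_sum fun γ hγ => by rw [m₀ γ hγ, mul_zero, zero_smul]).symm
  have h3 : ∑ γ ∈ S, (ψ (g * h * δ) * φ (k * h * (δ * γ : Γ))) • p γ x =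
      ∑' γ : Γ, (ψ (g * h * δ) * φ (k * h * (δ * γ : Γ))) • p γ x :=
    (tsum_eq_sum fun γ hγ => by
      rw [m₀ (δ * γ) fun hcon => hγ ?_, mul_zero, zero_smul]
      exact Finset.mem_mul.2 ⟨δ⁻¹, Finset.inv_mem_inv hδ, δ * γ, hcon, by simp⟩).symm
  rw [h2, h3, ← (Equiv.mulLeft δ).tsum_eq]
  simp

variable [MeasurableSpace G] [BorelSpace G] [MeasurableSpace (G ⧸ Γ)] [BorelSpace (G ⧸ Γ)]
  {ℓ : LengthFunction G} {μ : Measure (G ⧸ Γ)} (σ : AlmostMinimalSection ℓ μ)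
  [IsProbabilityMeasure μ] [CompleteSpace X₂]

theorem finite_translates_coeff (ψ φ : C_c(G, ℝ)) (Q : Set G) (hQ : IsCompact Q) :
    {γ : Γ | (γ : G) ∈ (tsupport ψ)⁻¹ * Q * tsupport φ}.Finite := by
  have h := finite_translates (Γ := Γ)
    ((ψ.hasCompactSupport.isCompact.inv.mul hQ).mul φ.hasCompactSupport.isCompact) 1
  simpa using h

/-- The pairing of two fields of lattice sums no longer depends on the section `σ`: its coefficients
are integrals over `G`. -/
theorem AlmostMinimalSection.lpIntegrate_lpEval (ψ φ : C_c(G, ℝ)) {a₁ : Γ → X₁ →L[ℂ] X₂}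
    {a₀ : Γ → X₀ →L[ℂ] X₁}
    {p : Γ → X₀ →L[ℂ] X₂} (hp : ∀ γ δ, (a₁ γ).comp (a₀ δ) = p (γ⁻¹ * δ)) {L s : ℝ} (hs : 0 ≤ s)
    (h₁ : ∀ γ : Γ, ‖a₁ γ‖ ≤ L * Real.exp (s * ℓ (γ : G)))
    (h₀ : ∀ γ : Γ, ‖a₀ γ‖ ≤ L * Real.exp (s * ℓ (γ : G))) (g k : G) (x : X₀) :
    lpIntegrate μ (σ.lpSum ψ a₁ g) (lpEval μ (σ.lpSum φ a₀ k) x) =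
      ∑' γ : Γ, weil μ (fun y => ψ (g * y) * φ (k * y * γ)) • p γ x := by
  rw [lpIntegrate_apply]
  set s := (finite_translates_coeff (Γ := Γ) ψ φ {g * k⁻¹} isCompact_singleton).toFinset with hs'
  have hz : ∀ γ : Γ, γ ∉ s → (fun y => ψ (g * y) * φ (k * y * γ)) = 0 := fun γ hγ => by
    ext y
    exact mul_translate_eq_zero ψ φ g k (by simpa [hs'] using hγ) y
  have hp0 : ∀ q, periodize Γ (0 : G → ℝ) q = 0 := fun q => by simp [periodize]
  have e1 : ∀ᵐ q ∂μ, σ.lpSum ψ a₁ g q (lpEval μ (σ.lpSum φ a₀ k) x q) =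
      ∑ γ ∈ s, periodize Γ (fun y => ψ (g * y) * φ (k * y * γ)) q • p γ x := by
    filter_upwards [σ.lpSum_ae ψ hs h₁ g, σ.lpSum_ae φ hs h₀ k, lpEval_apply_ae μ (σ.lpSum φ a₀ k) x]
      with q hq₁ hq₀ hq
    rw [hq, hq₁, hq₀, latticeSum_comp_latticeSum ψ φ hp, σ.mk_apply]
    exact tsum_eq_sum fun γ hγ => by rw [hz γ hγ, hp0, zero_smul]
  have hint : ∀ γ : Γ, Integrable (periodize Γ (fun y => ψ (g * y) * φ (k * y * γ))) μ := fun γ =>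
    integrable_periodize μ (by fun_prop) (hasCompactSupport_mul_translate ψ φ g k γ)
  rw [integral_congr_ae e1, integral_finsetSum _ fun γ _ => (hint γ).smul_const _]
  simp only [integral_smul_const]
  exact (tsum_eq_sum fun γ hγ => by rw [hz γ hγ]; simp [hp0]).symm

variable [SMulInvariantMeasure G (G ⧸ Γ) μ]

/-- The coefficients `∫_G ψ (g y) φ (y γ) dy`, for a Haar measure of `G`. -/
noncomputable def inducedCoeff (μ : Measure (G ⧸ Γ)) (ψ φ : G → ℝ) (g : G) (γ : Γ) : ℝ :=
  weil μ fun y => ψ (g * y) * φ (y * γ)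

/-- Left invariance of the integral: only the product `g * k` matters. -/
theorem inducedCoeff_mul_inv (ψ φ : G → ℝ) (g k : G) (γ : Γ) :
    weil μ (fun y => ψ (g * y) * φ (k⁻¹ * y * γ)) = inducedCoeff μ ψ φ (g * k) γ := by
  have := weil_mul_left μ (fun y => ψ (g * y) * φ (k⁻¹ * y * γ)) k
  rw [← this, inducedCoeff]
  simp [mul_assoc]

/-- The two-step representation of `G` induced from a two-step representation `ρ` of `Γ`. It depends
on two functions `ψ`, `φ` on `G`. The middle space is `L²(G ⧸ Γ; X₁)`: a vector `x` is mapped to the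
field `q ↦ ∑_γ φ (g⁻¹ σ(q) γ) ρ.pi₀ γ x`, and a field `F` to the integral over `q` of
`∑_γ ψ (g σ(q) γ) ρ.pi₁ γ⁻¹ (F q)`. The inverse in the second sum makes the products
`ρ.pi₁ γ⁻¹ ∘ ρ.pi₀ δ = ρ.pi (γ⁻¹ δ)` depend on `γ⁻¹ δ` only. -/
noncomputable def AlmostMinimalSection.induce (ψ φ : C_c(G, ℝ)) (ρ : TwoStepRep Γ X₀ X₁ X₂) {L s : ℝ}
    (hs : 0 ≤ s)
    (h₀ : ∀ γ : Γ, ‖ρ.pi₀ γ‖ ≤ L * Real.exp (s * ℓ (γ : G)))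
    (h₁ : ∀ γ : Γ, ‖ρ.pi₁ γ‖ ≤ L * Real.exp (s * ℓ (γ : G))) :
    TwoStepRep G X₀ (Lp X₁ 2 μ) X₂ where
  pi₀ g := lpEval μ (σ.lpSum φ ρ.pi₀ g⁻¹)
  pi₁ g := lpIntegrate μ (σ.lpSum ψ (fun γ => ρ.pi₁ γ⁻¹) g)
  continuous₀ x := by
    have h := (σ.continuous_lpSum φ hs h₀).comp (continuous_inv (G := G))
    exact ((lpEval μ).continuous.comp h).clm_apply continuous_const
  continuous₁ F := by
    have h := σ.continuous_lpSum ψ (a := fun γ => ρ.pi₁ γ⁻¹) hs fun γ => by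
      refine (h₁ γ⁻¹).trans (le_of_eq ?_)
      rw [Subgroup.coe_inv, ℓ.map_inv]
    exact ((lpIntegrate μ).continuous.comp h).clm_apply continuous_const
  compat g g' g'' := by
    have h₁' : ∀ γ : Γ, ‖ρ.pi₁ γ⁻¹‖ ≤ L * Real.exp (s * ℓ (γ : G)) := fun γ => by
      refine (h₁ γ⁻¹).trans (le_of_eq ?_)
      rw [Subgroup.coe_inv, ℓ.map_inv]
    have hp : ∀ γ δ, (ρ.pi₁ γ⁻¹).comp (ρ.pi₀ δ) = ρ.pi (γ⁻¹ * δ) := fun γ δ => (ρ.pi_mul _ _).symm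
    ext x
    simp only [ContinuousLinearMap.comp_apply]
    rw [σ.lpIntegrate_lpEval ψ φ hp hs h₁' h₀, σ.lpIntegrate_lpEval ψ φ hp hs h₁' h₀]
    simp only [inducedCoeff_mul_inv (ψ : G → ℝ) (φ : G → ℝ)]
    simp only [mul_assoc]

variable (ρ : TwoStepRep Γ X₀ X₁ X₂) {L s : ℝ} (hs : 0 ≤ s)
  (h₀ : ∀ γ : Γ, ‖ρ.pi₀ γ‖ ≤ L * Real.exp (s * ℓ (γ : G)))
  (h₁ : ∀ γ : Γ, ‖ρ.pi₁ γ‖ ≤ L * Real.exp (s * ℓ (γ : G)))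

theorem AlmostMinimalSection.induce_pi_apply (ψ φ : C_c(G, ℝ)) (g : G) (x : X₀) :
    (σ.induce ψ φ ρ hs h₀ h₁).pi g x = ∑' γ : Γ, inducedCoeff μ ψ φ g γ • ρ.pi γ x := by
  have h₁' : ∀ γ : Γ, ‖ρ.pi₁ γ⁻¹‖ ≤ L * Real.exp (s * ℓ (γ : G)) := fun γ => by
    refine (h₁ γ⁻¹).trans (le_of_eq ?_)
    rw [Subgroup.coe_inv, ℓ.map_inv]
  have hp : ∀ γ δ, (ρ.pi₁ γ⁻¹).comp (ρ.pi₀ δ) = ρ.pi (γ⁻¹ * δ) := fun γ δ => (ρ.pi_mul _ _).symm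
  refine (σ.lpIntegrate_lpEval ψ φ hp hs h₁' h₀ g 1⁻¹ x).trans ?_
  simp only [inducedCoeff_mul_inv (ψ : G → ℝ) (φ : G → ℝ), mul_one]

/-- The bounds on the induced representation, uniform for functions supported in a given compact
set and bounded by a given constant. -/
theorem AlmostMinimalSection.exists_induce_bound {K : Set G} (hK : IsCompact K) {s : ℝ}
    (hs : 0 ≤ s) {B : ℝ} (hB : 0 ≤ B) : ∃ κ : ℝ, 0 ≤ κ ∧ ∀ {X₀ X₁ X₂ : Type u}
      [NormedAddCommGroup X₀] [NormedSpace ℂ X₀]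
      [NormedAddCommGroup X₁] [NormedSpace ℂ X₁]
      [NormedAddCommGroup X₂] [NormedSpace ℂ X₂] [CompleteSpace X₂]
      (ρ : TwoStepRep Γ X₀ X₁ X₂) (L : ℝ)
      (h₀ : ∀ γ : Γ, ‖ρ.pi₀ γ‖ ≤ L * Real.exp (s * ℓ (γ : G)))
      (h₁ : ∀ γ : Γ, ‖ρ.pi₁ γ‖ ≤ L * Real.exp (s * ℓ (γ : G))) (ψ φ : C_c(G, ℝ)),
      (∀ x ∉ K, ψ x = 0) → (∀ x ∉ K, φ x = 0) → (∀ x, |ψ x| ≤ B) → (∀ x, |φ x| ≤ B) →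
      (∀ g, ‖(σ.induce ψ φ ρ hs h₀ h₁).pi₀ g‖ ≤ κ * L * Real.exp (2 * s * ℓ g)) ∧
      ∀ g, ‖(σ.induce ψ φ ρ hs h₀ h₁).pi₁ g‖ ≤ κ * L * Real.exp (2 * s * ℓ g) := by
  obtain ⟨κ, hκ0, hκ⟩ := σ.exists_latticeSum_bound hK hs
  refine ⟨B * κ, by positivity, fun ρ L h₀ h₁ ψ φ hψ hφ hψB hφB => ⟨fun g => ?_, fun g => ?_⟩⟩
  · refine (norm_lpEval_le μ _).trans (norm_Lp_le_of_ae_bound ?_)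
    filter_upwards [σ.lpSum_ae φ hs h₀ g⁻¹] with q hq
    rw [hq]
    refine (hκ φ B ρ.pi₀ L hφ hφB h₀ g⁻¹ q).trans (le_of_eq ?_)
    rw [ℓ.map_inv]
    ring
  · have h₁' : ∀ γ : Γ, ‖ρ.pi₁ γ⁻¹‖ ≤ L * Real.exp (s * ℓ (γ : G)) := fun γ => by
      refine (h₁ γ⁻¹).trans (le_of_eq ?_)
      rw [Subgroup.coe_inv, ℓ.map_inv]
    refine (norm_lpIntegrate_le μ _).trans (norm_Lp_le_of_ae_bound ?_)
    filter_upwards [σ.lpSum_ae ψ hs h₁' g] with q hq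
    rw [hq]
    refine (hκ ψ B _ L hψ hψB h₁' g q).trans (le_of_eq ?_)
    ring

end Induction

/-! ### Averages of induced representations -/

section InducedAverage

variable {G : Type u} [Group G] [TopologicalSpace G] [IsTopologicalGroup G] [T2Space G]
  [LocallyCompactSpace G] {Γ : Subgroup G} [DiscreteTopology Γ]
  [MeasurableSpace G] [BorelSpace G] [MeasurableSpace (G ⧸ Γ)] [BorelSpace (G ⧸ Γ)]
  {ℓ : LengthFunction G} {μ : Measure (G ⧸ Γ)}
  [IsProbabilityMeasure μ] [SMulInvariantMeasure G (G ⧸ Γ) μ]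

theorem inducedCoeff_eq_zero (ψ φ : C_c(G, ℝ)) {g : G} {γ : Γ}
    (hγ : (γ : G) ∉ (tsupport ψ)⁻¹ * {g} * tsupport φ) : inducedCoeff μ ψ φ g γ = 0 := by
  have h : (fun y => ψ (g * y) * φ (y * γ)) = 0 := by
    ext y
    have := mul_translate_eq_zero ψ φ g 1 (γ := γ) (by simpa using hγ) y
    simpa using this
  rw [inducedCoeff, h]
  simp [weil, periodize]

theorem inducedCoeff_nonneg {ψ φ : G → ℝ} (hψ : ∀ x, 0 ≤ ψ x) (hφ : ∀ x, 0 ≤ φ x) (g : G) (γ : Γ) :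
    0 ≤ inducedCoeff μ ψ φ g γ :=
  weil_nonneg μ fun _ => mul_nonneg (hψ _) (hφ _)

theorem continuous_inducedCoeff (ψ φ : C_c(G, ℝ)) (γ : Γ) :
    Continuous fun g => inducedCoeff μ ψ φ g γ := by
  have hψ : Continuous (ψ : G → ℝ) := map_continuous ψ
  have hφ : Continuous (φ : G → ℝ) := map_continuous φ
  refine continuous_iff_continuousAt.2 fun g₀ => ?_
  set c := weil μ fun y => |φ (y * γ)| with hc
  have hc0 : 0 ≤ c := weil_nonneg μ fun _ => abs_nonneg _
  have hs : HasCompactSupport fun y => |φ (y * γ)| := (φ.mulRight γ).hasCompactSupport.norm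
  refine Metric.tendsto_nhds.2 fun ε hε => ?_
  filter_upwards [eventually_norm_mulLeft_sub_lt hψ ψ.hasCompactSupport g₀
    (ε := ε / (c + 1)) (by positivity)] with g hg
  have h1 : ∀ k, HasCompactSupport fun y => ψ (k * y) * φ (y * γ) := fun k =>
    (ψ.mulLeft k).hasCompactSupport.mul_right
  rw [dist_eq_norm, inducedCoeff, inducedCoeff, ← weil_sub μ (by fun_prop) (h1 g) (by fun_prop) (h1 g₀)]
  have h2 : |weil μ fun y => ψ (g * y) * φ (y * γ) - ψ (g₀ * y) * φ (y * γ)| ≤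
      weil μ fun y => ε / (c + 1) * |φ (y * γ)| := by
    refine abs_weil_le μ (by fun_prop) ((h1 g).sub (h1 g₀)) (by fun_prop) hs.mul_left fun y => ?_
    rw [← sub_mul, abs_mul]
    gcongr
    exact (hg y).le
  have h3 : weil μ (fun y => ε / (c + 1) * |φ (y * γ)|) = ε / (c + 1) * c :=
    weil_const_smul μ (ε / (c + 1)) fun y => |φ (y * γ)|
  rw [h3] at h2
  refine h2.trans_lt ?_
  rw [div_mul_eq_mul_div, div_lt_iff₀ (by positivity)]
  nlinarith

/-- The weights on `Γ` obtained from the measure `m` on `G`: the mean of the coefficients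
`inducedCoeff` of the induced representation. -/
noncomputable def averageCoeff (μ : Measure (G ⧸ Γ)) (m : CompactProb G) (ψ φ : G → ℝ) (γ : Γ) : ℝ :=
  ∫ g, inducedCoeff μ ψ φ g γ ∂m.measure

theorem averageCoeff_nonneg (m : CompactProb G) {ψ φ : G → ℝ} (hψ : ∀ x, 0 ≤ ψ x)
    (hφ : ∀ x, 0 ≤ φ x) (γ : Γ) : 0 ≤ averageCoeff μ m ψ φ γ :=
  integral_nonneg fun _ => inducedCoeff_nonneg hψ hφ _ _

theorem averageCoeff_eq_zero (m : CompactProb G) (ψ φ : C_c(G, ℝ)) {S : Set G}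
    (hS : m.SupportedIn S) {γ : Γ} (hγ : (γ : G) ∉ (tsupport ψ)⁻¹ * S * tsupport φ) :
    averageCoeff μ m ψ φ γ = 0 := by
  refine integral_eq_zero_of_ae (hS.ae.mono fun g hg => inducedCoeff_eq_zero ψ φ fun h => hγ ?_)
  exact Set.mul_subset_mul_right (Set.mul_subset_mul_left (Set.singleton_subset_iff.2 hg)) h

theorem exists_finset_averageCoeff (m : CompactProb G) (ψ φ : C_c(G, ℝ)) :
    ∃ (s : Finset Γ) (Q : Set G), m.SupportedIn Q ∧ (∀ g ∈ Q, ∀ γ ∉ s, inducedCoeff μ ψ φ g γ = 0) ∧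
      ∀ γ ∉ s, averageCoeff μ m ψ φ γ = 0 := by
  obtain ⟨Q, hQ, hmQ⟩ := m.exists_compact
  have hmQ' : m.SupportedIn Q := ⟨Q, hQ, subset_rfl, hmQ⟩
  refine ⟨(finite_translates_coeff (Γ := Γ) ψ φ Q hQ).toFinset, Q, hmQ', fun g hg γ hγ => ?_, fun γ hγ => ?_⟩
  · refine inducedCoeff_eq_zero ψ φ fun h => hγ ?_
    rw [Set.Finite.mem_toFinset]
    exact Set.mul_subset_mul_right (Set.mul_subset_mul_left (Set.singleton_subset_iff.2 hg)) h
  · exact averageCoeff_eq_zero m ψ φ hmQ' (by simpa using hγ)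

theorem summable_averageCoeff (m : CompactProb G) (ψ φ : C_c(G, ℝ)) {V : Type*}
    [NormedAddCommGroup V] [NormedSpace ℝ V] (a : Γ → V) :
    Summable fun γ => averageCoeff μ m ψ φ γ • a γ := by
  obtain ⟨s, Q, -, -, hs⟩ := exists_finset_averageCoeff (μ := μ) m ψ φ
  refine summable_of_hasFiniteSupport (s.finite_toSet.subset fun γ hγ => ?_)
  by_contra hcon
  exact hγ (by simp only [hs γ hcon, zero_smul])

theorem integrable_inducedCoeff (m : CompactProb G) (ψ φ : C_c(G, ℝ)) (γ : Γ) :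
    Integrable (fun g => inducedCoeff μ ψ φ g γ) m.measure :=
  m.integrable_of_continuous (continuous_inducedCoeff ψ φ γ)

theorem averageCoeff_add_left (m : CompactProb G) (ψ ψ' φ : C_c(G, ℝ)) (γ : Γ) :
    averageCoeff μ m (ψ + ψ') φ γ = averageCoeff μ m ψ φ γ + averageCoeff μ m ψ' φ γ := by
  rw [averageCoeff, averageCoeff, averageCoeff,
    ← integral_add (integrable_inducedCoeff m ψ φ γ) (integrable_inducedCoeff m ψ' φ γ)]
  congr 1; ext g
  have h1 : ∀ f : C_c(G, ℝ), HasCompactSupport fun y => f (g * y) * φ (y * γ) := fun f =>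
    (f.mulLeft g).hasCompactSupport.mul_right
  rw [inducedCoeff, inducedCoeff, inducedCoeff, ← weil_add μ (by fun_prop) (h1 ψ) (by fun_prop) (h1 ψ')]
  simp [add_mul]

theorem averageCoeff_add_right (m : CompactProb G) (ψ φ φ' : C_c(G, ℝ)) (γ : Γ) :
    averageCoeff μ m ψ (φ + φ') γ = averageCoeff μ m ψ φ γ + averageCoeff μ m ψ φ' γ := by
  rw [averageCoeff, averageCoeff, averageCoeff,
    ← integral_add (integrable_inducedCoeff m ψ φ γ) (integrable_inducedCoeff m ψ φ' γ)]
  congr 1; ext g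
  have h1 : ∀ f : C_c(G, ℝ), HasCompactSupport fun y => ψ (g * y) * f (y * γ) := fun f =>
    (ψ.mulLeft g).hasCompactSupport.mul_right
  rw [inducedCoeff, inducedCoeff, inducedCoeff, ← weil_add μ (by fun_prop) (h1 φ) (by fun_prop) (h1 φ')]
  simp [mul_add]

theorem averageCoeff_smul_left (m : CompactProb G) (c : ℝ) (ψ φ : C_c(G, ℝ)) (γ : Γ) :
    averageCoeff μ m (c • ψ : C_c(G, ℝ)) φ γ = c * averageCoeff μ m ψ φ γ := by
  rw [averageCoeff, averageCoeff, ← integral_const_mul]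
  congr 1; ext g
  rw [inducedCoeff, inducedCoeff, ← smul_eq_mul c, ← weil_const_smul]
  simp [mul_assoc]

theorem averageCoeff_smul_right (m : CompactProb G) (c : ℝ) (ψ φ : C_c(G, ℝ)) (γ : Γ) :
    averageCoeff μ m ψ (c • φ : C_c(G, ℝ)) γ = c * averageCoeff μ m ψ φ γ := by
  rw [averageCoeff, averageCoeff, ← integral_const_mul]
  congr 1; ext g
  rw [inducedCoeff, inducedCoeff, ← smul_eq_mul c, ← weil_const_smul]
  simp [mul_left_comm]

theorem averageCoeff_translate (m : CompactProb G) (ψ φ : C_c(G, ℝ)) (k k' : G) (γ : Γ) :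
    averageCoeff μ (m.translate k k') ψ φ γ = ∫ g, inducedCoeff μ ψ φ (k * g * k') γ ∂m.measure := by
  have hc : Continuous fun h : G => k * h * k' := by fun_prop
  exact integral_map hc.measurable.aemeasurable
    (integrable_inducedCoeff (m.translate k k') ψ φ γ).aestronglyMeasurable

theorem averageCoeff_mulLeft_left (m : CompactProb G) (ψ φ : C_c(G, ℝ)) (k : G) (γ : Γ) :
    averageCoeff μ m (ψ.mulLeft k) φ γ = averageCoeff μ (m.translate k 1) ψ φ γ := by
  rw [averageCoeff_translate]
  simp [averageCoeff, inducedCoeff, mul_assoc]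

theorem averageCoeff_mulLeft_right (m : CompactProb G) (ψ φ : C_c(G, ℝ)) (k : G) (γ : Γ) :
    averageCoeff μ m ψ (φ.mulLeft k) γ = averageCoeff μ (m.translate 1 k⁻¹) ψ φ γ := by
  rw [averageCoeff_translate, averageCoeff]
  congr 1; ext g
  rw [← inducedCoeff_mul_inv, inducedCoeff]
  simp [mul_assoc]

/-- Right translation of `ψ` and `φ` by elements of `Γ` amounts to a two-sided translation of the
image measure on `Γ`. -/
theorem averageCoeff_mulRight (m : CompactProb G) (ψ φ : C_c(G, ℝ)) (δ δ' γ : Γ) :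
    averageCoeff μ m (ψ.mulRight δ) (φ.mulRight δ') γ = averageCoeff μ m ψ φ (δ⁻¹ * γ * δ') := by
  rw [averageCoeff, averageCoeff]
  congr 1; ext g
  rw [inducedCoeff, inducedCoeff, ← weil_mul_right μ (fun y => ψ (g * y) * φ (y * (δ⁻¹ * γ * δ' : Γ))) δ]
  simp [mul_assoc]

variable {X₀ X₁ X₂ : Type u}
  [NormedAddCommGroup X₀] [NormedSpace ℂ X₀]
  [NormedAddCommGroup X₁] [NormedSpace ℂ X₁]
  [NormedAddCommGroup X₂] [NormedSpace ℂ X₂]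

/-- The average of a two-step representation of `Γ` against the weights `averageCoeff`. Only finitely
many terms of the sum are non-zero. -/
noncomputable def inducedAverage (μ : Measure (G ⧸ Γ)) (ρ : TwoStepRep Γ X₀ X₁ X₂) (m : CompactProb G) (ψ φ : G → ℝ) :
    X₀ →L[ℂ] X₂ := ∑' γ, averageCoeff μ m ψ φ γ • ρ.pi γ

theorem inducedAverage_apply (ρ : TwoStepRep Γ X₀ X₁ X₂) (m : CompactProb G) (ψ φ : C_c(G, ℝ)) (x : X₀) :
    inducedAverage μ ρ m ψ φ x = ∑' γ, averageCoeff μ m ψ φ γ • ρ.pi γ x := by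
  obtain ⟨s, Q, -, -, hs⟩ := exists_finset_averageCoeff (μ := μ) m ψ φ
  rw [inducedAverage, tsum_eq_sum (s := s) fun γ hγ => by rw [hs γ hγ, zero_smul],
    tsum_eq_sum (s := s) fun γ hγ => by rw [hs γ hγ, zero_smul]]
  simp

/-- Averaging the induced representation of `G` against `m` amounts to averaging the representation
of `Γ` against the weights obtained from `m`. -/
theorem AlmostMinimalSection.average_induce [CompleteSpace X₀] [CompleteSpace X₂]
    (σ : AlmostMinimalSection ℓ μ)
    (ρ : TwoStepRep Γ X₀ X₁ X₂) {L s : ℝ} (hs : 0 ≤ s)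
    (h₀ : ∀ γ : Γ, ‖ρ.pi₀ γ‖ ≤ L * Real.exp (s * ℓ (γ : G)))
    (h₁ : ∀ γ : Γ, ‖ρ.pi₁ γ‖ ≤ L * Real.exp (s * ℓ (γ : G))) (ψ φ : C_c(G, ℝ)) (m : CompactProb G) :
    (σ.induce ψ φ ρ hs h₀ h₁).average m = inducedAverage μ ρ m ψ φ := by
  obtain ⟨s, Q, hQ, hsQ, hs'⟩ := exists_finset_averageCoeff (μ := μ) m ψ φ
  ext x
  rw [TwoStepRep.average_apply, inducedAverage_apply,
    tsum_eq_sum (s := s) fun γ hγ => by rw [hs' γ hγ, zero_smul]]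
  have h1 : ∀ᵐ g ∂m.measure, (σ.induce ψ φ ρ hs h₀ h₁).pi g x =
      ∑ γ ∈ s, inducedCoeff μ ψ φ g γ • ρ.pi γ x := hQ.ae.mono fun g hg => by
    rw [σ.induce_pi_apply, tsum_eq_sum fun γ hγ => by rw [hsQ g hg γ hγ, zero_smul]]
  rw [integral_congr_ae h1, integral_finsetSum _ fun γ _ =>
    (integrable_inducedCoeff m ψ φ γ).smul_const _]
  simp only [integral_smul_const]
  rfl

/-- Induced averages as linear maps in the first function. -/
noncomputable def inducedAverageLeft (μ : Measure (G ⧸ Γ)) [IsProbabilityMeasure μ]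
    [SMulInvariantMeasure G (G ⧸ Γ) μ] (ρ : TwoStepRep Γ X₀ X₁ X₂) (m : CompactProb G)
    (φ : C_c(G, ℝ)) : C_c(G, ℝ) →ₗ[ℝ] X₀ →L[ℂ] X₂ where
  toFun ψ := inducedAverage μ ρ m ψ φ
  map_add' ψ ψ' := by
    rw [inducedAverage, inducedAverage, inducedAverage, ← (summable_averageCoeff (μ := μ) m ψ φ ρ.pi).tsum_add
      (summable_averageCoeff (μ := μ) m ψ' φ ρ.pi)]
    congr 1; ext1 γ
    rw [← add_smul, ← averageCoeff_add_left]
    rfl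
  map_smul' c ψ := by
    rw [inducedAverage, inducedAverage, RingHom.id_apply, ← tsum_const_smul'' c]
    congr 1; ext1 γ
    rw [averageCoeff_smul_left, mul_smul]

/-- Induced averages as linear maps in the second function. -/
noncomputable def inducedAverageRight (μ : Measure (G ⧸ Γ)) [IsProbabilityMeasure μ]
    [SMulInvariantMeasure G (G ⧸ Γ) μ] (ρ : TwoStepRep Γ X₀ X₁ X₂) (m : CompactProb G)
    (ψ : C_c(G, ℝ)) : C_c(G, ℝ) →ₗ[ℝ] X₀ →L[ℂ] X₂ where
  toFun φ := inducedAverage μ ρ m ψ φ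
  map_add' φ φ' := by
    rw [inducedAverage, inducedAverage, inducedAverage, ← (summable_averageCoeff (μ := μ) m ψ φ ρ.pi).tsum_add
      (summable_averageCoeff (μ := μ) m ψ φ' ρ.pi)]
    congr 1; ext1 γ
    rw [← add_smul, ← averageCoeff_add_right]
    rfl
  map_smul' c φ := by
    rw [inducedAverage, inducedAverage, RingHom.id_apply, ← tsum_const_smul'' c]
    congr 1; ext1 γ
    rw [averageCoeff_smul_right, mul_smul]

variable [CompleteSpace X₀] [CompleteSpace X₁] [CompleteSpace X₂]

/-- The limit of the induced averages, as a function of the two auxiliary functions on `G`. By the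
uniqueness of invariant functionals it only depends on the integrals of the two functions. The
property is used with the exponent `2 * s`, as induction doubles the exponent of growth. -/
theorem AlmostMinimalSection.exists_limit [μ.Regular] (σ : AlmostMinimalSection ℓ μ)
    {E : BanachClass.{u}} (hE : E.StableL2) (h1 : ℓ 1 = 0) {s t C : ℝ} (hs : 0 ≤ s) (ht : 0 < t)
    {m : ℕ → CompactProb G} (hm : (m 0).SupportedIn {g | ℓ g ≤ 0})
    (H : StarEstimate ℓ E (2 * s) t C m) (hX : E X₁) (ρ : TwoStepRep Γ X₀ X₁ X₂) (L : ℝ)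
    (h₀ : ∀ γ : Γ, ‖ρ.pi₀ γ‖ ≤ L * Real.exp (s * ℓ (γ : G)))
    (h₁ : ∀ γ : Γ, ‖ρ.pi₁ γ‖ ≤ L * Real.exp (s * ℓ (γ : G))) :
    ∃ P : C_c(G, ℝ) → C_c(G, ℝ) → X₀ →L[ℂ] X₂,
      (∀ (ψ φ : C_c(G, ℝ)) (κ : ℝ),
        (∀ g, ‖(σ.induce ψ φ ρ hs h₀ h₁).pi₀ g‖ ≤ κ * L * Real.exp (2 * s * ℓ g)) →
        (∀ g, ‖(σ.induce ψ φ ρ hs h₀ h₁).pi₁ g‖ ≤ κ * L * Real.exp (2 * s * ℓ g)) →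
        ‖P ψ φ‖ ≤ (κ * L) ^ 2 + C * (κ * L) ^ 2 ∧
        ∀ n : ℕ, ‖inducedAverage μ ρ (m n) ψ φ - P ψ φ‖ ≤ C * (κ * L) ^ 2 * Real.exp (-(t * n))) ∧
      (∀ ψ φ : C_c(G, ℝ), Tendsto (fun n => inducedAverage μ ρ (m n) ψ φ) atTop (𝓝 (P ψ φ))) ∧
      (∀ ψ φ f : C_c(G, ℝ), weil μ f • P ψ φ = weil μ ψ • P f φ) ∧
      ∀ ψ φ f : C_c(G, ℝ), weil μ f • P ψ φ = weil μ φ • P ψ f := by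
  have hsup : ∀ f : C_c(G, ℝ), ∃ B, 0 ≤ B ∧ ∀ x, |f x| ≤ B := fun f => by
    obtain ⟨B, hB⟩ := f.continuous.bounded_above_of_compact_support f.hasCompactSupport
    exact ⟨max B 0, le_max_right _ _, fun x => (hB x).trans (le_max_left _ _)⟩
  -- the estimate for the induced representation; a priori the limit depends on the bound `κ`
  have hstar : ∀ (ψ φ : C_c(G, ℝ)) (κ : ℝ),
      (∀ g, ‖(σ.induce ψ φ ρ hs h₀ h₁).pi₀ g‖ ≤ κ * L * Real.exp (2 * s * ℓ g)) →
      (∀ g, ‖(σ.induce ψ φ ρ hs h₀ h₁).pi₁ g‖ ≤ κ * L * Real.exp (2 * s * ℓ g)) →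
      ∃ P : X₀ →L[ℂ] X₂, (∀ n : ℕ, ‖inducedAverage μ ρ (m n) ψ φ - P‖ ≤
        C * (κ * L) ^ 2 * Real.exp (-(t * n))) ∧ ∀ g g' : G, Tendsto (fun n =>
          ‖inducedAverage μ ρ ((m n).translate g g') ψ φ - inducedAverage μ ρ (m n) ψ φ‖) atTop (𝓝 0) := by
    intro ψ φ κ hκ₀ hκ₁
    have := H X₀ (Lp X₁ 2 μ) X₂ (σ.induce ψ φ ρ hs h₀ h₁) (κ * L) (hE X₁ _ μ hX) hκ₀ hκ₁
    simpa only [σ.average_induce] using this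
  have htend : ∀ (ψ φ : C_c(G, ℝ)) (κ : ℝ) (P : X₀ →L[ℂ] X₂),
      (∀ n : ℕ, ‖inducedAverage μ ρ (m n) ψ φ - P‖ ≤ C * (κ * L) ^ 2 * Real.exp (-(t * n))) →
      Tendsto (fun n => inducedAverage μ ρ (m n) ψ φ) atTop (𝓝 P) := by
    intro ψ φ κ P hP
    refine tendsto_iff_norm_sub_tendsto_zero.2 (squeeze_zero (fun _ => norm_nonneg _) hP ?_)
    simpa using (tendsto_exp_neg_mul_natCast ht).const_mul (C * (κ * L) ^ 2)
  have hex : ∀ ψ φ : C_c(G, ℝ), ∃ P : X₀ →L[ℂ] X₂,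
      Tendsto (fun n => inducedAverage μ ρ (m n) ψ φ) atTop (𝓝 P) ∧ ∀ g g' : G, Tendsto (fun n =>
          ‖inducedAverage μ ρ ((m n).translate g g') ψ φ - inducedAverage μ ρ (m n) ψ φ‖) atTop (𝓝 0) := by
    intro ψ φ
    obtain ⟨B, hB0, hB⟩ := hsup ψ
    obtain ⟨B', hB'0, hB'⟩ := hsup φ
    obtain ⟨κ, -, hκ⟩ := σ.exists_induce_bound
      (ψ.hasCompactSupport.isCompact.union φ.hasCompactSupport.isCompact) hs (le_max_of_le_left hB0 : 0 ≤ max B B')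
    obtain ⟨hκ₀, hκ₁⟩ := hκ ρ L h₀ h₁ ψ φ (fun x hx => image_eq_zero_of_notMem_tsupport fun h => hx (Or.inl h))
      (fun x hx => image_eq_zero_of_notMem_tsupport fun h => hx (Or.inr h))
      (fun x => (hB x).trans (le_max_left _ _)) (fun x => (hB' x).trans (le_max_right _ _))
    obtain ⟨P, hP, hP'⟩ := hstar ψ φ κ hκ₀ hκ₁
    exact ⟨P, htend ψ φ κ P hP, hP'⟩
  choose P hP hPinv using hex
  have hrate : ∀ (ψ φ : C_c(G, ℝ)) (κ : ℝ),
      (∀ g, ‖(σ.induce ψ φ ρ hs h₀ h₁).pi₀ g‖ ≤ κ * L * Real.exp (2 * s * ℓ g)) →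
      (∀ g, ‖(σ.induce ψ φ ρ hs h₀ h₁).pi₁ g‖ ≤ κ * L * Real.exp (2 * s * ℓ g)) →
      ∀ n : ℕ, ‖inducedAverage μ ρ (m n) ψ φ - P ψ φ‖ ≤ C * (κ * L) ^ 2 * Real.exp (-(t * n)) := by
    intro ψ φ κ hκ₀ hκ₁
    obtain ⟨P', hP', -⟩ := hstar ψ φ κ hκ₀ hκ₁
    rwa [tendsto_nhds_unique (hP ψ φ) (htend ψ φ κ P' hP')]
  have hPnorm : ∀ (ψ φ : C_c(G, ℝ)) (κ : ℝ),
      (∀ g, ‖(σ.induce ψ φ ρ hs h₀ h₁).pi₀ g‖ ≤ κ * L * Real.exp (2 * s * ℓ g)) →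
      (∀ g, ‖(σ.induce ψ φ ρ hs h₀ h₁).pi₁ g‖ ≤ κ * L * Real.exp (2 * s * ℓ g)) →
      ‖P ψ φ‖ ≤ (κ * L) ^ 2 + C * (κ * L) ^ 2 := by
    intro ψ φ κ hκ₀ hκ₁
    -- `P ψ φ` is compared with the average against `m 0`, which lives at length zero
    have h2 := hrate ψ φ κ hκ₀ hκ₁ 0
    have h3 : ‖inducedAverage μ ρ (m 0) ψ φ‖ ≤ (κ * L) ^ 2 := by
      rw [← σ.average_induce ρ hs h₀ h₁]
      refine TwoStepRep.norm_average_le _ hm fun g hg => ?_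
      refine (TwoStepRep.norm_pi_le _ h1 hκ₀ hκ₁ g).trans ?_
      have : ℓ g = 0 := le_antisymm hg (ℓ.nonneg g)
      simp [this]
    have h4 : P ψ φ = inducedAverage μ ρ (m 0) ψ φ - (inducedAverage μ ρ (m 0) ψ φ - P ψ φ) := by abel
    rw [h4]
    refine norm_sub_le_of_le h3 ?_
    simpa using h2
  have hnorm : ∀ K, IsCompact K → ∀ B, 0 ≤ B → ∃ C', ∀ ψ φ : C_c(G, ℝ), (∀ x ∉ K, ψ x = 0) →
      (∀ x ∉ K, φ x = 0) → (∀ x, |ψ x| ≤ B) → (∀ x, |φ x| ≤ B) → ‖P ψ φ‖ ≤ C' := by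
    intro K hK B hB
    obtain ⟨κ, -, hκ⟩ := σ.exists_induce_bound hK hs hB
    refine ⟨(κ * L) ^ 2 + C * (κ * L) ^ 2, fun ψ φ hψ hφ hψB hφB => ?_⟩
    obtain ⟨hκ₀, hκ₁⟩ := hκ ρ L h₀ h₁ ψ φ hψ hφ hψB hφB
    exact hPnorm ψ φ κ hκ₀ hκ₁
  have hμ : NeZero μ := inferInstance
  refine ⟨P, fun ψ φ κ hκ₀ hκ₁ => ⟨hPnorm ψ φ κ hκ₀ hκ₁, hrate ψ φ κ hκ₀ hκ₁⟩, hP, fun ψ φ f => ?_, fun ψ φ f => ?_⟩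
  · let I : C_c(G, ℝ) →ₗ[ℝ] X₀ →L[ℂ] X₂ := linearMapOfTendsto (fun ψ => P ψ φ)
      (fun n => inducedAverageLeft μ ρ (m n) φ) (tendsto_pi_nhds.2 fun ψ => hP ψ φ)
    obtain ⟨B', hB'0, hB'⟩ := hsup φ
    refine weil_smul_comm μ I (fun K hK => ?_) (fun ψ k => ?_) ψ f
    · obtain ⟨C', hC'⟩ := hnorm _ (hK.union φ.hasCompactSupport.isCompact) (max 1 B')
        (le_max_of_le_left zero_le_one)
      exact ⟨C', fun f hf hf1 => hC' f φ (fun x hx => hf x fun h => hx (Or.inl h))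
        (fun x hx => image_eq_zero_of_notMem_tsupport fun h => hx (Or.inr h))
        (fun x => (hf1 x).trans (le_max_left _ _)) (fun x => (hB' x).trans (le_max_right _ _))⟩
    · change P (ψ.mulLeft k) φ = P ψ φ
      refine tendsto_nhds_unique (hP _ φ) ?_
      have h2 : ∀ n, inducedAverage μ ρ (m n) (ψ.mulLeft k) φ =
          inducedAverage μ ρ ((m n).translate k 1) ψ φ := fun n => by
        simp only [inducedAverage, averageCoeff_mulLeft_left]
      simp only [h2]
      have h3 := (tendsto_zero_iff_norm_tendsto_zero.2 (hPinv ψ φ k 1)).add (hP ψ φ)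
      simpa using h3
  · let I : C_c(G, ℝ) →ₗ[ℝ] X₀ →L[ℂ] X₂ := linearMapOfTendsto (fun φ => P ψ φ)
      (fun n => inducedAverageRight μ ρ (m n) ψ) (tendsto_pi_nhds.2 fun φ => hP ψ φ)
    obtain ⟨B', hB'0, hB'⟩ := hsup ψ
    refine weil_smul_comm μ I (fun K hK => ?_) (fun φ k => ?_) φ f
    · obtain ⟨C', hC'⟩ := hnorm _ (hK.union ψ.hasCompactSupport.isCompact) (max 1 B')
        (le_max_of_le_left zero_le_one)
      exact ⟨C', fun f hf hf1 => hC' ψ f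
        (fun x hx => image_eq_zero_of_notMem_tsupport fun h => hx (Or.inr h)) (fun x hx => hf x fun h => hx (Or.inl h))
        (fun x => (hB' x).trans (le_max_right _ _)) (fun x => (hf1 x).trans (le_max_left _ _))⟩
    · change P ψ (φ.mulLeft k) = P ψ φ
      refine tendsto_nhds_unique (hP ψ _) ?_
      have h2 : ∀ n, inducedAverage μ ρ (m n) ψ (φ.mulLeft k) =
          inducedAverage μ ρ ((m n).translate 1 k⁻¹) ψ φ := fun n => by
        simp only [inducedAverage, averageCoeff_mulLeft_right]
      simp only [h2]
      have h3 := (tendsto_zero_iff_norm_tendsto_zero.2 (hPinv ψ φ 1 k⁻¹)).add (hP ψ φ)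
      simpa using h3

end InducedAverage

/-! ### Finitely supported measures -/

section FiniteMeasures

/-- Finitely supported probability measures. -/
theorem CompactProb.exists_of_weights {Z : Type*} [TopologicalSpace Z] [T1Space Z]
    [MeasurableSpace Z] [OpensMeasurableSpace Z] {w : Z → ℝ} (hw : ∀ z, 0 ≤ w z) {s : Finset Z}
    (hs : ∀ z ∉ s, w z = 0) (h1 : ∑' z, w z = 1) :
    ∃ M : CompactProb Z, (∀ S : Set Z, (∀ z, w z ≠ 0 → z ∈ S) → M.SupportedIn S) ∧
      ∀ (Y : Type u) [NormedAddCommGroup Y] [NormedSpace ℝ Y] [CompleteSpace Y] (f : Z → Y),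
        ∫ z, f z ∂M.measure = ∑' z, w z • f z := by
  classical
  rw [tsum_eq_sum (s := s) hs] at h1
  have hsupp : ∀ S : Set Z, (∀ z, w z ≠ 0 → z ∈ S) → MeasurableSet S →
      (∑ z ∈ s, ENNReal.ofReal (w z) • Measure.dirac z) Sᶜ = 0 := by
    intro S hS hSm
    rw [Measure.finsetSum_apply]
    refine Finset.sum_eq_zero fun z _ => ?_
    by_cases hz : w z = 0
    · simp [hz]
    · rw [Measure.smul_apply, Measure.dirac_apply' _ hSm.compl]
      simp [hS z hz]
  have hfin : ∀ S : Set Z, (∀ z, w z ≠ 0 → z ∈ S) → ∃ K : Set Z, IsCompact K ∧ K ⊆ S ∧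
      (∑ z ∈ s, ENNReal.ofReal (w z) • Measure.dirac z) Kᶜ = 0 := by
    intro S hS
    have hK : ({z | w z ≠ 0} : Set Z).Finite := s.finite_toSet.subset fun z hz => by
      by_contra hcon
      exact hz (hs z hcon)
    exact ⟨_, hK.isCompact, hS, hsupp _ (fun z hz => hz) hK.measurableSet⟩
  refine ⟨⟨∑ z ∈ s, ENNReal.ofReal (w z) • Measure.dirac z, ⟨?_⟩, ?_⟩, fun S hS => hfin S hS, ?_⟩
  · rw [Measure.finsetSum_apply]
    simp only [Measure.smul_apply, measure_univ, smul_eq_mul, mul_one]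
    rw [← ENNReal.ofReal_sum_of_nonneg fun z _ => hw z, h1, ENNReal.ofReal_one]
  · obtain ⟨K, hK, -, h⟩ := hfin Set.univ fun _ _ => trivial
    exact ⟨K, hK, h⟩
  · intro Y _ _ _ f
    rw [tsum_eq_sum (s := s) fun z hz => by rw [hs z hz, zero_smul]]
    rw [integral_finsetSum_measure fun z _ => ?_]
    · refine Finset.sum_congr rfl fun z _ => ?_
      rw [integral_smul_measure, integral_dirac, ENNReal.toReal_ofReal (hw z)]
    · exact (integrable_dirac (by simp)).smul_measure ENNReal.ofReal_ne_top

end FiniteMeasures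

/-! ### The mass of the induced averages -/

section Restriction

variable {G : Type u} [Group G] [TopologicalSpace G] [IsTopologicalGroup G] [T2Space G]
  [LocallyCompactSpace G] {Γ : Subgroup G} [DiscreteTopology Γ]
  [MeasurableSpace G] [BorelSpace G] [MeasurableSpace (G ⧸ Γ)] [BorelSpace (G ⧸ Γ)]
  {ℓ : LengthFunction G} {μ : Measure (G ⧸ Γ)}
  [IsProbabilityMeasure μ] [SMulInvariantMeasure G (G ⧸ Γ) μ]

theorem periodize_smul_mk (f : G → ℝ) (g h : G) :
    periodize Γ f (g • (h : G ⧸ Γ)) = ∑' γ : Γ, f (g * h * γ) := by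
  rw [← periodize_mul_left, periodize_mk]
  simp [mul_assoc]

/-- The total mass of the coefficients, computed on `G ⧸ Γ`. This is the product formula for lattice
sums in the case of the trivial representation. -/
theorem tsum_inducedCoeff (ψ φ : C_c(G, ℝ)) (g : G) :
    ∑' γ : Γ, inducedCoeff μ ψ φ g γ = ∫ q, periodize Γ ψ (g • q) * periodize Γ φ q ∂μ := by
  set s := (finite_translates_coeff (Γ := Γ) ψ φ {g} isCompact_singleton).toFinset with hsdef
  have hs : ∀ γ ∉ s, ∀ y, ψ (g * y) * φ (1 * y * γ) = 0 := fun γ hγ y =>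
    mul_translate_eq_zero ψ φ g 1 (by simpa [hsdef] using hγ) y
  have hs' : ∀ γ ∉ s, inducedCoeff μ ψ φ g γ = 0 := fun γ hγ =>
    inducedCoeff_eq_zero ψ φ (by simpa [hsdef] using hγ)
  have hpt : ∀ q : G ⧸ Γ, periodize Γ ψ (g • q) * periodize Γ φ q =
      ∑ γ ∈ s, periodize Γ (fun y => ψ (g * y) * φ (y * γ)) q := by
    intro q
    obtain ⟨h, rfl⟩ := QuotientGroup.mk_surjective q
    -- the spaces of a two-step representation live in the universe of `G`, whence the lift of `ℂ`
    have key := latticeSum_comp_latticeSum (Γ := Γ) (X₀ := ULift.{u} ℂ) (X₁ := ULift.{u} ℂ)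
      (X₂ := ULift.{u} ℂ) ψ φ (a₁ := fun _ => .id ℂ _) (a₀ := fun _ => .id ℂ _)
      (p := fun _ => .id ℂ _) (fun _ _ => rfl) g 1 h ⟨1⟩
    have hsum : ∀ (f : C_c(G, ℝ)) (k : G), latticeSum (V := ULift.{u} ℂ →L[ℂ] ULift.{u} ℂ) f
        (fun _ : Γ => .id ℂ _) k = (∑' γ : Γ, f (k * γ)) • .id ℂ _ := fun f k => by
      rw [latticeSum, (summable_translates f.hasCompactSupport k).tsum_smul_const]
    rw [tsum_eq_sum (s := s) fun γ hγ => by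
      have : (fun y => ψ (g * y) * φ (1 * y * γ)) = fun _ => 0 := funext (hs γ hγ)
      rw [this]; simp [periodize], hsum, hsum] at key
    have key2 := congrArg (fun z : ULift.{u} ℂ => z.down) key
    have hdown : ∀ (s : Finset Γ) (a : Γ → ULift.{u} ℂ), (∑ γ ∈ s, a γ).down = ∑ γ ∈ s, (a γ).down := by
      classical
      intro s a
      induction s using Finset.induction_on with
      | empty => simp
      | insert γ s h ih => rw [Finset.sum_insert h, Finset.sum_insert h, ← ih]; rfl
    simp only [hdown, smul_apply, ContinuousLinearMap.id_apply, ULift.smul_down, one_mul,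
      Complex.real_smul, mul_one] at key2
    rw [periodize_smul_mk, periodize_mk]
    exact_mod_cast key2
  rw [tsum_eq_sum hs']
  simp only [hpt]
  rw [integral_finsetSum _ fun γ _ => ?_]
  · rfl
  · exact integrable_periodize μ (by fun_prop) (ψ.mulLeft g).hasCompactSupport.mul_right

/-- The total mass of the weights `averageCoeff` on `Γ`. -/
noncomputable def averageMass (μ : Measure (G ⧸ Γ)) (m : CompactProb G) (ψ φ : G → ℝ) : ℝ :=
  ∑' γ : Γ, averageCoeff μ m ψ φ γ

theorem averageMass_eq_integral (m : CompactProb G) (ψ φ : C_c(G, ℝ)) :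
    averageMass μ m ψ φ = ∫ g, ∫ q, periodize Γ ψ (g • q) * periodize Γ φ q ∂μ ∂m.measure := by
  obtain ⟨s, Q, hQ, hsQ, hs⟩ := exists_finset_averageCoeff (μ := μ) m ψ φ
  rw [averageMass, tsum_eq_sum hs]
  simp only [averageCoeff]
  rw [← integral_finsetSum _ fun γ _ => integrable_inducedCoeff m ψ φ γ]
  refine integral_congr_ae (hQ.ae.mono fun g hg => ?_)
  simp only
  rw [← tsum_inducedCoeff, tsum_eq_sum (hsQ g hg)]

/-- For a fixed `ψ` there is a `φ` whose lattice sum is at least `1` on so large a part of `G ⧸ Γ` that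
the masses are bounded below, uniformly in the measure `m`: a translate of `periodize Γ ψ` by an
element of `G` has the same integral, of which the rest of `G ⧸ Γ` carries at most half. -/
theorem exists_le_averageMass [μ.Regular] (σ : AlmostMinimalSection ℓ μ) (ψ : C_c(G, ℝ)) (hψ : ∀ x, 0 ≤ ψ x)
    (hψ0 : 0 < weil μ ψ) :
    ∃ φ : C_c(G, ℝ), ∀ m : CompactProb G, weil μ ψ / 2 ≤ averageMass μ m ψ φ := by
  have hSψ : ∀ q, 0 ≤ periodize Γ ψ q := fun q => by
    obtain ⟨h, rfl⟩ := QuotientGroup.mk_surjective q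
    rw [periodize_mk]
    exact tsum_nonneg fun γ => hψ _
  obtain ⟨B, hB⟩ := (continuous_periodize (Γ := Γ) (map_continuous ψ) ψ.hasCompactSupport).bounded_above_of_compact_support
    (hasCompactSupport_periodize ψ.hasCompactSupport)
  have hB0 : 0 ≤ B := (norm_nonneg _).trans (hB ((1 : G) : G ⧸ Γ))
  have hlim : Tendsto (fun n => B * μ.real (σ.D n)ᶜ) atTop (𝓝 0) := by
    have h := (ENNReal.tendsto_toReal ENNReal.zero_ne_top).comp σ.tendsto_D
    simpa [Measure.real] using h.const_mul B
  obtain ⟨n, hn⟩ := (hlim.eventually_lt_const (half_pos hψ0)).exists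
  obtain ⟨Q, hQ, hQD⟩ := σ.exists_compact n
  obtain ⟨φ, hφQ, hφ0, -⟩ := exists_cutoff hQ
  have hSφ : ∀ q, 0 ≤ periodize Γ φ q := fun q => by
    obtain ⟨h, rfl⟩ := QuotientGroup.mk_surjective q
    rw [periodize_mk]
    exact tsum_nonneg fun γ => hφ0 _
  have hSφ1 : ∀ q ∈ σ.D n, 1 ≤ periodize Γ φ q := fun q hq => by
    have hq' : (σ.toFun q : G ⧸ Γ) = q := σ.mk_apply q
    rw [← hq', periodize_mk]
    have := (summable_translates (Γ := Γ) φ.hasCompactSupport (σ.toFun q)).le_tsum 1 fun γ _ => hφ0 _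
    simpa [hφQ _ (hQD q hq)] using this
  have hψc := continuous_periodize (Γ := Γ) (map_continuous ψ) ψ.hasCompactSupport
  have hψi : Integrable (periodize Γ ψ) μ := integrable_periodize μ ψ.continuous ψ.hasCompactSupport
  have hφc := continuous_periodize (Γ := Γ) (map_continuous φ) φ.hasCompactSupport
  have hφi : Integrable (periodize Γ φ) μ := integrable_periodize μ φ.continuous φ.hasCompactSupport
  have hcoeff : ∀ g : G, weil μ ψ / 2 ≤ ∫ q, periodize Γ ψ (g • q) * periodize Γ φ q ∂μ := by
    intro g
    have hgi : Integrable (fun q => periodize Γ ψ (g • q)) μ :=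
      (measurePreserving_smul g μ).integrable_comp_of_integrable hψi
    have h1 : ∫ q, (periodize Γ ψ (g • q) - (σ.D n)ᶜ.indicator (fun _ => B) q) ∂μ ≤
        ∫ q, periodize Γ ψ (g • q) * periodize Γ φ q ∂μ := by
      refine integral_mono (hgi.sub ((integrable_const B).indicator (σ.measurableSet_D n).compl)) ?_ fun q => ?_
      · exact hφi.bdd_mul (hψc.comp (continuous_const_smul g)).aestronglyMeasurable
          (Eventually.of_forall fun q => hB (g • q))
      · simp only
        by_cases hq : q ∈ σ.D n
        · simp only [Set.mem_compl_iff, hq, not_true_eq_false, not_false_eq_true, Set.indicator_of_notMem, sub_zero]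
          exact le_mul_of_one_le_right (hSψ _) (hSφ1 q hq)
        · rw [Set.indicator_of_mem hq]
          have := (le_abs_self _).trans (hB (g • q))
          nlinarith [mul_nonneg (hSψ (g • q)) (hSφ q)]
    rw [integral_sub hgi ((integrable_const B).indicator (σ.measurableSet_D n).compl),
      integral_indicator_const _ (σ.measurableSet_D n).compl,
      (measurePreserving_smul g μ).integral_comp (measurableEmbedding_const_smul g)] at h1
    rw [smul_eq_mul] at h1
    change weil μ ψ - _ ≤ _ at h1
    linarith
  refine ⟨φ, fun m => ?_⟩
  rw [averageMass_eq_integral]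
  have hcont : Integrable (fun g => ∫ q, periodize Γ ψ (g • q) * periodize Γ φ q ∂μ) m.measure := by
    obtain ⟨s, Q, hQ, hsQ, hs⟩ := exists_finset_averageCoeff (μ := μ) m ψ φ
    refine (integrable_finsetSum s fun γ _ => integrable_inducedCoeff (μ := μ) m ψ φ γ).congr
      (hQ.ae.mono fun g hg => ?_)
    simp only
    rw [← tsum_inducedCoeff, tsum_eq_sum (hsQ g hg)]
  have := integral_mono (μ := m.measure) (integrable_const (weil μ ψ / 2)) hcont hcoeff
  simpa using this

/-- The trivial two-step representation. -/
def TwoStepRep.trivial (H X : Type u) [Group H] [TopologicalSpace H] [NormedAddCommGroup X]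
    [NormedSpace ℂ X] : TwoStepRep H X X X where
  pi₀ _ := .id ℂ X
  pi₁ _ := .id ℂ X
  continuous₀ _ := continuous_const
  continuous₁ _ := continuous_const
  compat _ _ _ := rfl

/-- The masses converge exponentially fast to a positive limit. For the trivial representation on a
non-zero space of the class, `P ψ φ` is the limit of the masses times the identity. -/
theorem AlmostMinimalSection.exists_mass_limit [μ.Regular] (σ : AlmostMinimalSection ℓ μ)
    {E : BanachClass.{u}} (hE : E.StableL2) (h1 : ℓ 1 = 0) {s t C : ℝ} (hs : 0 ≤ s) (ht : 0 < t)
    {m : ℕ → CompactProb G} (hm : (m 0).SupportedIn {g | ℓ g ≤ 0})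
    (H : StarEstimate ℓ E (2 * s) t C m) {X : Type u} [NormedAddCommGroup X] [NormedSpace ℂ X]
    [CompleteSpace X] [Nontrivial X] (hX : E X) (ψ φ : C_c(G, ℝ)) (hψ : ∀ x, 0 ≤ ψ x)
    (hψ0 : 0 < weil μ ψ) (hφ0 : 0 < weil μ φ) (hφ : ∀ x, 0 ≤ φ x) :
    ∃ c K : ℝ, 0 < c ∧ 0 ≤ K ∧ ∀ n : ℕ, |averageMass μ (m n) ψ φ - c| ≤ K * Real.exp (-(t * n)) := by
  have hid : ∀ γ : Γ, ‖ContinuousLinearMap.id ℂ X‖ ≤ 1 * Real.exp (s * ℓ (γ : G)) := fun γ => by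
    rw [ContinuousLinearMap.norm_id, one_mul]
    exact Real.one_le_exp (mul_nonneg hs (ℓ.nonneg _))
  obtain ⟨P, hP, hPt, -, hPφ⟩ := σ.exists_limit hE h1 hs ht hm H hX (TwoStepRep.trivial Γ X) 1 hid hid
  have hav : ∀ (n : ℕ) (ψ φ : C_c(G, ℝ)), inducedAverage μ (TwoStepRep.trivial Γ X) (m n) ψ φ =
      averageMass μ (m n) ψ φ • ContinuousLinearMap.id ℂ X := fun n ψ φ => by
    have hsum : Summable (averageCoeff μ (m n) ψ φ : Γ → ℝ) := by
      simpa using summable_averageCoeff (μ := μ) (m n) ψ φ fun _ : Γ => (1 : ℝ)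
    rw [averageMass, ← hsum.tsum_smul_const]
    rfl
  obtain ⟨x, hx⟩ := exists_ne (0 : X)
  obtain ⟨η, hη, hηx⟩ := exists_dual_vector ℂ x (norm_ne_zero_iff.2 hx)
  have hx0 : 0 < ‖x‖ := norm_pos_iff.2 hx
  -- a norming functional at `x` reads off the scalar
  let c : C_c(G, ℝ) → C_c(G, ℝ) → ℝ := fun ψ φ => (η (P ψ φ x)).re / ‖x‖
  have hc : ∀ (ψ φ : C_c(G, ℝ)) (n : ℕ), |averageMass μ (m n) ψ φ - c ψ φ| ≤
      ‖inducedAverage μ (TwoStepRep.trivial Γ X) (m n) ψ φ - P ψ φ‖ := by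
    intro ψ φ n
    have h2 : averageMass μ (m n) ψ φ - c ψ φ =
        (η ((inducedAverage μ (TwoStepRep.trivial Γ X) (m n) ψ φ - P ψ φ) x)).re / ‖x‖ := by
      simp only [c]
      rw [hav, sub_apply, map_sub, Complex.sub_re, sub_div]
      congr 1
      rw [smul_apply, ContinuousLinearMap.id_apply, ← Complex.coe_smul, map_smul, hηx]
      simp [hx0.ne']
    rw [h2, abs_div, abs_of_pos hx0, div_le_iff₀ hx0]
    refine (Complex.abs_re_le_norm _).trans ((η.le_opNorm _).trans ?_)
    rw [hη, one_mul]
    exact ContinuousLinearMap.le_opNorm _ _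
  have hct : ∀ ψ φ : C_c(G, ℝ), Tendsto (fun n => averageMass μ (m n) ψ φ) atTop (𝓝 (c ψ φ)) := fun ψ φ =>
    tendsto_iff_norm_sub_tendsto_zero.2 (squeeze_zero (fun _ => norm_nonneg _) (hc ψ φ)
      (tendsto_iff_norm_sub_tendsto_zero.1 (hPt ψ φ)))
  have hcφ : ∀ φ' : C_c(G, ℝ), weil μ φ' * c ψ φ = weil μ φ * c ψ φ' := by
    intro φ'
    have h2 := congrArg (fun T : X →L[ℂ] X => (η (T x)).re / ‖x‖) (hPφ ψ φ φ')
    simp only [smul_apply, ← Complex.coe_smul, map_smul] at h2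
    simpa [c, mul_div_assoc] using h2
  obtain ⟨φ', hφ'⟩ := exists_le_averageMass σ ψ hψ hψ0
  have hc' : weil μ ψ / 2 ≤ c ψ φ' := ge_of_tendsto' (hct ψ φ') fun n => hφ' (m n)
  have hcnn : 0 ≤ c ψ φ := ge_of_tendsto' (hct ψ φ) fun n =>
    tsum_nonneg fun γ => averageCoeff_nonneg _ hψ hφ γ
  -- the limit is a multiple of the integral of `φ`, and non-zero for the function `φ'`
  have hpos : 0 < c ψ φ := by
    rcases hcnn.eq_or_lt with h0 | h0
    · have h3 := hcφ φ'
      rw [← h0, mul_zero] at h3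
      have := mul_pos hφ0 ((half_pos hψ0).trans_le hc')
      linarith
    · exact h0
  obtain ⟨B, hB⟩ := ψ.continuous.bounded_above_of_compact_support ψ.hasCompactSupport
  obtain ⟨B', hB'⟩ := φ.continuous.bounded_above_of_compact_support φ.hasCompactSupport
  obtain ⟨κ, -, hκ⟩ := σ.exists_induce_bound
    (ψ.hasCompactSupport.isCompact.union φ.hasCompactSupport.isCompact) hs
      (le_max_of_le_left ((norm_nonneg _).trans (hB 1)) : 0 ≤ max B B')
  obtain ⟨hκ₀, hκ₁⟩ := hκ (TwoStepRep.trivial Γ X) 1 hid hid ψ φ (fun x hx => image_eq_zero_of_notMem_tsupport fun h => hx (Or.inl h))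
    (fun x hx => image_eq_zero_of_notMem_tsupport fun h => hx (Or.inr h))
    (fun x => (hB x).trans (le_max_left _ _)) (fun x => (hB' x).trans (le_max_right _ _))
  have hrate := (hP ψ φ κ hκ₀ hκ₁).2
  refine ⟨c ψ φ, C * (κ * 1) ^ 2, hpos, ?_, fun n => (hc ψ φ n).trans (hrate n)⟩
  simpa using (norm_nonneg _).trans (hrate 0)

end Restriction

/-! ### From the group to the lattice -/

section Restriction

variable {G : Type u} [Group G] [TopologicalSpace G] [IsTopologicalGroup G] [T2Space G]
  [LocallyCompactSpace G] {Γ : Subgroup G} [DiscreteTopology Γ]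
  [MeasurableSpace G] [BorelSpace G] [MeasurableSpace (G ⧸ Γ)] [BorelSpace (G ⧸ Γ)]
  {ℓ : LengthFunction G} (μ : Measure (G ⧸ Γ))
  [IsProbabilityMeasure μ] [SMulInvariantMeasure G (G ⧸ Γ) μ]

/-- The weights on `Γ` obtained from `m`, normalized to a probability measure. -/
theorem exists_averageCoeff_prob (m : CompactProb G) {χ : C_c(G, ℝ)} (hχ : ∀ x, 0 ≤ χ x)
    (hm : 0 < averageMass μ m χ χ) :
    ∃ M : CompactProb Γ, (∀ (S : Set G) (S' : Set Γ), m.SupportedIn S →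
        (∀ γ : Γ, (γ : G) ∈ (tsupport χ)⁻¹ * S * tsupport χ → γ ∈ S') → M.SupportedIn S') ∧
      ∀ (Y : Type u) [NormedAddCommGroup Y] [NormedSpace ℝ Y] [CompleteSpace Y] (f : Γ → Y),
        ∫ γ, f γ ∂M.measure = (averageMass μ m χ χ)⁻¹ • ∑' γ, averageCoeff μ m χ χ γ • f γ := by
  obtain ⟨s, -, -, -, hs⟩ := exists_finset_averageCoeff (μ := μ) m χ χ
  obtain ⟨M, hMS, hM⟩ := CompactProb.exists_of_weights
    (w := fun γ : Γ => (averageMass μ m χ χ)⁻¹ * averageCoeff μ m χ χ γ)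
    (fun γ => mul_nonneg (inv_nonneg.2 hm.le) (averageCoeff_nonneg m hχ hχ γ)) (s := s)
    (fun γ hγ => by rw [hs γ hγ, mul_zero])
    (by rw [tsum_mul_left]; exact inv_mul_cancel₀ hm.ne')
  refine ⟨M, fun S S' hS hS' => hMS S' fun γ hγ => hS' γ ?_, fun Y _ _ _ f => ?_⟩
  · by_contra hcon
    exact hγ (by rw [averageCoeff_eq_zero m χ χ hS hcon, mul_zero])
  · rw [hM]
    simp only [mul_smul]
    exact tsum_const_smul'' _

/-- Property `(*_E)` passes from a locally compact group to a lattice, provided that the class contains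
a non-zero space. -/
theorem HasStarFor.restrict [μ.Regular] {E : BanachClass.{u}} (hE : E.StableL2) {X : Type u}
    [NormedAddCommGroup X] [NormedSpace ℂ X] [CompleteSpace X] [Nontrivial X] (hX : E X)
    (hG : HasStarFor G ℓ E) : HasStarFor Γ (ℓ.restrict Γ) E := by
  have h1 : ℓ 1 = 0 := hG.length_one
  obtain ⟨s', t, C, hs', ht, hC, m, hm, H⟩ := hasStarFor_iff.1 hG
  -- induction doubles the exponent of growth
  obtain ⟨s, rfl⟩ : ∃ s, s' = 2 * s := ⟨s' / 2, by ring⟩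
  have hs : 0 < s := by linarith
  obtain ⟨σ⟩ := nonempty_almostMinimalSection ℓ μ
  have hm0 : (m 0).SupportedIn {g | ℓ g ≤ 0} := by simpa using hm 0
  obtain ⟨χ, hχ, hχ1, -⟩ := exists_bump (G := G) univ_mem
  have hχ0 : 0 < weil μ χ :=
    weil_pos μ (map_continuous χ) χ.hasCompactSupport hχ (x := 1) (by rw [hχ1]; exact one_pos)
  obtain ⟨c, K, hc, hK, hmass⟩ := σ.exists_mass_limit hE h1 hs.le ht hm0 H hX χ χ hχ hχ0 hχ0 hχ
  obtain ⟨b, hb0, hb⟩ := ℓ.exists_bound χ.hasCompactSupport.isCompact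
  obtain ⟨B, hB⟩ := χ.continuous.bounded_above_of_compact_support χ.hasCompactSupport
  obtain ⟨κ, hκ0, hκ⟩ := σ.exists_induce_bound χ.hasCompactSupport.isCompact hs.le
    ((norm_nonneg _).trans (hB 1))
  have hexp := tendsto_exp_neg_mul_natCast ht
  -- the first few measures are discarded, as their mass in `Γ` might vanish
  obtain ⟨i₀, hi₀⟩ : ∃ i₀ : ℕ, ∀ n ≥ i₀, c / 2 ≤ averageMass μ (m n) χ χ := by
    have h := (hexp.const_mul K)
    rw [mul_zero] at h
    obtain ⟨i₀, hi₀⟩ := eventually_atTop.1 (h.eventually_lt_const (half_pos hc))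
    exact ⟨i₀, fun n hn => by linarith [(abs_le.1 ((hmass n).trans (hi₀ n hn).le)).1]⟩
  have hpos : ∀ n, 0 < averageMass μ (m (n + i₀)) χ χ := fun n =>
    (half_pos hc).trans_le (hi₀ _ (Nat.le_add_left _ _))
  choose M hMS hM using fun n => exists_averageCoeff_prob μ (m (n + i₀)) hχ (hpos n)
  obtain ⟨N, hN⟩ := exists_nat_ge (2 * b + i₀)
  have hNp : 0 < N + 1 := Nat.succ_pos N
  refine hasStarFor_of_linear_support (ℓ := ℓ.restrict Γ) (s := s) (t := t)
    (C := 2 / c * (C * κ ^ 2) + 2 / c * (K / c) * (κ ^ 2 + C * κ ^ 2) + 1) h1 hs ht (by positivity) hNp (M := M) ?_ ?_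
  · intro n
    refine hMS n _ _ (hm (n + i₀)) fun γ hγ => ?_
    obtain ⟨z, hz, y, hy, hzy⟩ := hγ
    obtain ⟨x, hx, g, hg, rfl⟩ := hz
    simp only at hzy
    have h2 : ℓ (γ : G) ≤ b + (n + i₀) + b := by
      rw [← hzy]
      have hx' : ℓ x ≤ b := by
        rw [← ℓ.map_inv]
        exact hb _ hx
      have hg' : ℓ g ≤ n + i₀ := by simpa using hg
      linarith [ℓ.map_mul_le (x * g) y, ℓ.map_mul_le x g, hb y hy]
    change ℓ (γ : G) ≤ (N + 1 : ℕ) * ((n : ℝ) + 1)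
    push_cast
    have h3 : (0 : ℝ) ≤ n := n.cast_nonneg
    have h4 : (0 : ℝ) ≤ N := N.cast_nonneg
    nlinarith [mul_nonneg h4 h3]
  · intro X₀ X₁ X₂ _ _ _ _ _ _ _ _ _ ρ L hX₁ h₀ h₁'
    replace h₀ : ∀ γ : Γ, ‖ρ.pi₀ γ‖ ≤ L * Real.exp (s * ℓ (γ : G)) := h₀
    replace h₁' : ∀ γ : Γ, ‖ρ.pi₁ γ‖ ≤ L * Real.exp (s * ℓ (γ : G)) := h₁'
    obtain ⟨P, hP, hPt, hPψ, hPφ⟩ := σ.exists_limit hE h1 hs.le ht hm0 H hX₁ ρ L h₀ h₁'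
    obtain ⟨hκ₀, hκ₁⟩ := hκ ρ L h₀ h₁' χ χ (fun x hx => image_eq_zero_of_notMem_tsupport hx)
      (fun x hx => image_eq_zero_of_notMem_tsupport hx) hB hB
    obtain ⟨hPn, hPr⟩ := hP χ χ κ hκ₀ hκ₁
    have hshift : Tendsto (fun n : ℕ => n + i₀) atTop atTop := tendsto_add_atTop_nat i₀
    have hmlim : Tendsto (fun n => (averageMass μ (m (n + i₀)) χ χ)⁻¹) atTop (𝓝 c⁻¹) := by
      refine Tendsto.inv₀ (Tendsto.comp (g := fun n => averageMass μ (m n) χ χ) ?_ hshift) hc.ne'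
      refine tendsto_iff_norm_sub_tendsto_zero.2 (squeeze_zero (fun _ => norm_nonneg _) hmass ?_)
      simpa using hexp.const_mul K
    have hav : ∀ n, ρ.average (M n) =
        (averageMass μ (m (n + i₀)) χ χ)⁻¹ • inducedAverage μ ρ (m (n + i₀)) χ χ := by
      intro n
      ext x
      rw [TwoStepRep.average_apply, hM, smul_apply, inducedAverage_apply]
    -- translating the measure on `Γ` amounts to translating the two auxiliary functions on the right
    have htr : ∀ n (γ δ : Γ), ρ.average ((M n).translate γ δ) = (averageMass μ (m (n + i₀)) χ χ)⁻¹ •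
        inducedAverage μ ρ (m (n + i₀)) (χ.mulRight γ) (χ.mulRight (δ : G)⁻¹) := by
      intro n γ δ
      ext x
      rw [TwoStepRep.average_translate_apply, hM, smul_apply, inducedAverage_apply]
      congr 1
      refine ((((Equiv.mulLeft γ).trans (Equiv.mulRight δ)).tsum_eq _).symm.trans ?_).symm
      refine tsum_congr fun η => ?_
      have h2 := averageCoeff_mulRight (μ := μ) (m (n + i₀)) χ χ γ δ⁻¹ (γ * η * δ)
      rw [show γ⁻¹ * (γ * η * δ) * δ⁻¹ = η by group] at h2
      change averageCoeff μ _ (χ.mulRight (γ : G)) (χ.mulRight (δ : G)⁻¹) (γ * η * δ) • ρ.pi (γ * η * δ) x = _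
      rw [← h2]
      rfl
    -- right translation by `Γ` does not change the integral, so it does not change the limit either
    have hlim : ∀ γ δ : Γ, Tendsto (fun n => ρ.average ((M n).translate γ δ)) atTop (𝓝 (c⁻¹ • P χ χ)) := by
      intro γ δ
      have h2 := hPψ (χ.mulRight γ) (χ.mulRight (δ : G)⁻¹) χ
      have h3 := hPφ χ (χ.mulRight (δ : G)⁻¹) χ
      have h4 : weil μ (χ.mulRight γ) = weil μ χ := weil_mul_right μ χ γ
      have h5 : weil μ (χ.mulRight (δ : G)⁻¹) = weil μ χ := weil_mul_right μ χ δ⁻¹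
      rw [h4] at h2
      rw [h5] at h3
      rw [← smul_right_injective _ hχ0.ne' h3, ← smul_right_injective _ hχ0.ne' h2]
      simp only [htr]
      exact hmlim.smul ((hPt _ _).comp hshift)
    have hlim1 : Tendsto (fun n => ρ.average (M n)) atTop (𝓝 (c⁻¹ • P χ χ)) := by
      simp only [hav]
      exact hmlim.smul ((hPt _ _).comp hshift)
    refine ⟨c⁻¹ • P χ χ, fun n => ?_, fun γ δ => ?_⟩
    · have hexp_le : Real.exp (-(t * (n + i₀ : ℕ))) ≤ Real.exp (-(t * n)) := by
        refine Real.exp_le_exp.2 (neg_le_neg (mul_le_mul_of_nonneg_left ?_ ht.le))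
        push_cast
        linarith [(i₀.cast_nonneg : (0 : ℝ) ≤ i₀)]
      set A := inducedAverage μ ρ (m (n + i₀)) χ χ
      set a := averageMass μ (m (n + i₀)) χ χ
      set e := Real.exp (-(t * n))
      have he : 0 < e := Real.exp_pos _
      have ha : c / 2 ≤ a := hi₀ _ (Nat.le_add_left _ _)
      have ha0 : 0 < a := hpos n
      have hainv : a⁻¹ ≤ 2 / c := by
        rw [inv_le_comm₀ ha0 (by positivity), inv_div]
        exact ha
      have hA : ‖A - P χ χ‖ ≤ C * (κ * L) ^ 2 * e :=
        (hPr (n + i₀)).trans (mul_le_mul_of_nonneg_left hexp_le (by positivity))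
      have hac : |a - c| ≤ K * e := (hmass (n + i₀)).trans (mul_le_mul_of_nonneg_left hexp_le hK)
      have hdec : a⁻¹ • A - c⁻¹ • P χ χ = a⁻¹ • (A - P χ χ) + (a⁻¹ * ((c - a) * c⁻¹)) • P χ χ := by
        have : a⁻¹ * ((c - a) * c⁻¹) = a⁻¹ - c⁻¹ := by field_simp
        rw [this, smul_sub, sub_smul]
        abel
      rw [hav, hdec]
      refine (norm_add_le _ _).trans ?_
      rw [norm_smul, norm_smul, norm_inv, norm_mul, norm_mul, norm_inv, norm_inv, Real.norm_of_nonneg ha0.le,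
        Real.norm_of_nonneg hc.le, Real.norm_eq_abs, abs_sub_comm c a]
      have e1 : a⁻¹ * ‖A - P χ χ‖ ≤ 2 / c * (C * (κ * L) ^ 2 * e) := by gcongr
      have e2 : a⁻¹ * (|a - c| * c⁻¹) * ‖P χ χ‖ ≤
          2 / c * (K * e * c⁻¹) * ((κ * L) ^ 2 + C * (κ * L) ^ 2) := by gcongr
      refine (add_le_add e1 e2).trans ?_
      have e3 : 2 / c * (C * (κ * L) ^ 2 * e) + 2 / c * (K * e * c⁻¹) * ((κ * L) ^ 2 + C * (κ * L) ^ 2)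
          = (2 / c * (C * κ ^ 2) + 2 / c * (K / c) * (κ ^ 2 + C * κ ^ 2)) * L ^ 2 * e := by
        field_simp
      rw [e3]
      have : 0 ≤ L ^ 2 * e := by positivity
      nlinarith
    · refine tendsto_zero_iff_norm_tendsto_zero.1 ?_
      simpa using (hlim γ δ).sub hlim1

end Restriction

/-! ### Almost fixed vectors of isometries -/

section FixedPoint

/-- A vector that is moved by at most `r` under a semigroup of isometries is within `r` of a fixed
vector: the element of minimal norm of the closed convex hull of its orbit. -/
theorem exists_fixed_of_norm_sub_le {H ι : Type*} [NormedAddCommGroup H] [InnerProductSpace ℝ H]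
    [CompleteSpace H] [Nonempty ι] (T : ι → H →ₗᵢ[ℝ] H) (hT : ∀ i j, ∃ k, ∀ x, T i (T j x) = T k x)
    {f : H} {r : ℝ} (hf : ∀ i, ‖T i f - f‖ ≤ r) : ∃ v, (∀ i, T i v = v) ∧ ‖v - f‖ ≤ r := by
  set S := closure (convexHull ℝ (Set.range fun i => T i f)) with hS
  have hconv : Convex ℝ S := (convex_convexHull ℝ _).closure
  have hne : S.Nonempty := (Set.range_nonempty _).mono ((subset_convexHull ℝ _).trans subset_closure)
  have hmaps : ∀ i, Set.MapsTo (T i) S S := by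
    intro i
    refine Set.MapsTo.closure ?_ (T i).continuous
    rw [Set.mapsTo_iff_image_subset]
    change (T i).toLinearMap '' _ ⊆ _
    rw [LinearMap.image_convexHull]
    refine convexHull_mono ?_
    rintro _ ⟨_, ⟨j, rfl⟩, rfl⟩
    obtain ⟨k, hk⟩ := hT i j
    exact ⟨k, (hk f).symm⟩
  obtain ⟨v, hv, hmin⟩ := exists_norm_eq_iInf_of_complete_convex hne isClosed_closure.isComplete hconv 0
  refine ⟨v, fun i => ?_, ?_⟩
  · have hw : T i v ∈ S := hmaps i hv
    have hmin' : ‖(0 : H) - T i v‖ = ⨅ w : S, ‖0 - (w : H)‖ := by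
      rw [← hmin, zero_sub, zero_sub, norm_neg, norm_neg, (T i).norm_map]
    have h1 := (norm_eq_iInf_iff_real_inner_le_zero hconv hv).1 hmin _ hw
    have h2 := (norm_eq_iInf_iff_real_inner_le_zero hconv hw).1 hmin' _ hv
    have h3 : inner ℝ (T i v - v) (T i v - v) ≤ 0 := by
      simp only [inner_sub_left, inner_sub_right, inner_zero_left] at h1 h2 ⊢
      linarith
    exact sub_eq_zero.1 (real_inner_self_nonpos.1 h3)
  · have h1 : S ⊆ Metric.closedBall f r := by
      refine closure_minimal (convexHull_min ?_ (convex_closedBall f r)) Metric.isClosed_closedBall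
      rintro _ ⟨i, rfl⟩
      rw [mem_closedBall_iff_norm]
      exact hf i
    exact mem_closedBall_iff_norm.1 (h1 hv)

end FixedPoint

/-! ### Functions orthogonal to continuous functions -/

section Density

variable {Z : Type*} [TopologicalSpace Z] [T2Space Z] [LocallyCompactSpace Z] [MeasurableSpace Z]
  [BorelSpace Z] {ν : Measure Z} [IsFiniteMeasure ν] [ν.Regular]

/-- The indicator function of a compact set is approximated by continuous functions supported in
small neighbourhoods. -/
theorem setIntegral_isCompact_eq_zero {w : Z → ℝ} (hw : Integrable w ν)
    (h : ∀ F : Z → ℝ, Continuous F → HasCompactSupport F → ∫ q, w q * F q ∂ν = 0) {K : Set Z}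
    (hK : IsCompact K) : ∫ q in K, w q ∂ν = 0 := by
  have hKm := hK.measurableSet
  have hU : ∀ n : ℕ, ∃ U, K ⊆ U ∧ IsOpen U ∧ ν U < ν K + ((n : ENNReal) + 1)⁻¹ := fun n =>
    K.exists_isOpen_lt_add (measure_ne_top ν K) (by simp)
  choose U hKU hUo hUν using hU
  have hlim : Tendsto (fun n => ∫ q in U n \ K, ‖w q‖ ∂ν) atTop (𝓝 0) := by
    refine hw.norm.tendsto_setIntegral_nhds_zero (tendsto_of_tendsto_of_tendsto_of_le_of_le
      tendsto_const_nhds (h := fun n : ℕ => ((n : ENNReal) + 1)⁻¹) ?_ (fun _ => zero_le) fun n => ?_)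
    · have := ENNReal.tendsto_inv_nat_nhds_zero.comp (tendsto_add_atTop_nat 1)
      simpa [Function.comp_def] using this
    · simp only [Function.comp_apply]
      rw [measure_sdiff (hKU n) hKm.nullMeasurableSet (measure_ne_top ν K)]
      exact tsub_le_iff_left.2 (hUν n).le
  refine norm_le_zero_iff.1 (ge_of_tendsto' hlim fun n => ?_)
  obtain ⟨F, hF1, hF0, hFs, hF⟩ := exists_continuous_one_zero_of_isCompact hK (hUo n).isClosed_compl
    (Set.disjoint_compl_right_iff_subset.2 (hKU n))
  have hwF : Integrable (fun q => w q * F q) ν :=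
    hw.mul_bdd (c := 1) F.continuous.aestronglyMeasurable (Eventually.of_forall fun q => by
      rw [Real.norm_of_nonneg (hF q).1]; exact (hF q).2)
  have h1 : ∫ q in K, w q ∂ν = ∫ q, (K.indicator w q - w q * F q) ∂ν := by
    rw [integral_sub (hw.indicator hKm) hwF, h F F.continuous hFs, sub_zero, integral_indicator hKm]
  rw [h1, ← integral_indicator ((hUo n).measurableSet.diff hKm)]
  refine norm_integral_le_of_norm_le (hw.norm.indicator ((hUo n).measurableSet.diff hKm))
    (Eventually.of_forall fun q => ?_)
  by_cases hq : q ∈ K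
  · have := hF1 hq
    simp only [Pi.one_apply] at this
    simp [hq, this]
  · by_cases hqU : q ∈ U n
    · simp only [Set.mem_sdiff, hqU, hq, not_false_eq_true, and_self, Set.indicator_of_mem,
        Set.indicator_of_notMem, zero_sub, norm_neg, norm_mul]
      rw [Real.norm_of_nonneg (hF q).1]
      exact mul_le_of_le_one_right (norm_nonneg _) (hF q).2
    · have := hF0 (show q ∈ (U n)ᶜ from hqU)
      simp only [Pi.zero_apply] at this
      simp [hq, hqU, this]

/-- An integrable function orthogonal to the compactly supported continuous functions vanishes. -/
theorem ae_eq_zero_of_integral_mul_eq_zero {w : Z → ℝ} (hw : Integrable w ν)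
    (h : ∀ F : Z → ℝ, Continuous F → HasCompactSupport F → ∫ q, w q * F q ∂ν = 0) : w =ᵐ[ν] 0 := by
  refine hw.ae_eq_zero_of_forall_setIntegral_eq_zero fun A hA _ => ?_
  have hK : ∀ n : ℕ, ∃ K, K ⊆ A ∧ IsCompact K ∧ ν (A \ K) < ((n : ENNReal) + 1)⁻¹ := fun n =>
    hA.exists_isCompact_sdiff_lt (measure_ne_top ν A) (by simp)
  choose K hKA hK hKν using hK
  have hlim : Tendsto (fun n => ∫ q in A \ K n, w q ∂ν) atTop (𝓝 0) := by
    refine hw.tendsto_setIntegral_nhds_zero (tendsto_of_tendsto_of_tendsto_of_le_of_le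
      tendsto_const_nhds (h := fun n : ℕ => ((n : ENNReal) + 1)⁻¹) ?_ (fun _ => zero_le) fun n => (hKν n).le)
    have := ENNReal.tendsto_inv_nat_nhds_zero.comp (tendsto_add_atTop_nat 1)
    simpa [Function.comp_def] using this
  refine tendsto_nhds_unique (tendsto_const_nhds.congr fun n => ?_) hlim
  rw [setIntegral_sdiff (hK n).measurableSet hw.integrableOn (hKA n),
    setIntegral_isCompact_eq_zero hw h (hK n), sub_zero]

end Density

/-! ### Ergodicity of the action on the quotient -/

section Ergodic

variable {G : Type u} [Group G] [TopologicalSpace G] [IsTopologicalGroup G] [T2Space G]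
  [LocallyCompactSpace G] {Γ : Subgroup G} [DiscreteTopology Γ]
  [MeasurableSpace (G ⧸ Γ)] [BorelSpace (G ⧸ Γ)]
  {μ : Measure (G ⧸ Γ)} [IsProbabilityMeasure μ] [SMulInvariantMeasure G (G ⧸ Γ) μ]

/-- Every compact set of the quotient is covered by the image of a compact set. -/
theorem exists_isCompact_subset_image_mk {A : Set (G ⧸ Γ)} (hA : IsCompact A) :
    ∃ Q : Set G, IsCompact Q ∧ A ⊆ (QuotientGroup.mk : G → G ⧸ Γ) '' Q := by
  have hK : ∀ x : G, ∃ K : Set G, IsCompact K ∧ K ∈ 𝓝 x := fun x => exists_compact_mem_nhds x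
  choose K hKc hKn using hK
  obtain ⟨s, hs⟩ := hA.elim_finite_subcover (fun x : G => interior ((QuotientGroup.mk : G → G ⧸ Γ) '' K x))
    (fun _ => isOpen_interior) fun q _ => by
      obtain ⟨x, rfl⟩ := QuotientGroup.mk_surjective q
      exact Set.mem_iUnion.2 ⟨x, mem_interior_iff_mem_nhds.2
        (QuotientGroup.isOpenMap_coe.image_mem_nhds (hKn x))⟩
  refine ⟨⋃ x ∈ s, K x, s.isCompact_biUnion fun x _ => hKc x, hs.trans ?_⟩
  rw [Set.image_iUnion₂]
  exact Set.iUnion₂_mono fun _ _ => interior_subset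

/-- Every compactly supported continuous function on `G ⧸ Γ` is a lattice sum: multiply by a
cutoff function and divide by its lattice sum. -/
theorem exists_periodize_eq {F : G ⧸ Γ → ℝ} (hF : Continuous F) (hc : HasCompactSupport F) :
    ∃ ψ : C_c(G, ℝ), periodize Γ ψ = F := by
  obtain ⟨Q, hQ, hQF⟩ := exists_isCompact_subset_image_mk hc.isCompact
  obtain ⟨φ, hφQ, hφ0, -⟩ := exists_cutoff hQ
  have hSφ := continuous_periodize (Γ := Γ) (map_continuous φ) φ.hasCompactSupport
  -- on the support of `F` the lattice sum of `φ` is at least `1`, so the maximum changes nothing there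
  have hpos : ∀ q, max (periodize Γ φ q) 1 ≠ 0 := fun q => (lt_max_of_lt_right one_pos).ne'
  let F' : G ⧸ Γ → ℝ := fun q => F q / max (periodize Γ φ q) 1
  have hF' : Continuous F' := hF.div (hSφ.max continuous_const) hpos
  refine ⟨⟨⟨fun g => F' (g : G ⧸ Γ) * φ g, (hF'.comp QuotientGroup.continuous_mk).mul (map_continuous φ)⟩,
    φ.hasCompactSupport.mul_left⟩, ?_⟩
  ext q
  obtain ⟨g, rfl⟩ := QuotientGroup.mk_surjective q
  have h1 : periodize Γ (fun g => F' (g : G ⧸ Γ) * φ g) (g : G ⧸ Γ) = F' g * periodize Γ φ (g : G ⧸ Γ) := by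
    rw [periodize_mk, periodize_mk, ← tsum_mul_left]
    simp
  refine h1.trans ?_
  by_cases hg : (g : G ⧸ Γ) ∈ tsupport F
  · obtain ⟨y, hy, hyg⟩ := hQF hg
    have h2 : 1 ≤ periodize Γ φ (g : G ⧸ Γ) := by
      rw [← hyg, periodize_mk]
      have := (summable_translates (Γ := Γ) φ.hasCompactSupport y).le_tsum 1 fun γ _ => hφ0 _
      simpa [hφQ y hy] using this
    simp only [F', max_eq_left h2]
    exact div_mul_cancel₀ _ (zero_lt_one.trans_le h2).ne'
  · simp [F', image_eq_zero_of_notMem_tsupport hg]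

theorem exists_bound_periodize {K : Set G} (hK : IsCompact K) : ∃ N : ℝ, 0 ≤ N ∧ ∀ f : G → ℝ,
    (∀ x ∉ K, f x = 0) → (∀ x, |f x| ≤ 1) → ∀ q : G ⧸ Γ, |periodize Γ f q| ≤ N := by
  obtain ⟨N, hN⟩ := exists_card_translates_le (Γ := Γ) hK
  refine ⟨N, N.cast_nonneg, fun f hf hf1 q => ?_⟩
  obtain ⟨h, rfl⟩ := QuotientGroup.mk_surjective q
  rw [periodize_mk]
  simpa using norm_tsum_translates_le hK hN zero_le_one (fun γ hγ => hf _ hγ) fun γ _ => hf1 (h * γ)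

/-- The action of `G` on `G ⧸ Γ` is ergodic: an invariant square integrable function `v` defines
the invariant functional `ψ ↦ ∫ v · periodize ψ`, which is a multiple of `weil μ`. -/
theorem exists_ae_eq_const_of_invariant [μ.Regular] {v : Lp ℝ 2 μ}
    (hv : ∀ g : G, Lp.compMeasurePreserving (g • ·) (measurePreserving_smul g μ) v = v) :
    ∃ c : ℝ, v =ᵐ[μ] fun _ => c := by
  have hμ : NeZero μ := inferInstance
  have hvi : Integrable v μ := (Lp.memLp v).integrable (by norm_num)
  have hint : ∀ ψ : C_c(G, ℝ), Integrable (fun q => v q * periodize Γ ψ q) μ := fun ψ => by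
    have hψc := continuous_periodize (Γ := Γ) (map_continuous ψ) ψ.hasCompactSupport
    obtain ⟨B, hB⟩ := hψc.bounded_above_of_compact_support
      (hasCompactSupport_periodize ψ.hasCompactSupport)
    exact hvi.mul_bdd hψc.aestronglyMeasurable (Eventually.of_forall hB)
  have hadd : ∀ (ψ ψ' : C_c(G, ℝ)) q, periodize Γ (ψ + ψ' : C_c(G, ℝ)) q =
      periodize Γ ψ q + periodize Γ ψ' q := fun ψ ψ' q => by
    obtain ⟨h, rfl⟩ := QuotientGroup.mk_surjective q
    rw [periodize_mk, periodize_mk, periodize_mk, ← (summable_translates ψ.hasCompactSupport h).tsum_add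
      (summable_translates ψ'.hasCompactSupport h)]
    rfl
  have hsmul : ∀ (a : ℝ) (ψ : C_c(G, ℝ)) q, periodize Γ (a • ψ : C_c(G, ℝ)) q =
      a * periodize Γ ψ q := fun a ψ q => by
    obtain ⟨h, rfl⟩ := QuotientGroup.mk_surjective q
    rw [periodize_mk, periodize_mk, ← tsum_mul_left]
    rfl
  let I : C_c(G, ℝ) →ₗ[ℝ] ℝ :=
    { toFun := fun ψ => ∫ q, v q * periodize Γ ψ q ∂μ
      map_add' := fun ψ ψ' => by
        simp only [hadd, mul_add]
        exact integral_add (hint ψ) (hint ψ')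
      map_smul' := fun a ψ => by
        simp only [hsmul, mul_left_comm _ a, integral_const_mul]
        rfl }
  obtain ⟨χ, hχ, hχ1, -⟩ := exists_bump (G := G) univ_mem
  have hχ0 : 0 < weil μ χ :=
    weil_pos μ (map_continuous χ) χ.hasCompactSupport hχ (x := 1) (by rw [hχ1]; exact one_pos)
  have hI : ∀ ψ, weil μ χ * I ψ = weil μ ψ * I χ := fun ψ => by
    refine weil_smul_comm μ I (fun K hK => ?_) (fun f k => ?_) ψ χ
    · obtain ⟨N, hN0, hN⟩ := exists_bound_periodize (Γ := Γ) hK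
      refine ⟨∫ q, ‖v q‖ * N ∂μ, fun f hf hf1 => ?_⟩
      refine norm_integral_le_of_norm_le (hvi.norm.mul_const N) (Eventually.of_forall fun q => ?_)
      rw [norm_mul]
      exact mul_le_mul_of_nonneg_left (hN f hf hf1 q) (norm_nonneg _)
    · change ∫ q, v q * periodize Γ (fun h => f (k * h)) q ∂μ = ∫ q, v q * periodize Γ f q ∂μ
      simp only [periodize_mul_left]
      rw [← (measurePreserving_smul k μ).integral_comp (measurableEmbedding_const_smul k)
        (fun q => v q * periodize Γ f q)]
      refine integral_congr_ae ?_
      have h1 := Lp.coeFn_compMeasurePreserving v (measurePreserving_smul k μ)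
      rw [hv k] at h1
      filter_upwards [h1] with q hq
      rw [hq]
      rfl
  set c := I χ / weil μ χ
  have hF : ∀ F : G ⧸ Γ → ℝ, Continuous F → HasCompactSupport F → ∫ q, (v q - c) * F q ∂μ = 0 := by
    intro F hFc hFs
    obtain ⟨ψ, rfl⟩ := exists_periodize_eq hFc hFs
    simp only [sub_mul]
    rw [integral_sub (hint ψ) ((integrable_periodize μ (map_continuous ψ) ψ.hasCompactSupport).const_mul c),
      integral_const_mul]
    change I ψ - c * weil μ ψ = 0
    rw [sub_eq_zero, div_mul_eq_mul_div, eq_div_iff hχ0.ne', mul_comm, hI, mul_comm]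
  refine ⟨c, ?_⟩
  have h0 := ae_eq_zero_of_integral_mul_eq_zero (hvi.sub (integrable_const c)) hF
  filter_upwards [h0] with q hq
  exact sub_eq_zero.1 hq

theorem sq_dist_indicatorConstLp {Ω : Type*} [MeasurableSpace Ω] {μ : Measure Ω} [IsFiniteMeasure μ]
    {V : Type*} [NormedAddCommGroup V] {A B : Set Ω} (hA : MeasurableSet A) (hB : MeasurableSet B) (v : V) :
    ‖indicatorConstLp 2 hA (measure_ne_top μ A) v - indicatorConstLp 2 hB (measure_ne_top μ B) v‖ ^ 2 =
      ‖v‖ ^ 2 * μ.real (symmDiff A B) := by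
  rw [← dist_eq_norm, dist_indicatorConstLp_eq_norm, norm_indicatorConstLp (by norm_num) (by norm_num),
    mul_pow, ← Real.rpow_natCast (μ.real _ ^ _), ← Real.rpow_mul measureReal_nonneg]
  norm_num

/-- A set that is almost invariant under all of `G` is almost null or conull: its indicator function
is close to an invariant function, which is constant by ergodicity. -/
theorem measureReal_mul_compl_le [μ.Regular] {B : Set (G ⧸ Γ)} (hB : MeasurableSet B) {r : ℝ}
    (hr : ∀ g : G, μ.real (symmDiff ((g • ·) ⁻¹' B) B) ≤ r) : μ.real B * (1 - μ.real B) ≤ r := by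
  have hr0 : 0 ≤ r := measureReal_nonneg.trans (hr 1)
  let T : G → Lp ℝ 2 μ →ₗᵢ[ℝ] Lp ℝ 2 μ := fun g =>
    Lp.compMeasurePreservingₗᵢ ℝ (g • ·) (measurePreserving_smul g μ)
  set f : Lp ℝ 2 μ := indicatorConstLp 2 hB (measure_ne_top μ B) 1 with hf
  have hT : ∀ g h, ∃ k, ∀ x, T g (T h x) = T k x := fun g h => ⟨h * g, fun x => by
    change Lp.compMeasurePreserving _ _ (Lp.compMeasurePreserving _ _ x) = Lp.compMeasurePreserving _ _ x
    rw [← Lp.compMeasurePreserving_comp_apply]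
    congr 2
    ext q
    exact smul_smul _ _ _⟩
  have hTf : ∀ g, ‖T g f - f‖ ≤ √r := fun g => by
    have h1 : T g f = indicatorConstLp 2 (hB.preimage (measurePreserving_smul g μ).measurable)
      (measure_ne_top μ _) 1 := rfl
    refine Real.le_sqrt_of_sq_le ?_
    rw [h1, hf, sq_dist_indicatorConstLp]
    simpa using hr g
  obtain ⟨v, hv, hvf⟩ := exists_fixed_of_norm_sub_le T hT hTf
  obtain ⟨c, hc⟩ := exists_ae_eq_const_of_invariant hv
  have h1 : ‖v - f‖ ^ 2 = c ^ 2 + (1 - 2 * c) * μ.real B := by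
    rw [← real_inner_self_eq_norm_sq, L2.inner_def]
    have h2 : ∫ q, inner ℝ ((v - f : Lp ℝ 2 μ) q) ((v - f : Lp ℝ 2 μ) q) ∂μ =
        ∫ q, (c ^ 2 + B.indicator (fun _ => 1 - 2 * c) q) ∂μ := by
      refine integral_congr_ae ?_
      filter_upwards [Lp.coeFn_sub v f, hc, indicatorConstLp_coeFn (p := 2) (hs := hB)
        (hμs := measure_ne_top μ B) (c := (1 : ℝ))] with q h3 h4 h5
      rw [h3, Pi.sub_apply, h4, hf, h5]
      by_cases hq : q ∈ B
      · simp [hq]; ring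
      · simp [hq]
    rw [h2, integral_add (integrable_const _) ((integrable_const _).indicator hB),
      integral_indicator_const _ hB]
    simp [mul_comm]
  have h2 : ‖v - f‖ ^ 2 ≤ r := by
    rw [← Real.sq_sqrt hr0]
    gcongr
  rw [h1] at h2
  nlinarith [sq_nonneg (c - μ.real B)]

end Ergodic

/-! ### Spectral gap on the quotient -/

section Koopman

variable {G : Type u} [Group G] [TopologicalSpace G] [IsTopologicalGroup G] [T2Space G]
  [LocallyCompactSpace G] {Γ : Subgroup G} [DiscreteTopology Γ]
  [MeasurableSpace (G ⧸ Γ)] [BorelSpace (G ⧸ Γ)]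
  (μ : Measure (G ⧸ Γ)) [IsProbabilityMeasure μ] [SMulInvariantMeasure G (G ⧸ Γ) μ]
  (X : Type u) [NormedAddCommGroup X] [NormedSpace ℂ X]

/-- The translation of vector-valued square integrable functions on `G ⧸ Γ` by an element of `G`. -/
noncomputable def koopman (g : G) : Lp X 2 μ →ₗᵢ[ℂ] Lp X 2 μ :=
  Lp.compMeasurePreservingₗᵢ ℂ (g⁻¹ • ·) (measurePreserving_smul g⁻¹ μ)

variable {X}

theorem koopman_mul (g h : G) (F : Lp X 2 μ) : koopman μ X (g * h) F = koopman μ X g (koopman μ X h F) := by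
  change Lp.compMeasurePreserving _ _ F = Lp.compMeasurePreserving _ _ (Lp.compMeasurePreserving _ _ F)
  rw [← Lp.compMeasurePreserving_comp_apply]
  congr 2
  ext q
  simp [mul_smul]

theorem koopman_one (F : Lp X 2 μ) : koopman μ X 1 F = F := by
  have h : koopman μ X 1 (koopman μ X 1 F) = koopman μ X 1 F := by rw [← koopman_mul, one_mul]
  exact (koopman μ X 1).injective h

/-- The displacement of a vector is a subadditive function on the group. -/
theorem norm_koopman_mul_sub_le (F : Lp X 2 μ) (g h : G) :
    ‖koopman μ X (g * h) F - F‖ ≤ ‖koopman μ X g F - F‖ + ‖koopman μ X h F - F‖ := by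
  have h1 : koopman μ X (g * h) F - F =
      koopman μ X g (koopman μ X h F - F) + (koopman μ X g F - F) := by
    rw [koopman_mul, map_sub]; abel
  rw [h1, add_comm ‖koopman μ X g F - F‖]
  refine (norm_add_le _ _).trans ?_
  rw [(koopman μ X g).norm_map]

theorem sq_norm_koopman_indicator_sub {B : Set (G ⧸ Γ)} (hB : MeasurableSet B) (v : X) (g : G) :
    ‖koopman μ X g (indicatorConstLp 2 hB (measure_ne_top μ B) v) -
      indicatorConstLp 2 hB (measure_ne_top μ B) v‖ ^ 2 =
      ‖v‖ ^ 2 * μ.real (symmDiff ((g⁻¹ • ·) ⁻¹' B) B) :=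
  sq_dist_indicatorConstLp (hB.preimage (measurePreserving_smul g⁻¹ μ).measurable) hB v

variable (Γ X)

/-- The Koopman representation of the lattice on `L²(G ⧸ Γ; X)`. -/
noncomputable def koopmanRep : TwoStepRep Γ (Lp X 2 μ) (Lp X 2 μ) (Lp X 2 μ) where
  pi₀ γ := (koopman μ X (γ : G)).toContinuousLinearMap
  pi₁ γ := (koopman μ X (γ : G)).toContinuousLinearMap
  continuous₀ _ := continuous_of_discreteTopology
  continuous₁ _ := continuous_of_discreteTopology
  compat g g' g'' := by
    ext1 F
    simp [koopman_mul]

variable {Γ X}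

theorem koopmanRep_pi_apply (γ : Γ) (F : Lp X 2 μ) : (koopmanRep Γ μ X).pi γ F = koopman μ X (γ : G) F := by
  change koopman μ X (γ : G) (koopman μ X ((1 : Γ) : G) F) = _
  rw [Subgroup.coe_one, koopman_one]

variable [MeasurableSpace G] [BorelSpace G] [μ.Regular] {ℓ : LengthFunction G}

/-- A spectral gap property of the action of `G` on `G ⧸ Γ`: a set of measure at most `1 / 2` that is
not null is moved substantially by some element of a fixed compact set `K`.

The set `K` contains the support of a measure `m n` on `Γ` whose Koopman operator is close to the
limit `P`, which takes values in the `Γ`-invariant vectors, and the image of `K` has measure at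
least `3 / 4`. If `K` moves the indicator function `f` of a set of measure `b` by at most `√b / 32`,
then `P f` is within `3 √b / 32` of `f`, so that `Γ` moves `f` by at most `6 √b / 32`, and
`G ⊆ K Γ K` moves it by at most `√b / 4`. By ergodicity `b (1 - b) ≤ b / 16`, whence `b = 0`. -/
theorem exists_isCompact_expansion {E : BanachClass.{u}} (hE : E.StableL2) [CompleteSpace X]
    [Nontrivial X] (hX : E X) (hΓ : HasStarFor Γ (ℓ.restrict Γ) E) :
    ∃ K : Set G, IsCompact K ∧ 1 ∈ K ∧
      μ.real ((QuotientGroup.mk : G → G ⧸ Γ) '' K)ᶜ ≤ 1 / 4 ∧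
      ∀ B : Set (G ⧸ Γ), MeasurableSet B → μ.real B ≤ 1 / 2 →
        (∀ g ∈ K, μ.real (symmDiff ((g • ·) ⁻¹' B) B) ≤ 1 / 1024 * μ.real B) → μ.real B = 0 := by
  obtain ⟨s, t, C, hs, ht, hC, m, hm, H⟩ := hasStarFor_iff.1 hΓ
  have hbound : ∀ γ : Γ, ‖(koopman μ X (γ : G)).toContinuousLinearMap‖ ≤
      1 * Real.exp (s * ℓ.restrict Γ γ) := fun γ => by
    rw [one_mul]
    exact (LinearIsometry.norm_toContinuousLinearMap_le _).trans
      (Real.one_le_exp (mul_nonneg hs.le ((ℓ.restrict Γ).nonneg γ)))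
  obtain ⟨P, hP, hPinv⟩ := H _ _ _ (koopmanRep Γ μ X) 1 (hE X _ μ hX) hbound hbound
  have hPlim : Tendsto (fun n => (koopmanRep Γ μ X).average (m n)) atTop (𝓝 P) := by
    refine tendsto_iff_norm_sub_tendsto_zero.2 (squeeze_zero (fun _ => norm_nonneg _) hP ?_)
    have h := (tendsto_exp_neg_mul_natCast ht).const_mul (C * 1 ^ 2)
    rwa [mul_zero] at h
  -- the limit consists of invariant vectors
  have hfix : ∀ (γ : Γ) (F : Lp X 2 μ), koopman μ X (γ : G) (P F) = P F := by
    intro γ F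
    have h1 : ∀ n, (koopmanRep Γ μ X).average ((m n).translate γ 1) F =
        koopman μ X (γ : G) ((koopmanRep Γ μ X).average (m n) F) := fun n => by
      rw [TwoStepRep.average_translate_apply, TwoStepRep.average_apply]
      simp only [koopmanRep_pi_apply, mul_one, Subgroup.coe_mul, koopman_mul]
      exact (koopman μ X (γ : G)).toContinuousLinearMap.integral_comp_comm
        ((m n).integrable_of_continuous continuous_of_discreteTopology)
    have h2 : Tendsto (fun n => (koopmanRep Γ μ X).average (m n) F) atTop (𝓝 (P F)) :=
      ((ContinuousLinearMap.apply ℂ (Lp X 2 μ) F).continuous.tendsto P).comp hPlim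
    have h3 := ((koopman μ X (γ : G)).continuous.tendsto _).comp h2
    have h4 : Tendsto (fun n => (koopmanRep Γ μ X).average ((m n).translate γ 1)) atTop (𝓝 P) := by
      simpa using (tendsto_zero_iff_norm_tendsto_zero.2 (hPinv γ 1)).add hPlim
    have h5 : Tendsto (fun n => (koopmanRep Γ μ X).average ((m n).translate γ 1) F) atTop (𝓝 (P F)) :=
      ((ContinuousLinearMap.apply ℂ (Lp X 2 μ) F).continuous.tendsto P).comp h4
    simp only [h1] at h5
    exact tendsto_nhds_unique h3 h5
  obtain ⟨n, hn⟩ : ∃ n : ℕ, C * 1 ^ 2 * Real.exp (-(t * n)) < 1 / 16 := by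
    have h := (tendsto_exp_neg_mul_natCast ht).const_mul (C * 1 ^ 2)
    rw [mul_zero] at h
    exact (h.eventually_lt_const (by norm_num)).exists
  obtain ⟨σ⟩ := nonempty_almostMinimalSection ℓ μ
  obtain ⟨j, hj⟩ : ∃ j, μ.real (σ.D j)ᶜ < 1 / 4 := by
    have h := (ENNReal.tendsto_toReal ENNReal.zero_ne_top).comp σ.tendsto_D
    rw [ENNReal.toReal_zero] at h
    exact (h.eventually_lt_const (by norm_num)).exists
  obtain ⟨Q, hQ, hQD⟩ := σ.exists_compact j
  obtain ⟨R, hR, hRm⟩ := (m n).exists_compact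
  set S : Set G := insert 1 (Q ∪ (fun γ : Γ => (γ : G)) '' R) with hS
  have hSc : IsCompact S := (hQ.union (hR.image continuous_subtype_val)).insert 1
  have hKfull : (QuotientGroup.mk '' (S ∪ S⁻¹) : Set (G ⧸ Γ))ᶜ ⊆ (σ.D j)ᶜ := by
    refine Set.compl_subset_compl.2 fun q hq => ⟨σ.toFun q, ?_, σ.mk_apply q⟩
    exact Or.inl (Set.mem_insert_of_mem _ (Or.inl (hQD q hq)))
  have hK4 : μ.real (QuotientGroup.mk '' (S ∪ S⁻¹) : Set (G ⧸ Γ))ᶜ ≤ 1 / 4 :=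
    (measureReal_mono hKfull).trans hj.le
  have hKc : IsCompact (S ∪ S⁻¹) := hSc.union hSc.inv
  have hKinv : (S ∪ S⁻¹)⁻¹ = S ∪ S⁻¹ := by rw [Set.union_inv, inv_inv, Set.union_comm]
  refine ⟨S ∪ S⁻¹, hKc, Or.inl (Set.mem_insert _ _), hK4, fun B hB hB2 hBK => ?_⟩
  obtain ⟨x, hx⟩ := exists_ne (0 : X)
  obtain ⟨v, hv⟩ : ∃ v : X, ‖v‖ = 1 := ⟨((‖x‖⁻¹ : ℝ) : ℂ) • x, by
    rw [norm_smul, Complex.norm_real, norm_inv, norm_norm, inv_mul_cancel₀ (norm_ne_zero_iff.2 hx)]⟩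
  set b := μ.real B with hb
  have hb0 : 0 ≤ b := measureReal_nonneg
  set f : Lp X 2 μ := indicatorConstLp 2 hB (measure_ne_top μ B) v with hf
  have hfnorm : ‖f‖ = √b := by
    rw [hf, norm_indicatorConstLp (by norm_num) (by norm_num), hv, one_mul, Real.sqrt_eq_rpow, hb]
    norm_num
  have hsq : ∀ g : G, ‖koopman μ X g f - f‖ ^ 2 = μ.real (symmDiff ((g⁻¹ • ·) ⁻¹' B) B) := fun g => by
    rw [hf, sq_norm_koopman_indicator_sub, hv]; ring
  have hK1 : ∀ g ∈ S ∪ S⁻¹, ‖koopman μ X g f - f‖ ≤ √b / 32 := by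
    intro g hg
    refine le_of_sq_le_sq ?_ (by positivity)
    rw [hsq, div_pow, Real.sq_sqrt hb0]
    have := hBK g⁻¹ (by rw [← hKinv]; exact Set.inv_mem_inv.2 hg)
    linarith
  -- `f` is close to the invariant vector `P f`
  have hPf : ‖P f - f‖ ≤ √b / 32 + √b / 16 := by
    have h1 : ‖(koopmanRep Γ μ X).average (m n) f - f‖ ≤ √b / 32 := by
      have hint : Integrable (fun γ => (koopmanRep Γ μ X).pi γ f) (m n).measure :=
        (m n).integrable_of_continuous continuous_of_discreteTopology
      have h2 : (koopmanRep Γ μ X).average (m n) f - f =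
          ∫ γ, ((koopmanRep Γ μ X).pi γ f - f) ∂(m n).measure := by
        rw [integral_sub hint (integrable_const f), TwoStepRep.average_apply]
        simp
        rfl
      rw [h2]
      refine CompactProb.norm_integral_le (S := R) ⟨R, hR, subset_rfl, hRm⟩ fun γ hγ => ?_
      rw [koopmanRep_pi_apply]
      exact hK1 _ (Or.inl (Set.mem_insert_of_mem _ (Or.inr ⟨γ, hγ, rfl⟩)))
    have h2 : ‖(koopmanRep Γ μ X).average (m n) f - P f‖ ≤ √b / 16 := by
      refine (((koopmanRep Γ μ X).average (m n) - P).le_of_opNorm_le ((hP n).trans hn.le) f).trans ?_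
      rw [hfnorm]
      linarith
    have h3 : P f - f = ((koopmanRep Γ μ X).average (m n) f - f) -
        ((koopmanRep Γ μ X).average (m n) f - P f) := by abel
    rw [h3]
    exact norm_sub_le_of_le h1 h2
  have hΓf : ∀ γ : Γ, ‖koopman μ X (γ : G) f - f‖ ≤ 2 * (√b / 32 + √b / 16) := by
    intro γ
    have h3 : koopman μ X (γ : G) f - f = (P f - f) - koopman μ X (γ : G) (P f - f) := by
      rw [map_sub, hfix]; abel
    rw [h3, two_mul]
    refine norm_sub_le_of_le hPf ?_
    rw [(koopman μ X (γ : G)).norm_map]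
    exact hPf
  -- every element of `G` is a product of an element of the lattice and two elements of the compact set
  have hG : ∀ g : G, ‖koopman μ X g f - f‖ ≤ √b / 4 := by
    intro g
    -- two sets of measure at least `3 / 4` meet
    obtain ⟨q, hq1, hq2⟩ : ((QuotientGroup.mk '' (S ∪ S⁻¹) : Set (G ⧸ Γ)) ∩
        (g • ·) ⁻¹' (QuotientGroup.mk '' (S ∪ S⁻¹) : Set (G ⧸ Γ))).Nonempty := by
      by_contra hcon
      rw [Set.not_nonempty_iff_eq_empty, ← Set.disjoint_iff_inter_eq_empty] at hcon
      have hA := ((hKc.image (f := (QuotientGroup.mk : G → G ⧸ Γ)) QuotientGroup.continuous_mk).isClosed).measurableSet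
      have h2 : μ.real (QuotientGroup.mk '' (S ∪ S⁻¹) : Set (G ⧸ Γ)) ≥ 3 / 4 := by
        have := probReal_compl_eq_one_sub (μ := μ) hA
        linarith
      have h3 : μ.real ((g • ·) ⁻¹' (QuotientGroup.mk '' (S ∪ S⁻¹) : Set (G ⧸ Γ))) ≥ 3 / 4 := by
        rw [(measurePreserving_smul g μ).measureReal_preimage hA.nullMeasurableSet]
        exact h2
      have h4 := measureReal_union (μ := μ) hcon (hA.preimage (measurePreserving_smul g μ).measurable)
      have h5 : μ.real ((QuotientGroup.mk '' (S ∪ S⁻¹) : Set (G ⧸ Γ)) ∪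
        (g • ·) ⁻¹' (QuotientGroup.mk '' (S ∪ S⁻¹) : Set (G ⧸ Γ))) ≤ 1 := measureReal_le_one
      linarith
    obtain ⟨k, hk, rfl⟩ := hq1
    obtain ⟨k', hk', hkk⟩ := hq2
    have hmem : k'⁻¹ * (g * k) ∈ Γ := QuotientGroup.eq.1 hkk
    have hg : g = k' * ((⟨_, hmem⟩ : Γ) : G) * k⁻¹ := by simp [mul_assoc]
    have hk'' : k⁻¹ ∈ S ∪ S⁻¹ := by rw [← hKinv]; exact Set.inv_mem_inv.2 hk
    rw [hg]
    have e1 := norm_koopman_mul_sub_le μ f (k' * ((⟨_, hmem⟩ : Γ) : G)) k⁻¹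
    have e2 := norm_koopman_mul_sub_le μ f k' ((⟨_, hmem⟩ : Γ) : G)
    linarith [hK1 k' hk', hK1 _ hk'', hΓf ⟨_, hmem⟩]
  have hfin := measureReal_mul_compl_le (μ := μ) (Γ := Γ) hB (r := b / 16) fun g => by
    have h1 := hsq g⁻¹
    rw [inv_inv] at h1
    rw [← h1]
    calc _ ≤ (√b / 4) ^ 2 := by gcongr; exact hG _
      _ = b / 16 := by rw [div_pow, Real.sq_sqrt hb0]; norm_num
  rw [← hb] at hfin
  nlinarith

end Koopman

/-! ### Averages over sets of almost full measure -/

section Averages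

variable {Ω : Type*} [MeasurableSpace Ω] {ν : Measure Ω} [IsProbabilityMeasure ν]
  {Y : Type*} [NormedAddCommGroup Y] [NormedSpace ℝ Y]

/-- The averages of a bounded function over two nested sets, both of almost full measure, are close. -/
theorem norm_setAverage_sub_le_of_subset {F : Ω → Y} {A B : Set Ω} (hA : MeasurableSet A)
    (hAB : A ⊆ B) {ε R : ℝ} (hε : ε ≤ 1 / 2) (hAε : ν.real Aᶜ ≤ ε)
    (hF : IntegrableOn F B ν) (hR : ∀ x ∈ B, ‖F x‖ ≤ R) :
    ‖(⨍ x in A, F x ∂ν) - ⨍ x in B, F x ∂ν‖ ≤ 4 * R * ε := by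
  have ha : 1 - ε ≤ ν.real A := by
    have := probReal_compl_eq_one_sub (μ := ν) hA
    linarith
  have ha0 : 0 < ν.real A := by linarith
  have hab : ν.real A ≤ ν.real B := measureReal_mono hAB
  have hb0 : 0 < ν.real B := ha0.trans_le hab
  have hb1 : ν.real B ≤ 1 := measureReal_le_one
  have hR0 : 0 ≤ R := by
    obtain ⟨x, hx⟩ : A.Nonempty := Set.nonempty_iff_ne_empty.2 fun h => by simp [h] at ha0
    exact (norm_nonneg _).trans (hR x (hAB hx))
  have hdiff : ν.real (B \ A) = ν.real B - ν.real A := measureReal_sdiff hAB hA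
  have e1 : ‖∫ x in A, F x ∂ν‖ ≤ R * ν.real A :=
    norm_setIntegral_le_of_norm_le_const (measure_lt_top ν A) fun x hx => hR x (hAB hx)
  have e2 : ‖∫ x in B \ A, F x ∂ν‖ ≤ R * (ν.real B - ν.real A) := by
    rw [← hdiff]
    exact norm_setIntegral_le_of_norm_le_const (measure_lt_top ν _) fun x hx => hR x hx.1
  have e3 : ∫ x in B, F x ∂ν = (∫ x in A, F x ∂ν) + ∫ x in B \ A, F x ∂ν := by
    rw [setIntegral_sdiff hA hF hAB, add_sub_cancel]
  set a := ν.real A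
  set b := ν.real B
  have e4 : (⨍ x in A, F x ∂ν) - ⨍ x in B, F x ∂ν =
      ((b - a) / (a * b)) • (∫ x in A, F x ∂ν) - b⁻¹ • ∫ x in B \ A, F x ∂ν := by
    rw [setAverage_eq, setAverage_eq, e3, smul_add]
    have : (b - a) / (a * b) = a⁻¹ - b⁻¹ := by field_simp
    rw [this, sub_smul]
    abel
  have e5 : ‖((b - a) / (a * b)) • ∫ x in A, F x ∂ν‖ ≤ 2 * R * ε := by
    rw [norm_smul, Real.norm_of_nonneg (div_nonneg (by linarith) (by positivity))]
    calc _ ≤ (b - a) / (a * b) * (R * a) := mul_le_mul_of_nonneg_left e1 (div_nonneg (by linarith) (by positivity))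
      _ = R * (b - a) / b := by field_simp
      _ ≤ 2 * R * ε := by
        rw [div_le_iff₀ hb0]
        nlinarith [mul_nonneg hR0 (by linarith : 0 ≤ ε - (b - a)),
          mul_nonneg (mul_nonneg hR0 (measureReal_nonneg.trans hAε)) (by linarith : 0 ≤ 2 * b - 1)]
  have e6 : ‖b⁻¹ • ∫ x in B \ A, F x ∂ν‖ ≤ 2 * R * ε := by
    rw [norm_smul, norm_inv, Real.norm_of_nonneg hb0.le, inv_mul_le_iff₀ hb0]
    refine e2.trans ?_
    nlinarith [mul_nonneg hR0 (by linarith : 0 ≤ ε - (b - a)),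
      mul_nonneg (mul_nonneg hR0 (measureReal_nonneg.trans hAε)) (by linarith : 0 ≤ 2 * b - 1)]
  rw [e4]
  refine (norm_sub_le _ _).trans ?_
  linarith

/-- The averages of a bounded function over two sets of almost full measure are close: compare both
with the average over the union. -/
theorem norm_setAverage_sub_le {F : Ω → Y} {A B : Set Ω} (hA : MeasurableSet A)
    (hB : MeasurableSet B) {ε R : ℝ} (hε : ε ≤ 1 / 2) (hAε : ν.real Aᶜ ≤ ε) (hBε : ν.real Bᶜ ≤ ε)
    (hF : AEStronglyMeasurable F ν) (hRA : ∀ x ∈ A, ‖F x‖ ≤ R) (hRB : ∀ x ∈ B, ‖F x‖ ≤ R) :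
    ‖(⨍ x in A, F x ∂ν) - ⨍ x in B, F x ∂ν‖ ≤ 8 * R * ε := by
  have hR : ∀ x ∈ A ∪ B, ‖F x‖ ≤ R := fun x hx => hx.elim (hRA x) (hRB x)
  have hAB := hA.union hB
  have hint : IntegrableOn F (A ∪ B) ν := by
    refine Integrable.of_bound hF.restrict R ?_
    exact (ae_restrict_iff' hAB).2 (Eventually.of_forall hR)
  have h1 := norm_setAverage_sub_le_of_subset hA Set.subset_union_left hε hAε hint hR
  have h2 := norm_setAverage_sub_le_of_subset hB Set.subset_union_right hε hBε hint hR
  calc _ = ‖((⨍ x in A, F x ∂ν) - ⨍ x in A ∪ B, F x ∂ν) - ((⨍ x in B, F x ∂ν) - ⨍ x in A ∪ B, F x ∂ν)‖ := by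
        congr 1; abel
    _ ≤ 4 * R * ε + 4 * R * ε := norm_sub_le_of_le h1 h2
    _ = _ := by ring

end Averages

/-! ### Exponential decay of the cusps and averages on the quotient -/

section Decay

variable {G : Type u} [Group G] [TopologicalSpace G] [IsTopologicalGroup G] [T2Space G]
  [LocallyCompactSpace G] {Γ : Subgroup G} [DiscreteTopology Γ]
  [MeasurableSpace G] [BorelSpace G] [MeasurableSpace (G ⧸ Γ)] [BorelSpace (G ⧸ Γ)]
  (μ : Measure (G ⧸ Γ)) [IsProbabilityMeasure μ] [SMulInvariantMeasure G (G ⧸ Γ) μ] [μ.Regular]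
  {ℓ : LengthFunction G} {X : Type u} [NormedAddCommGroup X] [NormedSpace ℂ X] [CompleteSpace X]
  [Nontrivial X]

theorem isCompact_pow {K : Set G} (hK : IsCompact K) (n : ℕ) : IsCompact (K ^ n) := by
  induction n with
  | zero => simp
  | succ n ih =>
    rw [pow_succ]
    exact ih.mul hK

theorem measurableSet_image_mk {K : Set G} (hK : IsCompact K) :
    MeasurableSet (QuotientGroup.mk '' K : Set (G ⧸ Γ)) :=
  (hK.image QuotientGroup.continuous_mk).isClosed.measurableSet

/-- The complements of the images of the powers of a suitable compact set have exponentially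
decreasing measure: if the measure decreased slowly at some step, the complement would be almost
invariant under the compact set, against the spectral gap. -/
theorem exists_isCompact_decay {E : BanachClass.{u}} (hE : E.StableL2) (hX : E X)
    (hΓ : HasStarFor Γ (ℓ.restrict Γ) E) :
    ∃ (K : Set G) (q : ℝ), IsCompact K ∧ 0 < q ∧ q < 1 ∧
      ∀ n : ℕ, μ.real (QuotientGroup.mk '' (K ^ (n + 1)) : Set (G ⧸ Γ))ᶜ ≤ q ^ n / 4 := by
  obtain ⟨K, hK, hK1, hK4, hKB⟩ := exists_isCompact_expansion μ hE hX hΓ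
  refine ⟨K, 2048 / 2049, hK, by norm_num, by norm_num, fun n => ?_⟩
  induction n with
  | zero => simpa using hK4
  | succ n ih =>
    set A : Set (G ⧸ Γ) := QuotientGroup.mk '' (K ^ (n + 1)) with hAdef
    set A' : Set (G ⧸ Γ) := QuotientGroup.mk '' (K ^ (n + 1 + 1)) with hA'def
    have hA : MeasurableSet A := measurableSet_image_mk (isCompact_pow hK _)
    have hA' : MeasurableSet A' := measurableSet_image_mk (isCompact_pow hK _)
    have hsub : ∀ g ∈ K, (g • ·) ⁻¹' A'ᶜ ⊆ Aᶜ := by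
      rintro g hg q hq ⟨k, hk, rfl⟩
      refine hq ⟨g * k, ?_, rfl⟩
      rw [pow_succ']
      exact Set.mul_mem_mul hg hk
    have hsub1 : A'ᶜ ⊆ Aᶜ := by simpa using hsub 1 hK1
    have hle : μ.real A'ᶜ ≤ μ.real Aᶜ := measureReal_mono hsub1
    have hq : (2048 / 2049 : ℝ) ^ n ≤ 1 := pow_le_one₀ (by norm_num) (by norm_num)
    -- `K` moves the complement of `A'` by at most twice the decrease; unless this complement is null,
    -- the spectral gap bounds the decrease below by `1 / 2048` of its measure
    have hstep : μ.real A'ᶜ ≤ 2048 / 2049 * μ.real Aᶜ := by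
      by_cases hcase : 2 * (μ.real Aᶜ - μ.real A'ᶜ) ≤ 1 / 1024 * μ.real A'ᶜ
      · rw [hKB A'ᶜ hA'.compl (by linarith) fun g hg => ?_]
        · positivity
        refine le_trans ?_ hcase
        have hmeas : MeasurableSet ((g • ·) ⁻¹' A'ᶜ) := hA'.compl.preimage (measurePreserving_smul g μ).measurable
        have hpre : μ.real ((g • ·) ⁻¹' A'ᶜ) = μ.real A'ᶜ :=
          (measurePreserving_smul g μ).measureReal_preimage hA'.compl.nullMeasurableSet
        have h1 : μ.real ((g • ·) ⁻¹' A'ᶜ \ A'ᶜ) ≤ μ.real Aᶜ - μ.real A'ᶜ := by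
          rw [← measureReal_sdiff hsub1 hA'.compl]
          exact measureReal_mono (Set.sdiff_subset_sdiff_left (hsub g hg))
        have h2 : μ.real (A'ᶜ \ (g • ·) ⁻¹' A'ᶜ) ≤ μ.real Aᶜ - μ.real A'ᶜ := by
          rw [← hpre, ← measureReal_sdiff (hsub g hg) hmeas]
          exact measureReal_mono (Set.sdiff_subset_sdiff_left hsub1)
        refine (measureReal_union_le _ _).trans ?_
        linarith
      · linarith
    rw [pow_succ]
    linarith

theorem LengthFunction.le_of_mem_pow {K : Set G} {b : ℝ} (hb : ∀ x ∈ K, ℓ x ≤ b) (n : ℕ) :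
    ∀ x ∈ K ^ (n + 1), ℓ x ≤ (n + 1) * b := by
  induction n with
  | zero => simpa using hb
  | succ n ih =>
    intro x hx
    rw [pow_succ] at hx
    obtain ⟨y, hy, z, hz, rfl⟩ := hx
    push_cast
    linarith [ℓ.map_mul_le y z, ih y hy, hb z hz]

/-- A right `Γ`-invariant function takes the same value at `g` and at the chosen point of `g Γ`. -/
theorem AlmostMinimalSection.apply_section (σ : AlmostMinimalSection ℓ μ) {Y : Type*} {F : G → Y}
    (hF : ∀ g (γ : Γ), F (g * γ) = F g) (g : G) : F (σ.toFun g) = F g := by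
  have h : g⁻¹ * σ.toFun g ∈ Γ := QuotientGroup.eq.1 (σ.mk_apply g).symm
  have := hF g ⟨_, h⟩
  simpa using this

/-- The normalized restriction of the invariant measure to a set where the section is compactly
valued, transported to the group by the section. The bound on the length is assumed on the closure of
the image, since `ℓ` need not be continuous. -/
theorem AlmostMinimalSection.exists_prob (σ : AlmostMinimalSection ℓ μ) {b : ℝ} {A : Set (G ⧸ Γ)}
    (hA : MeasurableSet A) (hA0 : μ A ≠ 0) {Q : Set G} (hQ : IsCompact Q) (hAQ : ∀ q ∈ A, σ.toFun q ∈ Q)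
    (hAb : ∀ x ∈ closure (σ.toFun '' A), ℓ x ≤ b) :
    ∃ m : CompactProb G, m.SupportedIn {g | ℓ g ≤ b} ∧
      ∀ (Y : Type u) [NormedAddCommGroup Y] [NormedSpace ℝ Y] [CompleteSpace Y] (F : G → Y),
        Continuous F → ∫ g, F g ∂m.measure = ⨍ q in A, F (σ.toFun q) ∂μ := by
  have hσ : AEMeasurable σ.toFun ((μ A)⁻¹ • μ.restrict A) := (σ.aemeasurable.restrict).smul_measure _
  have hprob : IsProbabilityMeasure ((μ A)⁻¹ • μ.restrict A) :=
    ProbabilityTheory.cond_isProbabilityMeasure hA0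
  have hK : IsCompact (closure (σ.toFun '' A)) :=
    hQ.of_isClosed_subset isClosed_closure (closure_minimal (Set.image_subset_iff.2 hAQ) hQ.isClosed)
  have hnull : ((μ A)⁻¹ • μ.restrict A).map σ.toFun (closure (σ.toFun '' A))ᶜ = 0 := by
    rw [Measure.map_apply_of_aemeasurable hσ isClosed_closure.measurableSet.compl, Measure.smul_apply,
      Measure.restrict_apply' hA]
    have : σ.toFun ⁻¹' (closure (σ.toFun '' A))ᶜ ∩ A = ∅ := by
      ext q
      simp only [Set.mem_inter_iff, Set.mem_preimage, Set.mem_compl_iff, Set.mem_empty_iff_false, iff_false, not_and]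
      exact fun h1 h2 => h1 (subset_closure ⟨q, h2, rfl⟩)
    rw [this, measure_empty, smul_zero]
  refine ⟨⟨((μ A)⁻¹ • μ.restrict A).map σ.toFun, Measure.isProbabilityMeasure_map hσ, _, hK, hnull⟩,
    ⟨_, hK, hAb, hnull⟩, fun Y _ _ _ F hF => ?_⟩
  rw [setAverage_eq']
  refine integral_map hσ ?_
  exact (CompactProb.integrable ⟨_, Measure.isProbabilityMeasure_map hσ, _, hK, hnull⟩ hF).aestronglyMeasurable

/-- The measures `ν k` have length growing linearly in `k`, and average right `Γ`-invariant functions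
with errors that decay like `q ^ k` as long as the growth of the function does not outweigh it.
The values of `ν k` on such functions form a sequence with small increments and are almost invariant
under left translation. The mean over `G ⧸ Γ` does not occur, as the function need not be integrable
there. -/
structure IsQuotientAveraging (ℓ : LengthFunction G) (Γ : Subgroup G) (b q : ℝ)
    (ν : ℕ → CompactProb G) : Prop where
  supportedIn : ∀ k : ℕ, (ν k).SupportedIn {g | ℓ g ≤ b * (k + 1)}
  norm_sub_le : ∀ (Y : Type u) [NormedAddCommGroup Y] [NormedSpace ℝ Y] [CompleteSpace Y]
    (F : G → Y) (M a : ℝ), Continuous F → (∀ g (γ : Γ), F (g * γ) = F g) → 0 ≤ a →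
    (∀ g, ‖F g‖ ≤ M * Real.exp (a * ℓ g)) → ∀ k : ℕ,
    ‖∫ g, F g ∂(ν (k + 1)).measure - ∫ g, F g ∂(ν k).measure‖ ≤
      4 * M * Real.exp (a * (b * (k + 2))) * q ^ k
  norm_translate_sub_le : ∀ (Y : Type u) [NormedAddCommGroup Y] [NormedSpace ℝ Y] [CompleteSpace Y]
    (F : G → Y) (M a : ℝ), Continuous F → (∀ g (γ : Γ), F (g * γ) = F g) → 0 ≤ a →
    (∀ g, ‖F g‖ ≤ M * Real.exp (a * ℓ g)) → ∀ (k : ℕ) (h : G),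
    ‖∫ g, F (h * g) ∂(ν k).measure - ∫ g, F g ∂(ν k).measure‖ ≤
      4 * M * Real.exp (a * (b * (k + 2) + ℓ h)) * q ^ k

/-- Since `A k ⊆ G ⧸ Γ` is contained in the image of `K ^ (k + 1)`, almost minimality bounds the length
of the section on `A k` linearly in `k`, while the complement of `A k` has measure at most
`q ^ k / 2`. The translate of `A k` by an element of `G` has the same property, and two
averages over sets of almost full measure are close. -/
theorem exists_isQuotientAveraging (μ : Measure (G ⧸ Γ)) [IsProbabilityMeasure μ]
    [SMulInvariantMeasure G (G ⧸ Γ) μ] [μ.Regular] {E : BanachClass.{u}} (hE : E.StableL2) (hX : E X)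
    (hΓ : HasStarFor Γ (ℓ.restrict Γ) E) :
    ∃ (b q : ℝ) (ν : ℕ → CompactProb G), 0 ≤ b ∧ 0 < q ∧ q < 1 ∧ IsQuotientAveraging ℓ Γ b q ν := by
  obtain ⟨K, q, hK, hq0, hq1, hKq⟩ := exists_isCompact_decay μ hE hX hΓ
  obtain ⟨σ⟩ := nonempty_almostMinimalSection ℓ μ
  obtain ⟨b₀, hb₀, hKb⟩ := ℓ.exists_bound hK
  obtain ⟨V, hV, hV1⟩ := exists_compact_mem_nhds (1 : G)
  obtain ⟨b₁, hb₁, hVb⟩ := ℓ.exists_bound hV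
  have hj : ∀ k : ℕ, ∃ j, μ.real (σ.D j)ᶜ < q ^ k / 4 := fun k => by
    have h := (ENNReal.tendsto_toReal ENNReal.zero_ne_top).comp σ.tendsto_D
    rw [ENNReal.toReal_zero] at h
    exact (h.eventually_lt_const (by positivity)).exists
  choose j hj using hj
  set A : ℕ → Set (G ⧸ Γ) := fun k => QuotientGroup.mk '' (K ^ (k + 1)) ∩ σ.D (j k) with hAdef
  have hA : ∀ k, MeasurableSet (A k) := fun k =>
    (measurableSet_image_mk (isCompact_pow hK _)).inter (σ.measurableSet_D _)
  have hAc : ∀ k, μ.real (A k)ᶜ ≤ q ^ k / 2 := fun k => by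
    rw [hAdef]
    simp only [Set.compl_inter]
    refine (measureReal_union_le _ _).trans ?_
    linarith [hKq k, hj k]
  have hqk : ∀ k : ℕ, q ^ k ≤ 1 := fun k => pow_le_one₀ hq0.le hq1.le
  have hA0 : ∀ k, μ (A k) ≠ 0 := fun k h => by
    have h1 := probReal_compl_eq_one_sub (μ := μ) (hA k)
    have h2 : μ.real (A k) = 0 := by simp [Measure.real, h]
    linarith [hAc k, hqk k]
  have hℓA : ∀ k, ∀ ω ∈ A k, ℓ (σ.toFun ω) ≤ (k + 1) * b₀ + σ.c := fun k ω hω => by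
    obtain ⟨x, hx, hxω⟩ := hω.1
    have h : (σ.toFun ω)⁻¹ * x ∈ Γ := QuotientGroup.eq.1 ((σ.mk_apply ω).trans hxω.symm)
    have h1 := σ.length_le ω ⟨_, h⟩
    simp only [mul_inv_cancel_left] at h1
    linarith [ℓ.le_of_mem_pow hKb k x hx]
  set b := b₀ + σ.c + b₁ with hb
  have hb0 : 0 ≤ b := by linarith [σ.c_nonneg]
  have hℓA' : ∀ k, ∀ ω ∈ A k, ℓ (σ.toFun ω) ≤ b * (k + 1) := fun k ω hω => by
    have h1 := hℓA k ω hω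
    have h2 : (0 : ℝ) ≤ k := k.cast_nonneg
    nlinarith [mul_nonneg σ.c_nonneg h2, mul_nonneg hb₁ h2]
  -- passing to the closure costs the maximal length `b₁` on a neighbourhood of `1`
  have hclosure : ∀ k, ∀ x ∈ closure (σ.toFun '' A k), ℓ x ≤ b * (k + 1) := by
    intro k x hx
    have hnhds : {y : G | y⁻¹ * x ∈ V} ∈ 𝓝 x := by
      have hc : ContinuousAt (fun y : G => y⁻¹ * x) x := by fun_prop
      exact hc.preimage_mem_nhds (by simpa using hV1)
    obtain ⟨y, hy1, ω, hω, rfl⟩ := mem_closure_iff_nhds.1 hx _ hnhds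
    have h1 := ℓ.map_mul_le (σ.toFun ω) ((σ.toFun ω)⁻¹ * x)
    rw [mul_inv_cancel_left] at h1
    have h2 : (0 : ℝ) ≤ k := k.cast_nonneg
    nlinarith [mul_nonneg σ.c_nonneg h2, mul_nonneg hb₁ h2, hℓA k ω hω, hVb _ hy1]
  choose ν hνs hν using fun k => σ.exists_prob μ (hA k) (hA0 k) (σ.exists_compact (j k)).choose_spec.1
    (fun ω hω => (σ.exists_compact (j k)).choose_spec.2 ω hω.2) (hclosure k)
  suffices key : ∀ (Y : Type u) [NormedAddCommGroup Y] [NormedSpace ℝ Y] [CompleteSpace Y]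
      (F : G → Y) (M a : ℝ), Continuous F → (∀ g (γ : Γ), F (g * γ) = F g) → 0 ≤ a →
      (∀ g, ‖F g‖ ≤ M * Real.exp (a * ℓ g)) → ∀ k : ℕ,
      ‖∫ g, F g ∂(ν (k + 1)).measure - ∫ g, F g ∂(ν k).measure‖ ≤
        4 * M * Real.exp (a * (b * (k + 2))) * q ^ k ∧
      ∀ h : G, ‖∫ g, F (h * g) ∂(ν k).measure - ∫ g, F g ∂(ν k).measure‖ ≤
        4 * M * Real.exp (a * (b * (k + 2) + ℓ h)) * q ^ k from
    ⟨b, q, ν, hb0, hq0, hq1, hνs, fun Y _ _ _ F M a hF hΓF ha hM k => (key Y F M a hF hΓF ha hM k).1,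
      fun Y _ _ _ F M a hF hΓF ha hM k h => (key Y F M a hF hΓF ha hM k).2 h⟩
  intro Y _ _ _ F M a hF hΓF ha hM k
  have hM0 : 0 ≤ M := by
    have h1 := (norm_nonneg _).trans (hM 1)
    exact nonneg_of_mul_nonneg_left h1 (Real.exp_pos _)
  have hFσ : AEStronglyMeasurable (fun ω => F (σ.toFun ω)) μ := σ.aestronglyMeasurable_comp hF
  have hbound : ∀ (g : G) (B : ℝ), ℓ g ≤ B → ‖F g‖ ≤ M * Real.exp (a * B) := fun g B hg =>
    (hM g).trans (by gcongr)
  constructor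
  · rw [hν _ Y F hF, hν _ Y F hF]
    have := norm_setAverage_sub_le (ν := μ) (F := fun ω => F (σ.toFun ω)) (hA (k + 1)) (hA k)
      (ε := q ^ k / 2) (R := M * Real.exp (a * (b * (k + 2)))) (by linarith [hqk k]) ?_ (hAc k) hFσ
      (fun ω hω => hbound _ _ ((hℓA' _ ω hω).trans (by push_cast; linarith)))
      (fun ω hω => hbound _ _ ((hℓA' _ ω hω).trans (by gcongr; norm_num)))
    · refine this.trans (le_of_eq (by ring))
    · refine (hAc (k + 1)).trans ?_
      rw [pow_succ]
      have : 0 < q ^ k := pow_pos hq0 k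
      nlinarith
  · intro h
    rw [hν _ Y F hF, hν _ Y (fun g => F (h * g)) (by fun_prop)]
    set A' : Set (G ⧸ Γ) := (h⁻¹ • ·) ⁻¹' A k with hA'def
    have hA' : MeasurableSet A' := (hA k).preimage (measurePreserving_smul h⁻¹ μ).measurable
    have hpre : (h • ·) ⁻¹' A' = A k := by
      ext ω
      simp [A']
    have hA'c : μ.real A'ᶜ = μ.real (A k)ᶜ :=
      (measurePreserving_smul h⁻¹ μ).measureReal_preimage (hA k).compl.nullMeasurableSet
    have hA'm : μ.real A' = μ.real (A k) :=
      (measurePreserving_smul h⁻¹ μ).measureReal_preimage (hA k).nullMeasurableSet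
    have hsec : ∀ ω, F (σ.toFun (h • ω)) = F (h * σ.toFun ω) := fun ω => by
      have h1 : h • ω = ((h * σ.toFun ω : G) : G ⧸ Γ) := by
        conv_lhs => rw [← σ.mk_apply ω]
        rfl
      rw [h1, σ.apply_section μ hΓF]
    -- translating the function by `h` amounts to translating the set `A k`
    have havg : ⨍ ω in A k, F (h * σ.toFun ω) ∂μ = ⨍ ω in A', F (σ.toFun ω) ∂μ := by
      rw [setAverage_eq, setAverage_eq, hA'm, ← hpre]
      simp only [← hsec]
      rw [(measurePreserving_smul h μ).setIntegral_preimage_emb (measurableEmbedding_const_smul h)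
        (fun ω => F (σ.toFun ω))]
    rw [havg]
    have := norm_setAverage_sub_le (ν := μ) (F := fun ω => F (σ.toFun ω)) hA' (hA k)
      (ε := q ^ k / 2) (R := M * Real.exp (a * (b * (k + 2) + ℓ h))) (by linarith [hqk k])
      (hA'c.trans_le (hAc k)) (hAc k) hFσ ?_ ?_
    · refine this.trans (le_of_eq (by ring))
    · intro ω hω
      have h1 : F (σ.toFun ω) = F (h * σ.toFun (h⁻¹ • ω)) := by rw [← hsec, smul_inv_smul]
      rw [h1]
      refine hbound _ _ ((ℓ.map_mul_le _ _).trans ?_)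
      linarith [hℓA' k _ hω]
    · intro ω hω
      refine hbound _ _ ((hℓA' k _ hω).trans ?_)
      linarith [ℓ.nonneg h]

end Decay

/-! ### Two-sided lifts of measures on the lattice -/

section Sandwich

variable {G : Type u} [Group G] [TopologicalSpace G] [IsTopologicalGroup G] [T2Space G]
  [LocallyCompactSpace G] {Γ : Subgroup G} [DiscreteTopology Γ]
  [MeasurableSpace G] [BorelSpace G]

theorem CompactProb.integral_map {Z Z' : Type*} [TopologicalSpace Z] [MeasurableSpace Z]
    [BorelSpace Z] [TopologicalSpace Z'] [MeasurableSpace Z'] [BorelSpace Z'] [T2Space Z']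
    {Y : Type*} [NormedAddCommGroup Y] [NormedSpace ℝ Y] (m : CompactProb Z) {f : Z → Z'}
    (hf : Continuous f) {F : Z' → Y} (hF : Continuous F) :
    ∫ z, F z ∂(m.map f hf).measure = ∫ z, F (f z) ∂m.measure :=
  MeasureTheory.integral_map hf.measurable.aemeasurable
    ((m.map f hf).integrable_of_continuous hF).aestronglyMeasurable

/-- On a discrete space a compactly supported measure is finitely supported, whence Fubini. -/
theorem CompactProb.integral_integral_swap {Z Z' : Type*} [TopologicalSpace Z] [DiscreteTopology Z]
    [MeasurableSpace Z] [BorelSpace Z] [TopologicalSpace Z'] [MeasurableSpace Z'] [BorelSpace Z']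
    [T2Space Z'] {Y : Type*} [NormedAddCommGroup Y] [NormedSpace ℝ Y] [CompleteSpace Y] (m : CompactProb Z)
    (m' : CompactProb Z') {f : Z → Z' → Y} (hf : ∀ z, Continuous (f z)) :
    ∫ z, ∫ z', f z z' ∂m'.measure ∂m.measure = ∫ z', ∫ z, f z z' ∂m.measure ∂m'.measure := by
  obtain ⟨K, hK, hmK⟩ := m.exists_compact
  have hKf : K.Finite := hK.finite_of_discrete
  have hsum : ∀ φ : Z → Y, ∫ z, φ z ∂m.measure = ∑ z ∈ hKf.toFinset, m.measure.real {z} • φ z := by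
    intro φ
    have h1 : m.measure.restrict (hKf.toFinset : Set Z) = m.measure :=
      Measure.restrict_eq_self_of_ae_mem (by rw [hKf.coe_toFinset]; exact hmK)
    rw [← setIntegral_finset _ (hf := (m.integrable_of_continuous continuous_of_discreteTopology).integrableOn), h1]
  rw [hsum]
  simp only [hsum, ← integral_smul]
  exact (integral_finsetSum _ fun z _ => ((m'.integrable_of_continuous (hf z)).smul _)).symm

/-- The measure `ν * m * ν̌`. -/
theorem CompactProb.exists_sandwich (ν : CompactProb G) (m : CompactProb Γ) :
    ∃ M : CompactProb G, (∀ (S : Set G) (S' : Set Γ), ν.SupportedIn S → m.SupportedIn S' →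
        M.SupportedIn (S * ((fun γ : Γ => (γ : G)) '' S' * S⁻¹))) ∧
      ∀ (Y : Type u) [NormedAddCommGroup Y] [NormedSpace ℝ Y] [CompleteSpace Y] (f : G → Y),
        Continuous f → ∫ g, f g ∂M.measure =
          ∫ g, ∫ g', ∫ γ, f (g * (γ : G) * g'⁻¹) ∂m.measure ∂ν.measure ∂ν.measure := by
  obtain ⟨M₁, hM₁, hM₁'⟩ := CompactProb.exists_conv (m.map _ continuous_subtype_val) (ν.map _ continuous_inv)
  obtain ⟨M, hM, hM'⟩ := CompactProb.exists_conv ν M₁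
  refine ⟨M, fun S S' hS hS' => hM _ _ hS (hM₁ _ _ (CompactProb.map_supportedIn _ hS' (Set.mapsTo_image _ _))
    (CompactProb.map_supportedIn _ hS fun x hx => by simpa using hx)), fun Y _ _ _ f hf => ?_⟩
  rw [hM' Y f hf]
  congr 1; ext g
  rw [hM₁' Y (fun h => f (g * h)) (by fun_prop), CompactProb.integral_map]
  · rw [← CompactProb.integral_integral_swap m ν (f := fun γ g' => f (g * (γ : G) * g'⁻¹))
      fun γ => by fun_prop]
    congr 1; ext γ
    rw [CompactProb.integral_map _ _ (by fun_prop : Continuous fun h : G => f (g * ((γ : G) * h)))]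
    simp only [mul_assoc]
  · exact (ν.map _ continuous_inv).continuous_integral (f := fun h h' => f (g * (h * h')))
      (by fun_prop)

end Sandwich

/-! ### Double averages on the quotient -/

section DoubleAverages

variable {G : Type u} [Group G] [TopologicalSpace G] [IsTopologicalGroup G] [T2Space G]
  [LocallyCompactSpace G] {Γ : Subgroup G}
  [MeasurableSpace G] [BorelSpace G] {ℓ : LengthFunction G} {b q : ℝ} {ν : ℕ → CompactProb G}
  {Y : Type u} [NormedAddCommGroup Y] [NormedSpace ℝ Y] [CompleteSpace Y]

/-- The estimate for increments, applied in each of the two variables. The function obtained by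
integrating one variable out again grows slowly in the other one. -/
theorem IsQuotientAveraging.norm_double_sub_le (hν : IsQuotientAveraging ℓ Γ b q ν) (hb : 0 ≤ b)
    (hq : 0 ≤ q) {Φ : G → G → Y} (hΦ : Continuous Φ.uncurry) (h₁ : ∀ g g' (γ : Γ), Φ (g * γ) g' = Φ g g')
    (h₂ : ∀ g g' (γ : Γ), Φ g (g' * γ) = Φ g g') {M a : ℝ} (ha : 0 ≤ a)
    (hM : ∀ g g', ‖Φ g g'‖ ≤ M * Real.exp (a * (ℓ g + ℓ g'))) (k : ℕ) :
    ‖∫ g, ∫ g', Φ g g' ∂(ν (k + 1)).measure ∂(ν (k + 1)).measure -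
      ∫ g, ∫ g', Φ g g' ∂(ν k).measure ∂(ν k).measure‖ ≤
      8 * M * Real.exp (a * (2 * b * (k + 2))) * q ^ k := by
  have hM0 : 0 ≤ M := nonneg_of_mul_nonneg_left ((norm_nonneg _).trans (hM 1 1)) (Real.exp_pos _)
  have hc : ∀ k, Continuous fun g => ∫ g', Φ g g' ∂(ν k).measure := fun k =>
    (ν k).continuous_integral hΦ
  have hc' : ∀ g, Continuous (Φ g) := fun g => hΦ.comp (Continuous.prodMk_right g)
  have e1 := hν.norm_sub_le Y (fun g => ∫ g', Φ g g' ∂(ν (k + 1)).measure)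
    (M * Real.exp (a * (b * (k + 2)))) a (hc _) (fun g γ => by simp only [h₁]) ha (fun g => by
      refine CompactProb.norm_integral_le (hν.supportedIn (k + 1)) fun g' hg' => (hM g g').trans ?_
      rw [mul_assoc, ← Real.exp_add, ← mul_add]
      have : ℓ g' ≤ b * (k + 2) := (show ℓ g' ≤ _ from hg').trans (by push_cast; linarith)
      gcongr M * Real.exp (a * ?_)
      linarith) k
  have e2 : ‖∫ g, ((∫ g', Φ g g' ∂(ν (k + 1)).measure) - ∫ g', Φ g g' ∂(ν k).measure) ∂(ν k).measure‖ ≤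
      4 * M * Real.exp (a * (2 * b * (k + 2))) * q ^ k := by
    refine CompactProb.norm_integral_le (hν.supportedIn k) fun g hg => ?_
    refine (hν.norm_sub_le Y (Φ g) (M * Real.exp (a * ℓ g)) a (hc' g) (h₂ g) ha (fun g' => by
      rw [mul_assoc, ← Real.exp_add, ← mul_add]
      exact hM g g') k).trans ?_
    rw [← mul_assoc, mul_assoc (4 * M), ← Real.exp_add, ← mul_add]
    have : ℓ g ≤ b * (k + 1) := hg
    gcongr 4 * M * Real.exp (a * ?_) * q ^ k
    linarith
  rw [integral_sub ((ν k).integrable (hc _)) ((ν k).integrable (hc _))] at e2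
  rw [← mul_assoc, mul_assoc (4 * M), ← Real.exp_add, ← mul_add,
    show b * ((k : ℝ) + 2) + b * (k + 2) = 2 * b * (k + 2) by ring] at e1
  refine (norm_sub_le_norm_sub_add_norm_sub _ _ _).trans ((add_le_add e1 e2).trans (le_of_eq (by ring)))

/-- The estimate for translates, applied in each of the two variables. -/
theorem IsQuotientAveraging.norm_double_translate_sub_le (hν : IsQuotientAveraging ℓ Γ b q ν) (hb : 0 ≤ b)
    (hq : 0 ≤ q) {Φ : G → G → Y} (hΦ : Continuous Φ.uncurry) (h₁ : ∀ g g' (γ : Γ), Φ (g * γ) g' = Φ g g')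
    (h₂ : ∀ g g' (γ : Γ), Φ g (g' * γ) = Φ g g') {M a : ℝ} (ha : 0 ≤ a)
    (hM : ∀ g g', ‖Φ g g'‖ ≤ M * Real.exp (a * (ℓ g + ℓ g'))) (k : ℕ) (h h' : G) :
    ‖∫ g, ∫ g', Φ (h * g) (h' * g') ∂(ν k).measure ∂(ν k).measure -
      ∫ g, ∫ g', Φ g g' ∂(ν k).measure ∂(ν k).measure‖ ≤
      8 * M * Real.exp (a * (2 * b * (k + 2) + (ℓ h + ℓ h'))) * q ^ k := by
  have hM0 : 0 ≤ M := nonneg_of_mul_nonneg_left ((norm_nonneg _).trans (hM 1 1)) (Real.exp_pos _)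
  have hc : Continuous fun g => ∫ g', Φ g g' ∂(ν k).measure := (ν k).continuous_integral hΦ
  have hc' : ∀ g, Continuous (Φ g) := fun g => hΦ.comp (Continuous.prodMk_right g)
  have hc'' : Continuous fun g => ∫ g', Φ (h * g) (h' * g') ∂(ν k).measure :=
    (ν k).continuous_integral (f := fun g g' => Φ (h * g) (h' * g'))
      (hΦ.comp (f := fun p : G × G => (h * p.1, h' * p.2)) (by fun_prop))
  have e1 := hν.norm_translate_sub_le Y (fun g => ∫ g', Φ g g' ∂(ν k).measure)
    (M * Real.exp (a * (b * (k + 2)))) a hc (fun g γ => by simp only [h₁]) ha (fun g => by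
      refine CompactProb.norm_integral_le (hν.supportedIn k) fun g' hg' => (hM g g').trans ?_
      rw [mul_assoc, ← Real.exp_add, ← mul_add]
      have : ℓ g' ≤ b * (k + 1) := hg'
      gcongr M * Real.exp (a * ?_)
      linarith) k h
  have e2 : ‖∫ g, ((∫ g', Φ (h * g) (h' * g') ∂(ν k).measure) -
      ∫ g', Φ (h * g) g' ∂(ν k).measure) ∂(ν k).measure‖ ≤
      4 * M * Real.exp (a * (2 * b * (k + 2) + (ℓ h + ℓ h'))) * q ^ k := by
    refine CompactProb.norm_integral_le (hν.supportedIn k) fun g hg => ?_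
    refine (hν.norm_translate_sub_le Y (Φ (h * g)) (M * Real.exp (a * ℓ (h * g))) a (hc' _) (h₂ _) ha
      (fun g' => by
        rw [mul_assoc, ← Real.exp_add, ← mul_add]
        exact hM _ g') k h').trans ?_
    rw [← mul_assoc, mul_assoc (4 * M), ← Real.exp_add, ← mul_add]
    have : ℓ g ≤ b * (k + 1) := hg
    have := ℓ.map_mul_le h g
    gcongr 4 * M * Real.exp (a * ?_) * q ^ k
    linarith
  have hch : Continuous fun g => ∫ g', Φ (h * g) g' ∂(ν k).measure := hc.comp (continuous_const_mul h)
  rw [integral_sub ((ν k).integrable hc'') ((ν k).integrable hch)] at e2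
  have e3 : 4 * (M * Real.exp (a * (b * (k + 2)))) * Real.exp (a * (b * (k + 2) + ℓ h)) * q ^ k ≤
      4 * M * Real.exp (a * (2 * b * (k + 2) + (ℓ h + ℓ h'))) * q ^ k := by
    rw [← mul_assoc, mul_assoc (4 * M), ← Real.exp_add, ← mul_add]
    have := ℓ.nonneg h'
    gcongr 4 * M * Real.exp (a * ?_) * q ^ k
    linarith
  refine (norm_sub_le_norm_sub_add_norm_sub _ _ _).trans
    ((add_le_add e2 (e1.trans e3)).trans (le_of_eq (by ring)))

end DoubleAverages

/-! ### Limits over the lattice -/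

section LimitOperator

variable {G : Type u} [Group G] [TopologicalSpace G] [IsTopologicalGroup G] [T2Space G]
  [LocallyCompactSpace G] {Γ : Subgroup G} [DiscreteTopology Γ]
  [MeasurableSpace G] [BorelSpace G] {ℓ : LengthFunction G}
  {X₀ X₁ X₂ : Type u}
  [NormedAddCommGroup X₀] [NormedSpace ℂ X₀] [CompleteSpace X₀]
  [NormedAddCommGroup X₁] [NormedSpace ℂ X₁] [CompleteSpace X₁]
  [NormedAddCommGroup X₂] [NormedSpace ℂ X₂] [CompleteSpace X₂]

/-- The restriction of a two-step representation to a subgroup. -/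
def TwoStepRep.restrict (ρ : TwoStepRep G X₀ X₁ X₂) (Γ : Subgroup G) : TwoStepRep Γ X₀ X₁ X₂ where
  pi₀ γ := ρ.pi₀ γ
  pi₁ γ := ρ.pi₁ γ
  continuous₀ x := (ρ.continuous₀ x).comp continuous_subtype_val
  continuous₁ x := (ρ.continuous₁ x).comp continuous_subtype_val
  compat _ _ _ := ρ.compat _ _ _

theorem TwoStepRep.restrict_pi (ρ : TwoStepRep G X₀ X₁ X₂) (γ : Γ) :
    (ρ.restrict Γ).pi γ = ρ.pi γ := rfl

/-- The limits of the averages over the lattice of the translates `γ ↦ π (g γ g')` of a two-step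
representation of `G`. They are invariant under `Γ` on the inner sides, because the limits for `Γ` are
invariant under translation of the measures. They are strongly continuous in `(g, g')`, because the
convergence is locally uniform. -/
theorem StarEstimate.exists_limit {E : BanachClass.{u}} {s t C : ℝ} {m : ℕ → CompactProb Γ}
    (H : StarEstimate (ℓ.restrict Γ) E s t C m) (h1 : ℓ 1 = 0) (ht : 0 < t)
    (hm : (m 0).SupportedIn {γ | ℓ (γ : G) ≤ 0}) (hX : E X₁) {a : ℝ} (ha : 0 ≤ a) (has : a ≤ s)
    (ρ : TwoStepRep G X₀ X₁ X₂) {L : ℝ} (h₀ : ∀ g, ‖ρ.pi₀ g‖ ≤ L * Real.exp (a * ℓ g))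
    (h₁ : ∀ g, ‖ρ.pi₁ g‖ ≤ L * Real.exp (a * ℓ g)) :
    ∃ P : G → G → X₀ →L[ℂ] X₂,
      (∀ g g' (n : ℕ) x, ‖∫ γ, ρ.pi (g * (γ : G) * g') x ∂(m n).measure - P g g' x‖ ≤
        C * L ^ 2 * Real.exp (2 * a * (ℓ g + ℓ g')) * Real.exp (-(t * n)) * ‖x‖) ∧
      (∀ g g' (γ : Γ), P (g * γ) g' = P g g') ∧ (∀ g g' (γ : Γ), P g (γ * g') = P g g') ∧
      (∀ x, Continuous fun p : G × G => P p.1 p.2 x) ∧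
      ∀ g g', ‖P g g'‖ ≤ (1 + C) * L ^ 2 * Real.exp (2 * a * (ℓ g + ℓ g')) := by
  have hL : 0 ≤ L := TwoStepRep.nonneg_of_norm_le h₀
  have hexp : ∀ g g', (L * Real.exp (a * (ℓ g + ℓ g'))) ^ 2 = L ^ 2 * Real.exp (2 * a * (ℓ g + ℓ g')) :=
    fun g g' => by rw [mul_pow, ← Real.exp_nat_mul]; ring_nf
  have hb₀ : ∀ g g' (γ : Γ), ‖((ρ.shift g g').restrict Γ).pi₀ γ‖ ≤
      L * Real.exp (a * (ℓ g + ℓ g')) * Real.exp (s * ℓ.restrict Γ γ) := fun g g' γ => by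
    refine (h₀ ((γ : G) * g')).trans ?_
    rw [mul_assoc, ← Real.exp_add]
    gcongr
    have e1 := mul_le_mul_of_nonneg_left (ℓ.map_mul_le (γ : G) g') ha
    have e2 := mul_le_mul_of_nonneg_right has (ℓ.nonneg (γ : G))
    have e3 := mul_nonneg ha (ℓ.nonneg g)
    change _ ≤ _ + s * ℓ (γ : G)
    linarith
  have hb₁ : ∀ g g' (γ : Γ), ‖((ρ.shift g g').restrict Γ).pi₁ γ‖ ≤
      L * Real.exp (a * (ℓ g + ℓ g')) * Real.exp (s * ℓ.restrict Γ γ) := fun g g' γ => by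
    refine (h₁ (g * (γ : G))).trans ?_
    rw [mul_assoc, ← Real.exp_add]
    gcongr
    have e1 := mul_le_mul_of_nonneg_left (ℓ.map_mul_le g (γ : G)) ha
    have e2 := mul_le_mul_of_nonneg_right has (ℓ.nonneg (γ : G))
    have e3 := mul_nonneg ha (ℓ.nonneg g')
    change _ ≤ _ + s * ℓ (γ : G)
    linarith
  choose P hP hPinv using fun g g' => H X₀ X₁ X₂ ((ρ.shift g g').restrict Γ)
    (L * Real.exp (a * (ℓ g + ℓ g'))) hX (hb₀ g g') (hb₁ g g')
  have havg : ∀ g g' n x, ((ρ.shift g g').restrict Γ).average (m n) x =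
      ∫ γ, ρ.pi (g * (γ : G) * g') x ∂(m n).measure := fun g g' n x => by
    simp only [TwoStepRep.average_apply, TwoStepRep.restrict_pi, TwoStepRep.shift_pi]
  have hlim : ∀ g g', Tendsto (fun n => ((ρ.shift g g').restrict Γ).average (m n)) atTop (𝓝 (P g g')) := by
    intro g g'
    refine tendsto_iff_norm_sub_tendsto_zero.2 (squeeze_zero (fun _ => norm_nonneg _) (hP g g') ?_)
    have h := (tendsto_exp_neg_mul_natCast ht).const_mul (C * (L * Real.exp (a * (ℓ g + ℓ g'))) ^ 2)
    rwa [mul_zero] at h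
  have hlim' : ∀ g g' (γ δ : Γ), Tendsto (fun n => ((ρ.shift g g').restrict Γ).average ((m n).translate γ δ))
      atTop (𝓝 (P g g')) := fun g g' γ δ => by
    simpa using (tendsto_zero_iff_norm_tendsto_zero.2 (hPinv g g' γ δ)).add (hlim g g')
  have htr : ∀ g g' (γ δ : Γ) n, ((ρ.shift g g').restrict Γ).average ((m n).translate γ δ) =
      ((ρ.shift (g * γ) (δ * g')).restrict Γ).average (m n) := fun g g' γ δ n => by
    ext x
    rw [TwoStepRep.average_translate_apply, TwoStepRep.average_apply]
    simp only [TwoStepRep.restrict_pi, TwoStepRep.shift_pi, Subgroup.coe_mul, mul_assoc]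
  have hest : ∀ g g' (n : ℕ) x, ‖∫ γ, ρ.pi (g * (γ : G) * g') x ∂(m n).measure - P g g' x‖ ≤
      C * L ^ 2 * Real.exp (2 * a * (ℓ g + ℓ g')) * Real.exp (-(t * n)) * ‖x‖ := by
    intro g g' n x
    rw [← havg, mul_assoc C, ← hexp]
    exact (((ρ.shift g g').restrict Γ).average (m n) - P g g').le_of_opNorm_le (hP g g' n) x
  refine ⟨P, hest, fun g g' γ => ?_, fun g g' γ => ?_, fun x => ?_, fun g g' => ?_⟩
  · have h2 := hlim' g g' γ 1
    simp only [htr, Subgroup.coe_one, one_mul] at h2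
    exact tendsto_nhds_unique (hlim _ _) h2
  · have h2 := hlim' g g' 1 γ
    simp only [htr, Subgroup.coe_one, mul_one] at h2
    exact tendsto_nhds_unique (hlim _ _) h2
  · refine continuous_of_locally_uniform_approx_of_continuousAt fun p u hu => ?_
    obtain ⟨ε, hε, hεu⟩ := Metric.mem_uniformity_dist.1 hu
    obtain ⟨V, hV, hVp⟩ := exists_compact_mem_nhds p
    obtain ⟨b₁, -, hb₁⟩ := ℓ.exists_bound (hV.image continuous_fst)
    obtain ⟨b₂, -, hb₂⟩ := ℓ.exists_bound (hV.image continuous_snd)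
    have h := ((tendsto_exp_neg_mul_natCast ht).const_mul
      (|C| * L ^ 2 * Real.exp (2 * a * (b₁ + b₂)))).mul_const ‖x‖
    rw [mul_zero, zero_mul] at h
    obtain ⟨n, hn⟩ := (h.eventually_lt_const hε).exists
    refine ⟨V, hVp, fun p => ∫ γ, ρ.pi (p.1 * (γ : G) * p.2) x ∂(m n).measure, ?_, fun p' hp' => hεu ?_⟩
    · refine ((m n).continuous_integral (f := fun (p : G × G) (γ : Γ) => ρ.pi (p.1 * (γ : G) * p.2) x)
        ?_).continuousAt
      exact (ρ.continuous_pi x).comp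
        (f := fun p : (G × G) × Γ => p.1.1 * (p.2 : G) * p.1.2) (by fun_prop)
    · rw [dist_comm, dist_eq_norm]
      refine (hest _ _ n x).trans_lt (lt_of_le_of_lt ?_ hn)
      have e1 := hb₁ _ ⟨p', hp', rfl⟩
      have e2 := hb₂ _ ⟨p', hp', rfl⟩
      gcongr
      exact le_abs_self C
  · have e1 : ‖((ρ.shift g g').restrict Γ).average (m 0)‖ ≤ (L * Real.exp (a * (ℓ g + ℓ g'))) ^ 2 := by
      refine TwoStepRep.norm_average_le _ hm fun γ hγ => ?_
      refine (TwoStepRep.norm_pi_le (ℓ := ℓ.restrict Γ) _ h1 (hb₀ g g') (hb₁ g g') γ).trans ?_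
      have : ℓ.restrict Γ γ = 0 := le_antisymm hγ (ℓ.nonneg _)
      simp [this]
    have e2 := hP g g' 0
    have e3 : P g g' = ((ρ.shift g g').restrict Γ).average (m 0) -
      (((ρ.shift g g').restrict Γ).average (m 0) - P g g') := by abel
    rw [e3]
    refine (norm_sub_le_of_le e1 e2).trans (le_of_eq ?_)
    rw [hexp]
    simp
    ring

end LimitOperator

/-! ### From the lattice to the group -/

section Extension

variable {G : Type u} [Group G] [TopologicalSpace G] [IsTopologicalGroup G] [T2Space G]
  [LocallyCompactSpace G] {Γ : Subgroup G} [DiscreteTopology Γ]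
  [MeasurableSpace G] [BorelSpace G] {ℓ : LengthFunction G}
  {X₀ X₁ X₂ : Type u}
  [NormedAddCommGroup X₀] [NormedSpace ℂ X₀] [CompleteSpace X₀]
  [NormedAddCommGroup X₁] [NormedSpace ℂ X₁] [CompleteSpace X₁]
  [NormedAddCommGroup X₂] [NormedSpace ℂ X₂] [CompleteSpace X₂]

/-- For measures `M n = ν n * m n * ν̌ n`, the operators `π(M n)` and their translates `π(δ_h * M n * δ_h')`
are exponentially close to `Q n x = ∫∫ P g g'⁻¹ x dν n(g) dν n(g')`, where `P g g'` is the limit of the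
averages of `γ ↦ π (g γ g')`. Both the invariance and the Cauchy property of `M n` follow from those
of the double averages of the right `Γ`-invariant function `(g, g') ↦ P g g'⁻¹ x`. -/
theorem StarEstimate.norm_average_sub_double_le {E : BanachClass.{u}} {s t C b q θ : ℝ}
    {m : ℕ → CompactProb Γ} {ν M : ℕ → CompactProb G}
    (H : StarEstimate (ℓ.restrict Γ) E s t C m) (h1 : ℓ 1 = 0) (ht : 2 * θ ≤ t) (hθ : 0 < θ) (hC : 0 ≤ C)
    (hm : (m 0).SupportedIn {γ | ℓ (γ : G) ≤ 0}) (hν : IsQuotientAveraging ℓ Γ b q ν) (hb : 0 ≤ b)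
    (hq : 0 < q) (hqθ : q ≤ Real.exp (-(2 * θ)))
    (hM : ∀ (n : ℕ) (Y : Type u) [NormedAddCommGroup Y] [NormedSpace ℝ Y] [CompleteSpace Y] (f : G → Y),
        Continuous f → ∫ g, f g ∂(M n).measure =
          ∫ g, ∫ g', ∫ γ, f (g * (γ : G) * g'⁻¹) ∂(m n).measure ∂(ν n).measure ∂(ν n).measure)
    (hX : E X₁) {a : ℝ} (ha : 0 ≤ a) (has : a ≤ s) (hab : 4 * a * b ≤ θ)
    (ρ : TwoStepRep G X₀ X₁ X₂) {L : ℝ} (h₀ : ∀ g, ‖ρ.pi₀ g‖ ≤ L * Real.exp (a * ℓ g))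
    (h₁ : ∀ g, ‖ρ.pi₁ g‖ ≤ L * Real.exp (a * ℓ g)) :
    ∃ Q : ℕ → X₀ → X₂,
      (∀ n x, ‖Q (n + 1) x - Q n x‖ ≤ 8 * (1 + C) * Real.exp (2 * θ) * L ^ 2 * Real.exp (-(θ * n)) * ‖x‖) ∧
      ∀ n x h h', ‖ρ.average ((M n).translate h h') x - Q n x‖ ≤
        (C * Real.exp θ + 8 * (1 + C) * Real.exp (2 * θ)) * Real.exp (2 * a * (ℓ h + ℓ h')) * L ^ 2 *
          Real.exp (-(θ * n)) * ‖x‖ := by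
  have ht0 : 0 < t := by linarith
  obtain ⟨P, hP, hPl, hPr, hPc, hPn⟩ := H.exists_limit h1 ht0 hm hX ha has ρ h₀ h₁
  let Φ : X₀ → G → G → X₂ := fun x g g' => P g g'⁻¹ x
  have hΦc : ∀ x, Continuous (Φ x).uncurry := fun x =>
    (hPc x).comp (f := fun p : G × G => (p.1, p.2⁻¹)) (by fun_prop)
  have hΦ₁ : ∀ x g g' (γ : Γ), Φ x (g * γ) g' = Φ x g g' := fun x g g' γ => by simp only [Φ, hPl]
  have hΦ₂ : ∀ x g g' (γ : Γ), Φ x g (g' * γ) = Φ x g g' := fun x g g' γ => by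
    have := hPr g g'⁻¹ γ⁻¹
    simp only [Φ, mul_inv_rev]
    rw [Subgroup.coe_inv] at this
    rw [this]
  have hΦn : ∀ x g g', ‖Φ x g g'‖ ≤ (1 + C) * L ^ 2 * ‖x‖ * Real.exp (2 * a * (ℓ g + ℓ g')) := fun x g g' => by
    refine ((P g g'⁻¹).le_of_opNorm_le (hPn g g'⁻¹) x).trans (le_of_eq ?_)
    rw [ℓ.map_inv]
    ring
  have hqn : ∀ n : ℕ, q ^ n ≤ Real.exp (-(2 * θ * n)) := fun n => by
    refine (pow_le_pow_left₀ hq.le hqθ n).trans (le_of_eq ?_)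
    rw [← Real.exp_nat_mul]
    ring_nf
  have h2a : 0 ≤ 2 * a := by linarith
  -- the growth of the averaged functions is compensated by the speed of the averages
  have hrate : ∀ (n : ℕ) (r : ℝ), Real.exp (2 * a * (2 * b * (n + 2) + r)) * q ^ n ≤
      Real.exp (2 * θ) * Real.exp (2 * a * r) * Real.exp (-(θ * n)) := fun n r => by
    refine (mul_le_mul_of_nonneg_left (hqn n) (Real.exp_pos _).le).trans ?_
    rw [← Real.exp_add, ← Real.exp_add, ← Real.exp_add]
    refine Real.exp_le_exp.2 ?_
    have h2 : (0 : ℝ) ≤ n := n.cast_nonneg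
    nlinarith [mul_le_mul_of_nonneg_right hab (by positivity : (0 : ℝ) ≤ n + 2)]
  refine ⟨fun n x => ∫ g, ∫ g', Φ x g g' ∂(ν n).measure ∂(ν n).measure, fun n x => ?_, fun n x h h' => ?_⟩
  · refine (hν.norm_double_sub_le hb hq.le (hΦc x) (hΦ₁ x) (hΦ₂ x) h2a (hΦn x) n).trans ?_
    have h2 := hrate n 0
    rw [add_zero, mul_zero, Real.exp_zero, mul_one] at h2
    calc _ = 8 * ((1 + C) * L ^ 2 * ‖x‖) * (Real.exp (2 * a * (2 * b * (n + 2))) * q ^ n) := by ring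
      _ ≤ 8 * ((1 + C) * L ^ 2 * ‖x‖) * (Real.exp (2 * θ) * Real.exp (-(θ * n))) := by gcongr
      _ = _ := by ring
  · have hcont : Continuous fun g => ρ.pi (h * g * h') x :=
      (ρ.continuous_pi x).comp (f := fun g => h * g * h') (by fun_prop)
    have hc1 : Continuous fun p : G × G => ∫ γ, ρ.pi (h * (p.1 * (γ : G) * p.2⁻¹) * h') x ∂(m n).measure :=
      (m n).continuous_integral (f := fun (p : G × G) (γ : Γ) => ρ.pi (h * (p.1 * (γ : G) * p.2⁻¹) * h') x)
        ((ρ.continuous_pi x).comp (f := fun p : (G × G) × Γ => h * (p.1.1 * (p.2 : G) * p.1.2⁻¹) * h')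
          (by fun_prop))
    have hc2 : Continuous fun p : G × G => Φ x (h * p.1) (h'⁻¹ * p.2) :=
      (hΦc x).comp (f := fun p : G × G => (h * p.1, h'⁻¹ * p.2)) (by fun_prop)
    rw [TwoStepRep.average_translate_apply, hM n X₂ _ hcont]
    have e1 : ‖∫ g, ∫ g', ((∫ γ, ρ.pi (h * (g * (γ : G) * g'⁻¹) * h') x ∂(m n).measure) -
        Φ x (h * g) (h'⁻¹ * g')) ∂(ν n).measure ∂(ν n).measure‖ ≤
        C * Real.exp θ * Real.exp (2 * a * (ℓ h + ℓ h')) * L ^ 2 * Real.exp (-(θ * n)) * ‖x‖ := by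
      refine CompactProb.norm_integral_le (hν.supportedIn n) fun g hg =>
        CompactProb.norm_integral_le (hν.supportedIn n) fun g' hg' => ?_
      have h2 := hP (h * g) (g'⁻¹ * h') n x
      have h3 : ∀ γ : Γ, h * (g * (γ : G) * g'⁻¹) * h' = h * g * γ * (g'⁻¹ * h') := fun γ => by group
      have h4 : (h'⁻¹ * g')⁻¹ = g'⁻¹ * h' := by group
      simp only [h3, Φ, h4]
      refine h2.trans ?_
      have h5 : Real.exp (2 * a * (ℓ (h * g) + ℓ (g'⁻¹ * h'))) * Real.exp (-(t * n)) ≤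
          Real.exp θ * Real.exp (2 * a * (ℓ h + ℓ h')) * Real.exp (-(θ * n)) := by
        rw [← Real.exp_add, ← Real.exp_add, ← Real.exp_add]
        refine Real.exp_le_exp.2 ?_
        have e1 : ℓ (h * g) ≤ ℓ h + b * (n + 1) := (ℓ.map_mul_le h g).trans (by gcongr; exact hg)
        have e2 : ℓ (g'⁻¹ * h') ≤ b * (n + 1) + ℓ h' := by
          refine (ℓ.map_mul_le _ _).trans ?_
          rw [ℓ.map_inv]
          gcongr
          exact hg'
        have e3 : (0 : ℝ) ≤ n := n.cast_nonneg
        have e4 := mul_le_mul_of_nonneg_right ht e3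
        have e5 := mul_le_mul_of_nonneg_right hab (by positivity : (0 : ℝ) ≤ n + 1)
        have e6 := mul_le_mul_of_nonneg_left (add_le_add e1 e2) h2a
        linarith
      calc _ = C * L ^ 2 * ‖x‖ * (Real.exp (2 * a * (ℓ (h * g) + ℓ (g'⁻¹ * h'))) * Real.exp (-(t * n))) := by ring
        _ ≤ C * L ^ 2 * ‖x‖ * (Real.exp θ * Real.exp (2 * a * (ℓ h + ℓ h')) * Real.exp (-(θ * n))) := by gcongr
        _ = _ := by ring
    have e2 := hν.norm_double_translate_sub_le hb hq.le (hΦc x) (hΦ₁ x) (hΦ₂ x) h2a (hΦn x) n h h'⁻¹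
    have e3 : 8 * ((1 + C) * L ^ 2 * ‖x‖) * Real.exp (2 * a * (2 * b * (n + 2) + (ℓ h + ℓ h'⁻¹))) * q ^ n ≤
        8 * (1 + C) * Real.exp (2 * θ) * Real.exp (2 * a * (ℓ h + ℓ h')) * L ^ 2 * Real.exp (-(θ * n)) * ‖x‖ := by
      have h2 := hrate n (ℓ h + ℓ h'⁻¹)
      rw [ℓ.map_inv] at h2 ⊢
      calc _ = 8 * ((1 + C) * L ^ 2 * ‖x‖) * (Real.exp (2 * a * (2 * b * (n + 2) + (ℓ h + ℓ h'))) * q ^ n) := by ring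
        _ ≤ 8 * ((1 + C) * L ^ 2 * ‖x‖) * (Real.exp (2 * θ) * Real.exp (2 * a * (ℓ h + ℓ h')) * Real.exp (-(θ * n))) := by
          gcongr
        _ = _ := by ring
    have hsplit : ∫ g, ∫ g', ((∫ γ, ρ.pi (h * (g * (γ : G) * g'⁻¹) * h') x ∂(m n).measure) -
        Φ x (h * g) (h'⁻¹ * g')) ∂(ν n).measure ∂(ν n).measure =
        (∫ g, ∫ g', ∫ γ, ρ.pi (h * (g * (γ : G) * g'⁻¹) * h') x ∂(m n).measure ∂(ν n).measure ∂(ν n).measure) -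
        ∫ g, ∫ g', Φ x (h * g) (h'⁻¹ * g') ∂(ν n).measure ∂(ν n).measure := by
      rw [← integral_sub ((ν n).integrable ((ν n).continuous_integral
        (f := fun g g' => ∫ γ, ρ.pi (h * (g * (γ : G) * g'⁻¹) * h') x ∂(m n).measure) hc1)) ((ν n).integrable ((ν n).continuous_integral
        (f := fun g g' => Φ x (h * g) (h'⁻¹ * g')) hc2))]
      congr 1; ext g
      exact integral_sub ((ν n).integrable (hc1.comp (Continuous.prodMk_right g)))
        ((ν n).integrable (hc2.comp (Continuous.prodMk_right g)))
    rw [hsplit] at e1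
    refine (norm_sub_le_norm_sub_add_norm_sub _ _ _).trans
      ((add_le_add e1 (e2.trans e3)).trans (le_of_eq (by ring)))

/-- Property `(*_E)` passes from a lattice to the ambient locally compact group, provided that the class
contains a non-zero space. The rate `θ` is half the smaller of the rates for `Γ` and for the averages
on `G ⧸ Γ`. The exponent `a` for `G` is so small that the growth `e^{2 a (ℓ g + ℓ g')}` over the support
of `ν n`, of length at most `b (n + 1)`, uses up no more than the other half. -/
theorem HasStarFor.of_restrict [MeasurableSpace (G ⧸ Γ)] [BorelSpace (G ⧸ Γ)] (μ : Measure (G ⧸ Γ))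
    [IsProbabilityMeasure μ] [SMulInvariantMeasure G (G ⧸ Γ) μ] [μ.Regular] {E : BanachClass.{u}}
    (hE : E.StableL2) {X : Type u} [NormedAddCommGroup X] [NormedSpace ℂ X] [CompleteSpace X]
    [Nontrivial X] (hX : E X) (hΓ : HasStarFor Γ (ℓ.restrict Γ) E) : HasStarFor G ℓ E := by
  have h1 : ℓ 1 = 0 := hΓ.length_one
  obtain ⟨b, q, ν, hb, hq0, hq1, hν⟩ := exists_isQuotientAveraging μ hE hX hΓ
  obtain ⟨s, t, C, hs, ht, hC, m, hm, H⟩ := hasStarFor_iff.1 hΓ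
  have hlog : 0 < -Real.log q := neg_pos.2 (Real.log_neg hq0 hq1)
  set θ := min t (-Real.log q) / 2 with hθdef
  have hθ : 0 < θ := half_pos (lt_min ht hlog)
  have hθt : 2 * θ ≤ t := by
    have := min_le_left t (-Real.log q)
    linarith
  have hθq : q ≤ Real.exp (-(2 * θ)) := by
    rw [← Real.log_le_iff_le_exp hq0]
    have := min_le_right t (-Real.log q)
    linarith
  set a := min s (θ / (4 * (b + 1))) with hadef
  have ha : 0 < a := lt_min hs (by positivity)
  have hab : 4 * a * b ≤ θ := by
    have h2 : a ≤ θ / (4 * (b + 1)) := min_le_right _ _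
    rw [le_div_iff₀ (by positivity)] at h2
    nlinarith
  have hm0 : (m 0).SupportedIn {γ : Γ | ℓ (γ : G) ≤ 0} := by
    have h2 := hm 0
    rw [Nat.cast_zero] at h2
    exact h2
  choose M hMS hM using fun n => CompactProb.exists_sandwich (ν n) (m n)
  obtain ⟨N, hN⟩ := exists_nat_ge (2 * b)
  set r := Real.exp (-θ) with hr
  have hr0 : 0 < r := Real.exp_pos _
  have hr1 : r < 1 := Real.exp_lt_one_iff.2 (neg_neg_of_pos hθ)
  have hrn : ∀ n : ℕ, Real.exp (-(θ * n)) = r ^ n := fun n => by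
    rw [hr, ← Real.exp_nat_mul]; ring_nf
  set D := C * Real.exp θ + 8 * (1 + C) * Real.exp (2 * θ) with hD
  set D' := 8 * (1 + C) * Real.exp (2 * θ) with hD'
  have hD0 : 0 < D := by positivity
  have hD'0 : 0 < D' := by positivity
  refine hasStarFor_of_linear_support (s := a) (t := θ) (C := (2 * D + D') / (1 - r)) h1 ha hθ
    (div_pos (by positivity) (by linarith)) (Nat.succ_pos N) (M := M) ?_ ?_
  · intro n
    refine (hMS n _ _ (hν.supportedIn n) (hm n)).mono ?_
    rintro _ ⟨g, hg, _, ⟨_, ⟨γ, hγ, rfl⟩, g', hg', rfl⟩, rfl⟩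
    have e1 : ℓ g ≤ b * (n + 1) := hg
    have e2 : ℓ (γ : G) ≤ n := hγ
    have e3 : ℓ g' ≤ b * (n + 1) := by
      rw [← ℓ.map_inv]
      exact hg'
    have e4 := ℓ.map_mul_le g (γ * g')
    have e5 := ℓ.map_mul_le (γ : G) g'
    have e6 : (0 : ℝ) ≤ n := n.cast_nonneg
    change ℓ (g * (γ * g')) ≤ (N + 1 : ℕ) * ((n : ℝ) + 1)
    push_cast
    nlinarith [mul_le_mul_of_nonneg_right hN (by positivity : (0 : ℝ) ≤ n + 1)]
  · intro X₀ X₁ X₂ _ _ _ _ _ _ _ _ _ ρ L hX₁ h₀ h₁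
    obtain ⟨Q, hQ, hQM⟩ := H.norm_average_sub_double_le h1 hθt hθ hC.le hm0 hν hb hq0 hθq hM hX₁ ha.le
      (min_le_left _ _) hab ρ h₀ h₁
    have hone : ∀ n, ρ.average ((M n).translate 1 1) = ρ.average (M n) := fun n => by
      ext x
      rw [TwoStepRep.average_translate_apply, TwoStepRep.average_apply]
      simp only [one_mul, mul_one]
    have hQM1 : ∀ n x, ‖ρ.average (M n) x - Q n x‖ ≤ D * L ^ 2 * r ^ n * ‖x‖ := fun n x => by
      have h2 := hQM n x 1 1
      rwa [hone, h1, add_zero, mul_zero, Real.exp_zero, mul_one, hrn] at h2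
    have hstep : ∀ n, dist (ρ.average (M n)) (ρ.average (M (n + 1))) ≤ (2 * D + D') * L ^ 2 * r ^ n := by
      intro n
      rw [dist_comm, dist_eq_norm]
      refine ContinuousLinearMap.opNorm_le_bound _ (by positivity) fun x => ?_
      have e1 := hQM1 n x
      have e2 : ‖ρ.average (M (n + 1)) x - Q (n + 1) x‖ ≤ D * L ^ 2 * r ^ n * ‖x‖ := by
        refine (hQM1 (n + 1) x).trans ?_
        gcongr D * L ^ 2 * ?_ * ‖x‖
        exact pow_le_pow_of_le_one hr0.le hr1.le (Nat.le_succ n)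
      have e3 : ‖Q (n + 1) x - Q n x‖ ≤ D' * L ^ 2 * r ^ n * ‖x‖ := by
        rw [← hrn]; exact hQ n x
      have e4 : (ρ.average (M (n + 1)) - ρ.average (M n)) x = (ρ.average (M (n + 1)) x - Q (n + 1) x) +
          (Q (n + 1) x - Q n x) - (ρ.average (M n) x - Q n x) := by
        rw [sub_apply]; abel
      rw [e4]
      refine (norm_sub_le_of_le (norm_add_le_of_le e2 e3) e1).trans (le_of_eq (by ring))
    obtain ⟨P, hP⟩ := cauchySeq_tendsto_of_complete (cauchySeq_of_le_geometric r _ hr1 hstep)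
    refine ⟨P, fun n => ?_, fun g g' => ?_⟩
    · rw [← dist_eq_norm, hrn]
      refine (dist_le_of_le_geometric_of_tendsto r _ hr1 hstep hP n).trans (le_of_eq ?_)
      field_simp
    · set κ := Real.exp (2 * a * (ℓ g + ℓ g'))
      have hbound : ∀ n : ℕ, ‖ρ.average ((M n).translate g g') - ρ.average (M n)‖ ≤
          (D * κ + D) * L ^ 2 * r ^ n := by
        intro n
        refine ContinuousLinearMap.opNorm_le_bound _ (by positivity) fun x => ?_
        have e1 := hQM n x g g'
        rw [hrn] at e1
        have e4 : (ρ.average ((M n).translate g g') - ρ.average (M n)) x =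
            (ρ.average ((M n).translate g g') x - Q n x) - (ρ.average (M n) x - Q n x) := by
          rw [sub_apply]; abel
        rw [e4]
        refine (norm_sub_le_of_le e1 (hQM1 n x)).trans (le_of_eq (by ring))
      refine squeeze_zero (fun _ => norm_nonneg _) hbound ?_
      have := (tendsto_pow_atTop_nhds_zero_of_lt_one hr0.le hr1).const_mul ((D * κ + D) * L ^ 2)
      rwa [mul_zero] at this

end Extension

/-! ### The class of Hilbert spaces -/

section Classes

/-- Square integrable functions with values in a Hilbert space form a Hilbert space. -/
theorem stableL2_hilbertClass : HilbertClass.{u}.StableL2 := by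
  intro X _ _ _ Ω _ μ hX
  obtain ⟨h, rfl⟩ := hX
  exact ⟨L2.innerProductSpace, rfl⟩

end Classes

theorem mainTheorem6 {G : Type u} [Group G] [TopologicalSpace G] [IsTopologicalGroup G]
    [LocallyCompactSpace G] [T2Space G] [MeasurableSpace G] [BorelSpace G]
    (Γ : Subgroup G) (hΓ : IsLatticeSubgroup Γ) (ℓ : LengthFunction G) :
    (HasStar G ℓ ↔ HasStar Γ (ℓ.restrict Γ)) ∧
    ∀ E : BanachClass.{u}, E.StableL2 →
      (HasStarFor G ℓ E ↔ HasStarFor Γ (ℓ.restrict Γ) E) := by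
  suffices h : ∀ E : BanachClass.{u}, E.StableL2 →
      (HasStarFor G ℓ E ↔ HasStarFor Γ (ℓ.restrict Γ) E) from ⟨h _ stableL2_hilbertClass, h⟩
  intro E hE
  have hdiscrete := hΓ.discrete
  obtain ⟨_, _, μ, _, _, _⟩ := hΓ.exists_invariant
  by_cases htriv : ∀ (X : Type u) [NormedAddCommGroup X] [NormedSpace ℂ X] [CompleteSpace X], E X →
      Subsingleton X
  · exact ⟨fun h => hasStarFor_of_subsingleton h.length_one htriv,
      fun h => hasStarFor_of_subsingleton h.length_one htriv⟩
  · push Not at htriv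
    obtain ⟨X, _, _, _, hX, hXn⟩ := htriv
    exact ⟨HasStarFor.restrict μ hE hX, HasStarFor.of_restrict μ hE hX⟩
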